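/- Let $\mathcal H=L^2[0,\infty[$ (complex-valued). For $\alpha\in\mathbb C$ let $L_\alpha=-\partial_x^2+\left(-\tfrac14+\alpha\right)\frac1{x^2}$. Let $L_\alpha^{\min}$ be the closure in $\mathcal H$ of $L_\alpha$ restricted to $C_c^\infty(]0,\infty[)$, and let $L_\alpha^{\max}$ be $L_\alpha$ (in the sense of distributions on $]0,\infty[$) on the domain $\{f\in\mathcal H : L_\alpha f\in\mathcal H\}$. For $m\in\mathbb C$ with $|\operatorname{Re} m|<1$ and $\kappa\in\mathbb C\cup\{\infty\}$ let $H_{m,\kappa}$ be the restriction of $L_{m^2}^{\max}$ to those $f\in \mathrm{Dom}(L_{m^2}^{\max})$ for which there is $c\in\mathbb C$ such that $$f(x)-c\,\bigl(x^{1/2-m}+\kappa x^{1/2+m}\bigr)\in \mathrm{Dom}(L_{m^2}^{\min})\ \text{ around } 0\qquad(\kappa\ne\infty),$$ $$f(x)-c\,x^{1/2+m}\in \mathrm{Dom}(L_{m^2}^{\min})\ \text{ around } 0\qquad(\kappa=\infty),$$ where "around $0$" means: coincides almost everywhere on some interval $]0,\varepsilon[$, $\varepsilon>0$, with an element of that domain.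 Then: 1. If $m\in\,]-1,1[$ and $\kappa\ge 0$ or $\kappa=\infty$, then $H_{m,\kappa}$ has no eigenvalues. 2. If $m\in\,]-1,1[$, $m\neq 0$ and $\kappa<0$, then $H_{m,\kappa}$ has exactly one eigenvalue, namely $$-4\left(\frac{\kappa\,\Gamma(m)}{\Gamma(-m)}\right)^{1/m}.$$ 3. If $m=\mathrm i m_{\mathrm I}$ with $m_{\mathrm I}\in\mathbb R\setminus\{0\}$ and $|\kappa|=1$, then $H_{m,\kappa}$ has infinitely many eigenvalues, which accumulate at $-\infty$ and at $0$: for every $R\in\mathbb R$ there are infinitely many real eigenvalues below $R$, and for every $\varepsilon>0$ infinitely many in $]-\varepsilon,0[$. Moreover, if $\alpha\in\mathbb R$ satisfies $\mathrm e^{\mathrm i\alpha}=\dfrac{\Gamma(-\mathrm i m_{\mathrm I})}{\kappa\,\Gamma(\mathrm i m_{\mathrm I})}$, then the set of eigenvalues is exactly $$\left\{-4\exp\left(-\frac{\alpha+2\pi n}{m_{\mathrm I}}\right) : n\in\mathbb Z\right\}.$$ -/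

import Mathlib

open MeasureTheory Set

noncomputable section

namespace AlmostHomogeneous

/-- Lebesgue measure on the half-line `]0,∞[`. -/
abbrev halfLine : Measure ℝ := volume.restrict (Ioi 0)

/-- The Hilbert space `L²[0,∞[` of complex-valued functions. -/
abbrev L2HalfLine : Type := Lp ℂ 2 halfLine

/-- `φ ∈ C_c^∞(]0,∞[)`, extended by zero to `ℝ`. -/
structure IsTestFunction (φ : ℝ → ℂ) : Prop where
  smooth : ContDiff ℝ ((⊤ : ℕ∞) : WithTop ℕ∞) φ
  compact : HasCompactSupport φ
  support : tsupport φ ⊆ Ioi 0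

/-- The differential expression `L_α φ = -φ'' + (-1/4 + α) x⁻² φ`. -/
def diffExpr (α : ℂ) (φ : ℝ → ℂ) (x : ℝ) : ℂ :=
  -deriv (deriv φ) x + (-(1 / 4) + α) / (x : ℂ) ^ 2 * φ x

/-! ### Elementary facts on test functions -/

theorem IsTestFunction.zero : IsTestFunction (0 : ℝ → ℂ) :=
  ⟨contDiff_const, HasCompactSupport.zero, by simp [tsupport]⟩

theorem IsTestFunction.add {φ ψ : ℝ → ℂ} (hφ : IsTestFunction φ) (hψ : IsTestFunction ψ) :
    IsTestFunction (φ + ψ) :=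
  ⟨hφ.smooth.add hψ.smooth, hφ.compact.add hψ.compact,
    (tsupport_add φ ψ).trans (union_subset hφ.support hψ.support)⟩

theorem IsTestFunction.smul {φ : ℝ → ℂ} (c : ℂ) (hφ : IsTestFunction φ) :
    IsTestFunction (c • φ) :=
  ⟨hφ.smooth.const_smul c, hφ.compact.smul_left (f := fun _ => c),
    (tsupport_smul_subset_right (fun _ => c) φ).trans hφ.support⟩

theorem IsTestFunction.differentiable {φ : ℝ → ℂ} (hφ : IsTestFunction φ) :
    Differentiable ℝ φ := hφ.smooth.differentiable (by simp)

theorem IsTestFunction.deriv {φ : ℝ → ℂ} (hφ : IsTestFunction φ) :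
    IsTestFunction (deriv φ) :=
  ⟨((contDiff_infty_iff_deriv).1 hφ.smooth).2, hφ.compact.deriv,
    tsupport_deriv_subset.trans hφ.support⟩

theorem diffExpr_add (α : ℂ) {φ ψ : ℝ → ℂ} (hφ : IsTestFunction φ) (hψ : IsTestFunction ψ) :
    diffExpr α (φ + ψ) = diffExpr α φ + diffExpr α ψ := by
  have h1 : deriv (φ + ψ) = deriv φ + deriv ψ := by
    ext x; exact deriv_add hφ.differentiable.differentiableAt hψ.differentiable.differentiableAt
  have h2 : deriv (deriv φ + deriv ψ) = deriv (deriv φ) + deriv (deriv ψ) := by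
    ext x
    exact deriv_add hφ.deriv.differentiable.differentiableAt
      hψ.deriv.differentiable.differentiableAt
  ext x
  simp only [diffExpr, h1, h2, Pi.add_apply]
  ring

theorem diffExpr_smul (α c : ℂ) {φ : ℝ → ℂ} (hφ : IsTestFunction φ) :
    diffExpr α (c • φ) = c • diffExpr α φ := by
  have h1 : deriv (c • φ) = c • deriv φ := by
    ext x; exact deriv_const_smul c hφ.differentiable.differentiableAt
  have h2 : deriv (c • deriv φ) = c • deriv (deriv φ) := by
    ext x; exact deriv_const_smul c hφ.deriv.differentiable.differentiableAt
  ext x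
  simp only [diffExpr, h1, h2, Pi.smul_apply, smul_eq_mul]
  ring

theorem IsTestFunction.continuous_potential {φ : ℝ → ℂ} (hφ : IsTestFunction φ) (α : ℂ) :
    Continuous fun x : ℝ => (-(1 / 4) + α) / (x : ℂ) ^ 2 * φ x := by
  rw [continuous_iff_continuousAt]
  intro x
  by_cases hx : x ∈ tsupport φ
  · have h0 : (x : ℂ) ^ 2 ≠ 0 := by
      have : (0 : ℝ) < x := hφ.support hx
      simpa using this.ne'
    refine ContinuousAt.mul (ContinuousAt.div continuousAt_const ?_ h0)
      hφ.smooth.continuous.continuousAt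
    exact (Complex.continuous_ofReal.pow 2).continuousAt
  · have h := notMem_tsupport_iff_eventuallyEq.1 hx
    refine (continuousAt_const (y := (0 : ℂ))).congr ?_
    filter_upwards [h] with y hy
    simp [hy]

theorem IsTestFunction.continuous_diffExpr {φ : ℝ → ℂ} (hφ : IsTestFunction φ) (α : ℂ) :
    Continuous (diffExpr α φ) :=
  hφ.deriv.deriv.smooth.continuous.neg.add (hφ.continuous_potential α)

theorem IsTestFunction.compact_diffExpr {φ : ℝ → ℂ} (hφ : IsTestFunction φ) (α : ℂ) :
    HasCompactSupport (diffExpr α φ) :=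
  hφ.deriv.deriv.compact.neg.add
    (hφ.compact.mul_left (f := fun x : ℝ => (-(1 / 4) + α) / (x : ℂ) ^ 2))


theorem integrable_pairing {ψ : ℝ → ℂ} (hψ : Continuous ψ) (hc : HasCompactSupport ψ)
    (f : L2HalfLine) : Integrable (fun x => f x * ψ x) halfLine :=
  (Lp.memLp f).integrable_mul
    (show MemLp ψ 2 halfLine from hψ.memLp_of_hasCompactSupport hc)

theorem continuous_pairing {ψ : ℝ → ℂ} (hψ : Continuous ψ) (hc : HasCompactSupport ψ) :
    Continuous fun f : L2HalfLine => ∫ x, f x * ψ x ∂halfLine := by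
  have hm : MemLp (fun x => (starRingEnd ℂ) (ψ x)) 2 halfLine :=
    (Complex.continuous_conj.comp hψ).memLp_of_hasCompactSupport
      (hc.comp_left (g := (starRingEnd ℂ)) (map_zero _))
  have key : (fun f : L2HalfLine => ∫ x, f x * ψ x ∂halfLine) =
      fun f => inner ℂ (hm.toLp _) f := by
    ext f
    rw [L2.inner_def]
    refine integral_congr_ae ?_
    filter_upwards [hm.coeFn_toLp] with x hx
    simp [hx]
  rw [key]
  exact continuous_const.inner continuous_id

/-! ### The maximal operator -/

/-- The graph of the maximal operator: pairs `(f, g)` in `L² × L²` with `L_α f = g` in the sense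
of distributions on `]0,∞[`. -/
def maxGraph (α : ℂ) : Submodule ℂ (L2HalfLine × L2HalfLine) where
  carrier := {p | ∀ φ : ℝ → ℂ, IsTestFunction φ →
    ∫ x, p.1 x * diffExpr α φ x ∂halfLine = ∫ x, p.2 x * φ x ∂halfLine}
  zero_mem' := by
    intro φ _
    have h : ∀ ψ : ℝ → ℂ, ∫ x, (0 : L2HalfLine) x * ψ x ∂halfLine = 0 := by
      intro ψ
      refine integral_eq_zero_of_ae ?_
      filter_upwards [Lp.coeFn_zero ℂ 2 halfLine] with x hx
      rw [hx, Pi.zero_apply, zero_mul]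
    exact (h _).trans (h _).symm
  add_mem' := by
    rintro p q hp hq φ hφ
    have h : ∀ (u v : L2HalfLine) (ψ : ℝ → ℂ), Continuous ψ → HasCompactSupport ψ →
        ∫ x, (u + v : L2HalfLine) x * ψ x ∂halfLine =
          ∫ x, u x * ψ x ∂halfLine + ∫ x, v x * ψ x ∂halfLine := by
      intro u v ψ hψ hc
      rw [← integral_add (integrable_pairing hψ hc u) (integrable_pairing hψ hc v)]
      refine integral_congr_ae ?_
      filter_upwards [Lp.coeFn_add u v] with x hx
      rw [hx, Pi.add_apply, add_mul]
    rw [Prod.fst_add, Prod.snd_add, h _ _ _ (hφ.continuous_diffExpr α) (hφ.compact_diffExpr α),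
      h _ _ _ hφ.smooth.continuous hφ.compact, hp φ hφ, hq φ hφ]
  smul_mem' := by
    rintro c p hp φ hφ
    have h : ∀ (u : L2HalfLine) (ψ : ℝ → ℂ),
        ∫ x, (c • u : L2HalfLine) x * ψ x ∂halfLine = c * ∫ x, u x * ψ x ∂halfLine := by
      intro u ψ
      rw [← integral_const_mul]
      refine integral_congr_ae ?_
      filter_upwards [Lp.coeFn_smul c u] with x hx
      rw [hx, Pi.smul_apply, smul_eq_mul, mul_assoc]
    rw [Prod.smul_fst, Prod.smul_snd, h, h, hp φ hφ]

theorem maxGraph_single_valued (α : ℂ) (p : L2HalfLine × L2HalfLine) (hp : p ∈ maxGraph α)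
    (h0 : p.1 = 0) : p.2 = 0 := by
  have hloc : LocallyIntegrableOn (p.2 : ℝ → ℂ) (Ioi 0) volume := by
    intro x _
    have h1 : LocallyIntegrable (p.2 : ℝ → ℂ) halfLine :=
      (Lp.memLp p.2).locallyIntegrable (by norm_num)
    obtain ⟨u, hu, hi⟩ := h1 x
    refine ⟨u ∩ Ioi 0, Filter.inter_mem (mem_nhdsWithin_of_mem_nhds hu) self_mem_nhdsWithin, ?_⟩
    rwa [IntegrableOn, Measure.restrict_restrict₀' measurableSet_Ioi.nullMeasurableSet] at hi
  have key := isOpen_Ioi.ae_eq_zero_of_integral_contDiff_smul_eq_zero hloc (by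
    intro g hg hc hs
    have hφ : IsTestFunction (fun x => (g x : ℂ)) := by
      refine ⟨Complex.ofRealCLM.contDiff.comp hg,
        hc.comp_left (g := fun y : ℝ => (y : ℂ)) Complex.ofReal_zero, ?_⟩
      refine (closure_mono ?_).trans hs
      intro x hx h
      exact hx (by simp [h])
    have h := hp _ hφ
    have hz : ∫ x, p.1 x * diffExpr α (fun x => (g x : ℂ)) x ∂halfLine = 0 := by
      rw [h0]
      refine integral_eq_zero_of_ae ?_
      filter_upwards [Lp.coeFn_zero ℂ 2 halfLine] with x hx
      rw [hx, Pi.zero_apply, zero_mul]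
    rw [hz] at h
    rw [← setIntegral_eq_integral_of_forall_compl_eq_zero (s := Ioi 0), h]
    · refine integral_congr_ae (Filter.Eventually.of_forall fun x => ?_)
      simp [mul_comm]
    · intro x hx
      have : g x = 0 := image_eq_zero_of_notMem_tsupport fun h => hx (hs h)
      simp [this])
  refine Lp.ext ?_
  have h2 : (p.2 : ℝ → ℂ) =ᵐ[halfLine] 0 := (ae_restrict_iff' measurableSet_Ioi).2 key
  exact h2.trans (Lp.coeFn_zero ℂ 2 halfLine).symm

/-- The maximal operator `L_α^max`: its domain is `{f ∈ L² | L_α f ∈ L²}`, where `L_α f` is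
computed as a distribution on `]0,∞[`. -/
def maxOp (α : ℂ) : L2HalfLine →ₗ.[ℂ] L2HalfLine := (maxGraph α).toLinearPMap

theorem maxOp_graph (α : ℂ) : (maxOp α).graph = maxGraph α :=
  Submodule.toLinearPMap_graph_eq _ (maxGraph_single_valued α)

theorem maxOp_isClosed (α : ℂ) : (maxOp α).IsClosed := by
  rw [LinearPMap.IsClosed, maxOp_graph]
  have : (maxGraph α : Set (L2HalfLine × L2HalfLine)) =
      ⋂ (φ : ℝ → ℂ) (_ : IsTestFunction φ), {p | ∫ x, p.1 x * diffExpr α φ x ∂halfLine =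
        ∫ x, p.2 x * φ x ∂halfLine} := by
    ext p; simp [maxGraph]
  rw [this]
  refine isClosed_iInter fun φ => isClosed_iInter fun hφ => isClosed_eq ?_ ?_
  · exact (continuous_pairing (hφ.continuous_diffExpr α) (hφ.compact_diffExpr α)).comp
      continuous_fst
  · exact (continuous_pairing hφ.smooth.continuous hφ.compact).comp continuous_snd

/-! ### The minimal operator -/

/-- The graph of `L_α` on `C_c^∞(]0,∞[)`. -/
def testGraph (α : ℂ) : Submodule ℂ (L2HalfLine × L2HalfLine) where
  carrier := {p | ∃ φ : ℝ → ℂ, IsTestFunction φ ∧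
    p.1 =ᵐ[halfLine] φ ∧ p.2 =ᵐ[halfLine] diffExpr α φ}
  zero_mem' := by
    refine ⟨0, IsTestFunction.zero, Lp.coeFn_zero ℂ 2 halfLine, ?_⟩
    have : diffExpr α 0 = 0 := by
      simpa using diffExpr_smul α 0 IsTestFunction.zero
    rw [this]
    exact Lp.coeFn_zero ℂ 2 halfLine
  add_mem' := by
    rintro p q ⟨φ, hφ, h1, h2⟩ ⟨ψ, hψ, h3, h4⟩
    refine ⟨φ + ψ, hφ.add hψ, (Lp.coeFn_add _ _).trans (h1.add h3), ?_⟩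
    rw [diffExpr_add α hφ hψ]
    exact (Lp.coeFn_add _ _).trans (h2.add h4)
  smul_mem' := by
    rintro c p ⟨φ, hφ, h1, h2⟩
    refine ⟨c • φ, hφ.smul c, (Lp.coeFn_smul _ _).trans (h1.const_smul c), ?_⟩
    rw [diffExpr_smul α c hφ]
    exact (Lp.coeFn_smul _ _).trans (h2.const_smul c)

/-- Integration by parts: `L_α` is symmetric with respect to the bilinear pairing. -/
theorem integral_diffExpr_mul (α : ℂ) {φ ψ : ℝ → ℂ} (hφ : IsTestFunction φ)
    (hψ : IsTestFunction ψ) :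
    ∫ x, φ x * diffExpr α ψ x ∂halfLine = ∫ x, diffExpr α φ x * ψ x ∂halfLine := by
  have hint : ∀ {u v : ℝ → ℂ}, IsTestFunction u → IsTestFunction v → Integrable (u * v) := by
    intro u v hu hv
    exact (hu.smooth.continuous.mul hv.smooth.continuous).integrable_of_hasCompactSupport
      hv.compact.mul_left
  have hd : ∀ {u : ℝ → ℂ}, IsTestFunction u → ∀ x, HasDerivAt u (deriv u x) x :=
    fun hu x => hu.differentiable.differentiableAt.hasDerivAt
  have e1 : ∫ x, φ x * deriv (deriv ψ) x = -∫ x, deriv φ x * deriv ψ x :=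
    integral_mul_deriv_eq_deriv_mul_of_integrable (fun x _ => hd hφ x)
      (fun x _ => hd hψ.deriv x) (hint hφ hψ.deriv.deriv) (hint hφ.deriv hψ.deriv)
      (hint hφ hψ.deriv)
  have e2 : ∫ x, deriv φ x * deriv ψ x = -∫ x, deriv (deriv φ) x * ψ x :=
    integral_mul_deriv_eq_deriv_mul_of_integrable (fun x _ => hd hφ.deriv x)
      (fun x _ => hd hψ x) (hint hφ.deriv hψ.deriv) (hint hφ.deriv.deriv hψ) (hint hφ.deriv hψ)
  have e3 : ∫ x, φ x * deriv (deriv ψ) x = ∫ x, deriv (deriv φ) x * ψ x := by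
    rw [e1, e2, neg_neg]
  have hpot : Integrable fun x : ℝ => φ x * ((-(1 / 4) + α) / (x : ℂ) ^ 2 * ψ x) :=
    (hφ.smooth.continuous.mul (hψ.continuous_potential α)).integrable_of_hasCompactSupport
      (hφ.compact.mul_right)
  rw [setIntegral_eq_integral_of_forall_compl_eq_zero,
    setIntegral_eq_integral_of_forall_compl_eq_zero]
  · have l : ∫ x, φ x * diffExpr α ψ x = -(∫ x, φ x * deriv (deriv ψ) x) +
        ∫ x : ℝ, φ x * ((-(1 / 4) + α) / (x : ℂ) ^ 2 * ψ x) := by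
      rw [← integral_neg, ← integral_add (f := fun x => -(φ x * deriv (deriv ψ) x)) (hint hφ hψ.deriv.deriv).neg hpot]
      refine integral_congr_ae (Filter.Eventually.of_forall fun x => ?_)
      simp only [diffExpr]; ring
    have r : ∫ x, diffExpr α φ x * ψ x = -(∫ x, deriv (deriv φ) x * ψ x) +
        ∫ x : ℝ, φ x * ((-(1 / 4) + α) / (x : ℂ) ^ 2 * ψ x) := by
      rw [← integral_neg, ← integral_add (f := fun x => -(deriv (deriv φ) x * ψ x)) (hint hφ.deriv.deriv hψ).neg hpot]
      refine integral_congr_ae (Filter.Eventually.of_forall fun x => ?_)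
      simp only [diffExpr]; ring
    rw [l, r, e3]
  · intro x hx
    have : ψ x = 0 := image_eq_zero_of_notMem_tsupport fun h => hx (hψ.support h)
    simp [this]
  · intro x hx
    have : φ x = 0 := image_eq_zero_of_notMem_tsupport fun h => hx (hφ.support h)
    simp [this]

theorem testGraph_le_maxGraph (α : ℂ) : testGraph α ≤ maxGraph α := by
  rintro p ⟨φ, hφ, h1, h2⟩ ψ hψ
  calc ∫ x, p.1 x * diffExpr α ψ x ∂halfLine = ∫ x, φ x * diffExpr α ψ x ∂halfLine :=
        integral_congr_ae (by filter_upwards [h1] with x hx; simp [hx])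
    _ = ∫ x, diffExpr α φ x * ψ x ∂halfLine := integral_diffExpr_mul α hφ hψ
    _ = ∫ x, p.2 x * ψ x ∂halfLine :=
        integral_congr_ae (by filter_upwards [h2] with x hx; simp [hx])

/-- The operator `L_α` with domain `C_c^∞(]0,∞[)`. -/
def testOp (α : ℂ) : L2HalfLine →ₗ.[ℂ] L2HalfLine := (testGraph α).toLinearPMap

theorem testOp_graph (α : ℂ) : (testOp α).graph = testGraph α :=
  Submodule.toLinearPMap_graph_eq _ fun p hp =>
    maxGraph_single_valued α p (testGraph_le_maxGraph α hp)

theorem testOp_isClosable (α : ℂ) : (testOp α).IsClosable :=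
  (maxOp_isClosed α).isClosable.leIsClosable <| LinearPMap.le_of_le_graph <| by
    rw [testOp_graph, maxOp_graph]; exact testGraph_le_maxGraph α

/-- The minimal operator `L_α^min`: the closure of `L_α` on `C_c^∞(]0,∞[)`. -/
def minOp (α : ℂ) : L2HalfLine →ₗ.[ℂ] L2HalfLine := (testOp α).closure

/-! ### The operators `H_{m,κ}` -/

/-- The function prescribing the behaviour at `0`: `x^{1/2-m} + κ x^{1/2+m}` for `κ ∈ ℂ`, and
`x^{1/2+m}` for `κ = ∞`. -/
def boundaryFun (m : ℂ) : OnePoint ℂ → ℝ → ℂ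
  | OnePoint.infty => fun x => (x : ℂ) ^ (1 / 2 + m)
  | OnePoint.some κ => fun x => (x : ℂ) ^ (1 / 2 - m) + κ * (x : ℂ) ^ (1 / 2 + m)

/-- The boundary condition: for some `c`, the function `f - c (x^{1/2-m} + κ x^{1/2+m})` (with the
usual meaning for `κ = ∞`) belongs to `Dom(L_{m²}^min)` around `0`, that is, it coincides on some
interval `]0,ε[` with an element of `Dom(L_{m²}^min)`. -/
def boundarySpace (m : ℂ) (κ : OnePoint ℂ) : Submodule ℂ L2HalfLine where
  carrier := {f | ∃ c : ℂ, ∃ h ∈ (minOp (m ^ 2)).domain, ∃ ε : ℝ, 0 < ε ∧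
    ∀ᵐ x ∂halfLine, x < ε → f x - c * boundaryFun m κ x = h x}
  zero_mem' := by
    refine ⟨0, 0, Submodule.zero_mem _, 1, one_pos, ?_⟩
    filter_upwards with x hx
    simp
  add_mem' := by
    rintro f g ⟨c, h, hh, ε, hε, hf⟩ ⟨d, k, hk, δ, hδ, hg⟩
    refine ⟨c + d, h + k, Submodule.add_mem _ hh hk, min ε δ, lt_min hε hδ, ?_⟩
    filter_upwards [hf, hg, Lp.coeFn_add f g, Lp.coeFn_add h k] with x h1 h2 h3 h4 hx
    rw [h3, h4, Pi.add_apply, Pi.add_apply, ← h1 (hx.trans_le (min_le_left _ _)),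
      ← h2 (hx.trans_le (min_le_right _ _))]
    ring
  smul_mem' := by
    rintro a f ⟨c, h, hh, ε, hε, hf⟩
    refine ⟨a * c, a • h, Submodule.smul_mem _ _ hh, ε, hε, ?_⟩
    filter_upwards [hf, Lp.coeFn_smul a f, Lp.coeFn_smul a h] with x h1 h3 h4 hx
    rw [h3, h4, Pi.smul_apply, Pi.smul_apply, ← h1 hx, smul_eq_mul, smul_eq_mul]
    ring

/-- The almost homogeneous Schrödinger operator `H_{m,κ}` (for `|Re m| < 1`): the restriction of
`L_{m²}^max` to the functions satisfying the boundary condition at `0`. -/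
def almostHomOp (m : ℂ) (κ : OnePoint ℂ) : L2HalfLine →ₗ.[ℂ] L2HalfLine :=
  (maxOp (m ^ 2)).domRestrict (boundarySpace m κ)

/-- The set of eigenvalues of an unbounded operator. -/
def eigenvalues (T : L2HalfLine →ₗ.[ℂ] L2HalfLine) : Set ℂ :=
  {z | ∃ f : T.domain, (f : L2HalfLine) ≠ 0 ∧ T f = z • (f : L2HalfLine)}

end AlmostHomogeneous

end


/-!
An eigenfunction is a classical solution of `F'' = ((-1/4 + m²) x⁻² - z) F`. For real `m²` and a
symmetric boundary condition, the Wronskian of `F` and its conjugate, whose derivative is a multiple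
of `(Im z) |F|²`, vanishes at both ends, so `z` is real. For `z > 0` an energy estimate prevents `F`
from being square integrable at infinity, and for `z = 0` it is a multiple of the boundary function,
which is not square integrable at infinity either. For `z = -4 β < 0` the solutions that are square
integrable at infinity are the multiples of
`x ^ (1 / 2 + m) ∫₀^∞ exp (-t - β x² / t) t ^ (-m - 1) dt`, that is, of `√x K_m (2 √β x)`.

Near `0`, the elements of `Dom(L_{m²}^min)` are detected by the vanishing of their Wronskians at `0`
with the square integrable solutions of `L_{m²} u = 0`. The boundary condition can therefore be read
off the limits at `0` of the Wronskians of the decaying solution with `x ^ (1 / 2 + m)` and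
`x ^ (1 / 2 - m)`, which are `2 β ^ (-m) Γ(1 + m)` and `2 Γ(1 - m)`. For finite `κ` and `m ≠ 0` it
becomes `κ β ^ (-m) Γ(1 + m) + Γ(1 - m) = 0`, which is then solved for `β`.
-/

open Filter Topology ComplexConjugate

noncomputable section

namespace AlmostHomogeneous

/-! ### Test functions and distributional derivatives -/

theorem Icc_subset_Ioi_zero {a b : ℝ} (ha : 0 < a) : Icc a b ⊆ Ioi 0 :=
  fun _ hx => ha.trans_le hx.1

theorem uIcc_subset_Ioi_zero {a b : ℝ} (ha : 0 < a) (hb : 0 < b) : uIcc a b ⊆ Ioi 0 :=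
  Icc_subset_Ioi_zero (lt_min ha hb)

theorem integral_halfLine_eq_integral {f : ℝ → ℂ} (hf : ∀ x, x ∉ Ioi 0 → f x = 0) :
    ∫ x, f x ∂halfLine = ∫ x, f x :=
  setIntegral_eq_integral_of_forall_compl_eq_zero hf

theorem integral_halfLine_eq_intervalIntegral {f : ℝ → ℂ} {a b : ℝ} (ha : 0 ≤ a) (hab : a ≤ b)
    (hf : ∀ x, x ∉ Ioo a b → f x = 0) : ∫ x, f x ∂halfLine = ∫ x in a..b, f x := by
  rw [intervalIntegral.integral_of_le hab, integral_halfLine_eq_integral,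
    setIntegral_eq_integral_of_forall_compl_eq_zero]
  · exact fun x hx => hf x fun h => hx ⟨h.1, h.2.le⟩
  · exact fun x hx => hf x fun h => hx (ha.trans_lt h.1)

section TestFunction

variable {f g φ ψ : ℝ → ℂ}

theorem deriv_eq_zero_of_notMem_tsupport {x : ℝ} (hx : x ∉ tsupport φ) : deriv φ x = 0 :=
  image_eq_zero_of_notMem_tsupport fun h => hx (tsupport_deriv_subset h)

theorem IsTestFunction.eq_zero_of_notMem_Ioi (hφ : IsTestFunction φ) {x : ℝ} (hx : x ∉ Ioi 0) :
    φ x = 0 :=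
  image_eq_zero_of_notMem_tsupport fun h => hx (hφ.support h)

theorem IsTestFunction.exists_Ioo (hφ : IsTestFunction φ) :
    ∃ a b : ℝ, 0 < a ∧ a < b ∧ tsupport φ ⊆ Ioo a b := by
  rcases (tsupport φ).eq_empty_or_nonempty with hempty | hne
  · exact ⟨1, 2, by norm_num, by norm_num, by simp [hempty]⟩
  · have hc : IsCompact (tsupport φ) := hφ.compact
    obtain ⟨a, ha, hmin⟩ := hc.exists_isLeast hne
    obtain ⟨b, -, hmax⟩ := hc.exists_isGreatest hne
    have h0 : 0 < a := hφ.support ha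
    refine ⟨a / 2, b + 1, by positivity, by linarith [hmax ha], fun x hx => ⟨?_, ?_⟩⟩
    · linarith [hmin hx]
    · linarith [hmax hx]

theorem IsTestFunction.integrable (hφ : IsTestFunction φ) : Integrable φ halfLine :=
  (hφ.smooth.continuous.integrable_of_hasCompactSupport hφ.compact).mono_measure
    Measure.restrict_le_self

theorem IsTestFunction.integrable_mul (hφ : IsTestFunction φ)
    (hf : LocallyIntegrableOn f (Ioi 0)) : Integrable (fun x => f x * φ x) halfLine := by
  have hK : IntegrableOn (fun x => f x * φ x) (tsupport φ) :=
    (hf.integrableOn_compact_subset hφ.support hφ.compact).mul_continuousOn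
      hφ.smooth.continuous.continuousOn hφ.compact
  refine Integrable.mono_measure ?_ Measure.restrict_le_self
  refine (integrableOn_iff_integrable_of_support_subset fun x hx => ?_).1 hK
  exact subset_tsupport φ (right_ne_zero_of_mul hx)

theorem integral_mul_add_smul (hf : LocallyIntegrableOn f (Ioi 0)) (hφ : IsTestFunction φ)
    (hψ : IsTestFunction ψ) (c : ℂ) :
    ∫ x, f x * (φ + c • ψ) x ∂halfLine =
      ∫ x, f x * φ x ∂halfLine + c * ∫ x, f x * ψ x ∂halfLine := by
  rw [← integral_const_mul,
    ← integral_add (hφ.integrable_mul hf) ((hψ.integrable_mul hf).const_mul c)]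
  refine integral_congr_ae (.of_forall fun x => ?_)
  simp only [Pi.add_apply, Pi.smul_apply, smul_eq_mul]
  ring

theorem locallyIntegrableOn_coe_Lp (u : L2HalfLine) :
    LocallyIntegrableOn (u : ℝ → ℂ) (Ioi 0) volume := by
  intro x _
  have hu : LocallyIntegrable (u : ℝ → ℂ) halfLine := (Lp.memLp u).locallyIntegrable (by norm_num)
  obtain ⟨s, hs, hi⟩ := hu x
  refine ⟨s ∩ Ioi 0, inter_mem (mem_nhdsWithin_of_mem_nhds hs) self_mem_nhdsWithin, ?_⟩
  rwa [IntegrableOn, Measure.restrict_restrict₀' measurableSet_Ioi.nullMeasurableSet] at hi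

theorem isTestFunction_ofReal {η : ℝ → ℝ} (hη : ContDiff ℝ ((⊤ : ℕ∞) : WithTop ℕ∞) η)
    (hc : HasCompactSupport η) (hs : tsupport η ⊆ Ioi 0) :
    IsTestFunction (fun x => (η x : ℂ)) where
  smooth := Complex.ofRealCLM.contDiff.comp hη
  compact := hc.comp_left (g := fun y : ℝ => (y : ℂ)) Complex.ofReal_zero
  support := (tsupport_comp_subset Complex.ofReal_zero η).trans hs

theorem ae_eq_zero_of_forall_integral_mul_eq_zero {U : Set ℝ} (hU : IsOpen U) (hU0 : U ⊆ Ioi 0)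
    (hf : LocallyIntegrableOn f U)
    (h : ∀ φ, IsTestFunction φ → tsupport φ ⊆ U → ∫ x, f x * φ x ∂halfLine = 0) :
    ∀ᵐ x, x ∈ U → f x = 0 := by
  refine hU.ae_eq_zero_of_integral_contDiff_smul_eq_zero hf fun η hη hc hs => ?_
  have htest := isTestFunction_ofReal hη hc (hs.trans hU0)
  rw [← h _ htest ((tsupport_comp_subset Complex.ofReal_zero η).trans hs),
    integral_halfLine_eq_integral fun x hx => by simp [htest.eq_zero_of_notMem_Ioi hx]]
  simp only [Complex.real_smul, mul_comm]

theorem exists_isTestFunction_integral_eq_one :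
    ∃ η, IsTestFunction η ∧ ∫ x, η x ∂halfLine = 1 := by
  let bump : ContDiffBump (1 : ℝ) := ⟨1 / 4, 1 / 2, by norm_num, by norm_num⟩
  have htest : IsTestFunction (fun x => (bump.normed volume x : ℂ)) := by
    refine isTestFunction_ofReal bump.contDiff_normed bump.hasCompactSupport_normed ?_
    rw [bump.tsupport_normed_eq, Real.closedBall_eq_Icc]
    exact Icc_subset_Ioi_zero (by norm_num [bump])
  refine ⟨_, htest, ?_⟩
  rw [integral_halfLine_eq_integral fun x => htest.eq_zero_of_notMem_Ioi, integral_complex_ofReal,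
    bump.integral_normed, Complex.ofReal_one]

theorem exists_isTestFunction_deriv_eq (hψ : IsTestFunction ψ)
    (h0 : ∫ x, ψ x ∂halfLine = 0) : ∃ φ : ℝ → ℂ, IsTestFunction φ ∧ deriv φ = ψ := by
  obtain ⟨a, b, ha, hab, hs⟩ := hψ.exists_Ioo
  have hzero : ∀ x, x ∉ Ioo a b → ψ x = 0 := fun x hx =>
    image_eq_zero_of_notMem_tsupport (mt (@hs x) hx)
  rw [integral_halfLine_eq_intervalIntegral ha.le hab.le hzero] at h0
  have hc := hψ.smooth.continuous
  have hd : ∀ x, HasDerivAt (fun x => ∫ t in a..x, ψ t) (ψ x) x := fun x =>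
    hc.integral_hasStrictDerivAt a x |>.hasDerivAt
  have hderiv : deriv (fun x => ∫ t in a..x, ψ t) = ψ := funext fun x => (hd x).deriv
  have hbelow : ∀ x, x < a → ∫ t in a..x, ψ t = 0 := fun x hx =>
    intervalIntegral.integral_zero_ae <| .of_forall fun t ht =>
      hzero t fun h => h.1.not_ge ((uIoc_of_ge hx.le ▸ ht).2)
  have habove : ∀ x, b < x → ∫ t in a..x, ψ t = 0 := fun x hx => by
    rw [← intervalIntegral.integral_add_adjacent_intervals (hc.intervalIntegrable a b)
      (hc.intervalIntegrable b x), h0, zero_add]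
    exact intervalIntegral.integral_zero_ae <| .of_forall fun t ht =>
      hzero t fun h => h.2.not_gt ((uIoc_of_le hx.le ▸ ht).1)
  have hsupp : tsupport (fun x => ∫ t in a..x, ψ t) ⊆ Icc a b := by
    refine closure_minimal (fun x hx => ?_) isClosed_Icc
    exact ⟨not_lt.1 fun h => hx (hbelow x h), not_lt.1 fun h => hx (habove x h)⟩
  refine ⟨_, ⟨?_, isCompact_Icc.of_isClosed_subset (isClosed_tsupport _) hsupp,
    hsupp.trans (Icc_subset_Ioi_zero ha)⟩, hderiv⟩
  rw [contDiff_infty_iff_deriv, hderiv]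
  exact ⟨fun x => (hd x).differentiableAt, hψ.smooth⟩

theorem exists_forall_eq_mul_integral_of_deriv_eq_zero {T : (ℝ → ℂ) → ℂ}
    (hadd : ∀ φ ψ (c : ℂ), IsTestFunction φ → IsTestFunction ψ → T (φ + c • ψ) = T φ + c * T ψ)
    (hderiv : ∀ φ, IsTestFunction φ → T (deriv φ) = 0) :
    ∃ c, ∀ φ, IsTestFunction φ → T φ = c * ∫ x, φ x ∂halfLine := by
  obtain ⟨η, hη, hη1⟩ := exists_isTestFunction_integral_eq_one
  refine ⟨T η, fun φ hφ => ?_⟩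
  set J := ∫ x, φ x ∂halfLine with hJ
  have hmean : ∫ x, (φ + (-J) • η) x ∂halfLine = 0 := by
    simp only [Pi.add_apply, Pi.smul_apply, smul_eq_mul]
    rw [integral_add hφ.integrable (hη.integrable.const_mul _), integral_const_mul, hη1, ← hJ]
    ring
  obtain ⟨θ, hθ, hθd⟩ := exists_isTestFunction_deriv_eq (hφ.add (hη.smul (-J))) hmean
  have hT := hderiv θ hθ
  rw [hθd, hadd φ η _ hφ hη] at hT
  linear_combination hT

/-- `g` is the derivative of `f` in the sense of distributions on `]0,∞[`. -/
def HasWeakDeriv (f g : ℝ → ℂ) : Prop :=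
  ∀ φ, IsTestFunction φ → ∫ x, f x * deriv φ x ∂halfLine = -∫ x, g x * φ x ∂halfLine

theorem HasWeakDeriv.exists_ae_eq_const (h : HasWeakDeriv f 0)
    (hf : LocallyIntegrableOn f (Ioi 0)) : ∃ c : ℂ, f =ᵐ[halfLine] fun _ => c := by
  obtain ⟨c, hc⟩ := exists_forall_eq_mul_integral_of_deriv_eq_zero
    (T := fun φ => ∫ x, f x * φ x ∂halfLine)
    (fun φ ψ c hφ hψ => integral_mul_add_smul hf hφ hψ c) (fun φ hφ => by simpa using h φ hφ)
  have hloc : LocallyIntegrableOn (fun x => f x - c) (Ioi 0) :=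
    hf.sub (continuousOn_const.locallyIntegrableOn measurableSet_Ioi)
  have hzero := ae_eq_zero_of_forall_integral_mul_eq_zero isOpen_Ioi subset_rfl hloc
    fun φ hφ _ => by
      simp only [sub_mul]
      rw [integral_sub (hφ.integrable_mul hf) (hφ.integrable.const_mul c), integral_const_mul,
        hc φ hφ, sub_self]
  refine ⟨c, (ae_restrict_iff' measurableSet_Ioi).2 ?_⟩
  filter_upwards [hzero] with x hx h using sub_eq_zero.1 (hx h)

theorem HasWeakDeriv.sub {f' g' : ℝ → ℂ} (h : HasWeakDeriv f g) (h' : HasWeakDeriv f' g')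
    (hf : LocallyIntegrableOn f (Ioi 0)) (hf' : LocallyIntegrableOn f' (Ioi 0))
    (hg : LocallyIntegrableOn g (Ioi 0)) (hg' : LocallyIntegrableOn g' (Ioi 0)) :
    HasWeakDeriv (f - f') (g - g') := by
  intro φ hφ
  simp only [Pi.sub_apply, sub_mul]
  rw [integral_sub (hφ.deriv.integrable_mul hf) (hφ.deriv.integrable_mul hf'),
    integral_sub (hφ.integrable_mul hg) (hφ.integrable_mul hg'), h φ hφ, h' φ hφ]
  ring

theorem hasWeakDeriv_of_hasDerivAt (hf : ∀ x, 0 < x → HasDerivAt f (g x) x)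
    (hg : ContinuousOn g (Ioi 0)) : HasWeakDeriv f g := by
  intro φ hφ
  have hfc : ContinuousOn f (Ioi 0) := fun x hx => (hf x hx).continuousAt.continuousWithinAt
  obtain ⟨a, b, ha, -, hs⟩ := hφ.exists_Ioo
  have hzero : ∀ x, x ∉ Ioo a b → f x * φ x = 0 := fun x hx => by
    rw [image_eq_zero_of_notMem_tsupport (mt (@hs x) hx), mul_zero]
  have h := integral_Ioi_mul_deriv_eq_deriv_mul (a := 0) (u := f) (v := φ) (a' := 0) (b' := 0) hf
    (fun x _ => hφ.differentiable.differentiableAt.hasDerivAt)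
    (hφ.deriv.integrable_mul (hfc.locallyIntegrableOn measurableSet_Ioi))
    (hφ.integrable_mul (hg.locallyIntegrableOn measurableSet_Ioi))
    (tendsto_const_nhds.congr' <| by
      filter_upwards [Ioo_mem_nhdsGT ha] with x hx using (hzero x fun h => h.1.not_gt hx.2).symm)
    (tendsto_const_nhds.congr' <| by
      filter_upwards [Ioi_mem_atTop b] with x hx using (hzero x fun h => h.2.not_gt hx).symm)
  rw [h, sub_self, zero_sub]

end TestFunction

section Primitive

theorem absolutelyContinuousOnInterval_intervalIntegral {E : Type*} [NormedAddCommGroup E]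
    [NormedSpace ℝ E] {r : ℝ → E} {a b c : ℝ} (hr : IntervalIntegrable r volume a b)
    (hc : c ∈ uIcc a b) : AbsolutelyContinuousOnInterval (fun x => ∫ v in c..x, r v) a b := by
  have hint : ∀ x ∈ uIcc a b, IntervalIntegrable r volume c x := fun x hx =>
    hr.mono_set (uIcc_subset_uIcc hc hx)
  have hdist : ∀ x ∈ uIcc a b, ∀ y ∈ uIcc a b, dist (∫ v in c..x, r v) (∫ v in c..y, r v) ≤
      dist (∫ v in c..x, ‖r v‖) (∫ v in c..y, ‖r v‖) := fun x hx y hy => by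
    rw [dist_eq_norm, dist_eq_norm, intervalIntegral.integral_interval_sub_left (hint x hx)
      (hint y hy), intervalIntegral.integral_interval_sub_left (hint x hx).norm (hint y hy).norm]
    exact intervalIntegral.norm_integral_le_abs_integral_norm
  have hnorm := hr.norm.absolutelyContinuousOnInterval_intervalIntegral hc
  rw [absolutelyContinuousOnInterval_iff] at hnorm ⊢
  intro ε hε
  obtain ⟨δ, hδ, H⟩ := hnorm ε hε
  refine ⟨δ, hδ, fun I hI hlen => (Finset.sum_le_sum fun i hi => ?_).trans_lt (H I hI hlen)⟩
  exact hdist _ (hI.1 i hi).1 _ (hI.1 i hi).2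

theorem integral_primitive_mul_deriv {r φ : ℝ → ℂ} {a b c : ℝ}
    (hr : IntervalIntegrable r volume a b) (hc : c ∈ uIcc a b) (hφ : ContDiff ℝ 1 φ)
    (ha : φ a = 0) (hb : φ b = 0) :
    ∫ x in a..b, (∫ v in c..x, r v) * deriv φ x = -∫ x in a..b, r x * φ x := by
  set P : ℝ → ℂ := fun x => ∫ v in c..x, r v
  have hP : AbsolutelyContinuousOnInterval P a b :=
    absolutelyContinuousOnInterval_intervalIntegral hr hc
  have hPφ' : IntervalIntegrable (fun x => P x * deriv φ x) volume a b :=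
    (hP.continuousOn.mul (hφ.continuous_deriv le_rfl).continuousOn).intervalIntegrable
  have hrφ : IntervalIntegrable (fun x => r x * φ x) volume a b :=
    hr.mul_continuousOn hφ.continuous.continuousOn
  have hsum := hPφ'.add hrφ
  -- `P φ - ∫ (P φ' + r φ)` is absolutely continuous with zero derivative.
  have hconst := (hP.smul hφ.contDiffOn.absolutelyContinuousOnInterval).sub
    (absolutelyContinuousOnInterval_intervalIntegral hsum left_mem_uIcc)
  obtain ⟨C, hC⟩ := hconst.const_of_ae_hasDerivAt_zero (by
    filter_upwards [hr.ae_hasDerivAt_integral, hsum.ae_hasDerivAt_integral] with x hPx hIx hx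
    refine (((hPx hx c hc).mul (hφ.differentiable one_ne_zero x).hasDerivAt).sub
      (hIx hx a left_mem_uIcc)).congr_deriv ?_
    ring)
  have hends := (hC b right_mem_uIcc).trans (hC a left_mem_uIcc).symm
  simp only [Pi.sub_apply, smul_eq_mul, Pi.mul_apply, ha, hb, mul_zero,
    intervalIntegral.integral_same] at hends
  rw [intervalIntegral.integral_add hPφ' hrφ] at hends
  linear_combination -hends

variable {r : ℝ → ℂ}

theorem intervalIntegrable_of_locallyIntegrableOn (hr : LocallyIntegrableOn r (Ioi 0)) {a b : ℝ}
    (ha : 0 < a) (hb : 0 < b) : IntervalIntegrable r volume a b := by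
  rw [intervalIntegrable_iff]
  exact (hr.integrableOn_compact_subset (uIcc_subset_Ioi_zero ha hb) isCompact_uIcc).mono_set
    uIoc_subset_uIcc

theorem hasDerivAt_primitive (hr : ContinuousOn r (Ioi 0)) {x : ℝ} (hx : 0 < x) :
    HasDerivAt (fun x => ∫ t in (1 : ℝ)..x, r t) (r x) x :=
  intervalIntegral.integral_hasDerivAt_right
    (intervalIntegrable_of_locallyIntegrableOn (hr.locallyIntegrableOn measurableSet_Ioi)
      one_pos hx)
    (hr.stronglyMeasurableAtFilter isOpen_Ioi x hx) (hr.continuousAt (Ioi_mem_nhds hx))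

theorem continuousOn_primitive (hr : LocallyIntegrableOn r (Ioi 0)) :
    ContinuousOn (fun x => ∫ v in (1 : ℝ)..x, r v) (Ioi 0) := by
  intro x (hx : 0 < x)
  have hle : min 1 x / 2 ≤ max 1 x + 1 := by
    linarith [min_le_left 1 x, le_max_left 1 x]
  have h := (absolutelyContinuousOnInterval_intervalIntegral (c := 1)
    (intervalIntegrable_of_locallyIntegrableOn hr (a := min 1 x / 2) (b := max 1 x + 1)
      (by positivity) (by positivity)) (by
      rw [uIcc_of_le hle]
      exact ⟨by linarith [min_le_left 1 x], by linarith [le_max_left 1 x]⟩)).continuousOn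
  refine (h.continuousAt ?_).continuousWithinAt
  rw [uIcc_of_le hle]
  exact Icc_mem_nhds (by linarith [min_le_right 1 x]) (by linarith [le_max_right 1 x])

theorem locallyIntegrableOn_primitive (hr : LocallyIntegrableOn r (Ioi 0)) :
    LocallyIntegrableOn (fun x => ∫ v in (1 : ℝ)..x, r v) (Ioi 0) :=
  (continuousOn_primitive hr).locallyIntegrableOn measurableSet_Ioi

theorem hasWeakDeriv_primitive (hr : LocallyIntegrableOn r (Ioi 0)) :
    HasWeakDeriv (fun x => ∫ v in (1 : ℝ)..x, r v) r := by
  intro φ hφ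
  obtain ⟨a', b', ha', -, hs'⟩ := hφ.exists_Ioo
  set a := min a' 1
  set b := max b' 1
  have ha : 0 < a := by positivity
  have hab : a ≤ b := (min_le_right _ _).trans (le_max_right _ _)
  have hs : tsupport φ ⊆ Ioo a b :=
    hs'.trans (Ioo_subset_Ioo (min_le_left _ _) (le_max_left _ _))
  have hφ0 : ∀ x, x ∉ Ioo a b → φ x = 0 := fun x hx =>
    image_eq_zero_of_notMem_tsupport (mt (@hs x) hx)
  have hφ1 : ∀ x, x ∉ Ioo a b → deriv φ x = 0 := fun x hx =>
    deriv_eq_zero_of_notMem_tsupport (mt (@hs x) hx)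
  rw [integral_halfLine_eq_intervalIntegral ha.le hab fun x hx => by rw [hφ1 x hx, mul_zero],
    integral_halfLine_eq_intervalIntegral ha.le hab fun x hx => by rw [hφ0 x hx, mul_zero]]
  refine integral_primitive_mul_deriv
    (intervalIntegrable_of_locallyIntegrableOn hr ha (by positivity)) ?_
    (hφ.smooth.of_le (by exact_mod_cast le_top)) (hφ0 a (by simp)) (hφ0 b (by simp))
  exact uIcc_of_le hab ▸ ⟨min_le_right _ _, le_max_right _ _⟩

theorem HasWeakDeriv.exists_ae_eq_primitive {f : ℝ → ℂ} (h : HasWeakDeriv f r)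
    (hf : LocallyIntegrableOn f (Ioi 0)) (hr : LocallyIntegrableOn r (Ioi 0)) :
    ∃ A : ℂ, f =ᵐ[halfLine] fun x => A + ∫ t in (1 : ℝ)..x, r t := by
  have hP := locallyIntegrableOn_primitive hr
  have h0 := h.sub (hasWeakDeriv_primitive hr) hf hP hr hr
  rw [sub_self] at h0
  obtain ⟨A, hA⟩ := h0.exists_ae_eq_const (hf.sub hP)
  refine ⟨A, ?_⟩
  filter_upwards [hA] with x hx using sub_eq_iff_eq_add.1 hx

theorem exists_hasWeakDeriv_const_add_primitive {f : ℝ → ℂ} (hf : LocallyIntegrableOn f (Ioi 0))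
    (hr : LocallyIntegrableOn r (Ioi 0))
    (h : ∀ φ : ℝ → ℂ, IsTestFunction φ →
      ∫ x, f x * deriv (deriv φ) x ∂halfLine = ∫ x, r x * φ x ∂halfLine) :
    ∃ B : ℂ, HasWeakDeriv f fun x => B + ∫ v in (1 : ℝ)..x, r v := by
  set P : ℝ → ℂ := fun x => ∫ v in (1 : ℝ)..x, r v
  have hP : LocallyIntegrableOn P (Ioi 0) := locallyIntegrableOn_primitive hr
  obtain ⟨c, hc⟩ := exists_forall_eq_mul_integral_of_deriv_eq_zero
    (T := fun φ => ∫ x, f x * deriv φ x ∂halfLine + ∫ x, P x * φ x ∂halfLine)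
    (fun φ ψ c hφ hψ => by
      have hd : deriv (φ + c • ψ) = deriv φ + c • deriv ψ := funext fun x => by
        rw [deriv_add hφ.differentiable.differentiableAt
          (hψ.smul c).differentiable.differentiableAt,
          deriv_const_smul c hψ.differentiable.differentiableAt, Pi.add_apply, Pi.smul_apply]
      rw [hd, integral_mul_add_smul hf hφ.deriv hψ.deriv, integral_mul_add_smul hP hφ hψ]
      ring)
    (fun φ hφ => by rw [h φ hφ, hasWeakDeriv_primitive hr φ hφ, add_neg_cancel])
  refine ⟨-c, fun φ hφ => ?_⟩
  simp only [add_mul]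
  rw [integral_add (hφ.integrable.const_mul _) (hφ.integrable_mul hP), integral_const_mul]
  linear_combination hc φ hφ

end Primitive

/-! ### Classical solutions and elliptic regularity -/

/-- `F` is twice continuously differentiable on `]0,∞[`, with derivatives `F₁` and `F₂`. Carrying
the derivatives as data keeps them explicit for the concrete functions below; their values outside
`]0,∞[` are irrelevant. -/
structure IsC2 (F F₁ F₂ : ℝ → ℂ) : Prop where
  hasDerivAt : ∀ x, 0 < x → HasDerivAt F (F₁ x) x
  hasDerivAt_deriv : ∀ x, 0 < x → HasDerivAt F₁ (F₂ x) x
  continuousOn_deriv_deriv : ContinuousOn F₂ (Ioi 0)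

/-- `F`, with derivative `F₁`, is a classical solution of `F'' = q F` on `]0,∞[`. -/
abbrev IsSolution (q F F₁ : ℝ → ℂ) : Prop := IsC2 F F₁ fun x => q x * F x

/-- The Wronskian `F G' - F' G` of two functions with derivatives `F₁` and `G₁`. -/
def wronskian (F F₁ G G₁ : ℝ → ℂ) (x : ℝ) : ℂ := F x * G₁ x - F₁ x * G x

/-- The potential `(-1/4 + α) x⁻²` of `L_α`. -/
def potential (α : ℂ) (x : ℝ) : ℂ := (-(1 / 4) + α) / (x : ℂ) ^ 2

theorem continuousOn_potential (α : ℂ) : ContinuousOn (potential α) (Ioi 0) :=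
  continuousOn_const.div (by fun_prop) fun x (hx : 0 < x) => by simpa using hx.ne'

section IsC2

variable {F F₁ F₂ G G₁ G₂ φ : ℝ → ℂ}

theorem IsC2.continuousOn (hF : IsC2 F F₁ F₂) : ContinuousOn F (Ioi 0) :=
  fun x hx => (hF.hasDerivAt x hx).continuousAt.continuousWithinAt

theorem IsC2.continuousOn_deriv (hF : IsC2 F F₁ F₂) : ContinuousOn F₁ (Ioi 0) :=
  fun x hx => (hF.hasDerivAt_deriv x hx).continuousAt.continuousWithinAt

theorem IsC2.const_mul (hF : IsC2 F F₁ F₂) (c : ℂ) :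
    IsC2 (fun x => c * F x) (fun x => c * F₁ x) (fun x => c * F₂ x) :=
  ⟨fun x hx => (hF.hasDerivAt x hx).const_mul c,
    fun x hx => (hF.hasDerivAt_deriv x hx).const_mul c,
    continuousOn_const.mul hF.continuousOn_deriv_deriv⟩

theorem IsC2.add (hF : IsC2 F F₁ F₂) (hG : IsC2 G G₁ G₂) :
    IsC2 (fun x => F x + G x) (fun x => F₁ x + G₁ x) (fun x => F₂ x + G₂ x) :=
  ⟨fun x hx => (hF.hasDerivAt x hx).add (hG.hasDerivAt x hx),
    fun x hx => (hF.hasDerivAt_deriv x hx).add (hG.hasDerivAt_deriv x hx),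
    hF.continuousOn_deriv_deriv.add hG.continuousOn_deriv_deriv⟩

theorem IsC2.sub (hF : IsC2 F F₁ F₂) (hG : IsC2 G G₁ G₂) :
    IsC2 (fun x => F x - G x) (fun x => F₁ x - G₁ x) (fun x => F₂ x - G₂ x) :=
  ⟨fun x hx => (hF.hasDerivAt x hx).sub (hG.hasDerivAt x hx),
    fun x hx => (hF.hasDerivAt_deriv x hx).sub (hG.hasDerivAt_deriv x hx),
    hF.continuousOn_deriv_deriv.sub hG.continuousOn_deriv_deriv⟩

theorem IsC2.congr (hF : IsC2 F F₁ F₂) (h : ∀ x, F₂ x = G₂ x) : IsC2 F F₁ G₂ :=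
  funext h ▸ hF

theorem IsC2.hasDerivAt_wronskian (hF : IsC2 F F₁ F₂) (hG : IsC2 G G₁ G₂) {x : ℝ} (hx : 0 < x) :
    HasDerivAt (wronskian F F₁ G G₁) (F x * G₂ x - F₂ x * G x) x := by
  refine (((hF.hasDerivAt x hx).mul (hG.hasDerivAt_deriv x hx)).sub
    ((hF.hasDerivAt_deriv x hx).mul (hG.hasDerivAt x hx))).congr_deriv ?_
  ring

theorem IsC2.integral_green (hF : IsC2 F F₁ F₂) (hG : IsC2 G G₁ G₂) {a b : ℝ} (ha : 0 < a)
    (hb : 0 < b) :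
    ∫ x in a..b, (F x * G₂ x - F₂ x * G x) = wronskian F F₁ G G₁ b - wronskian F F₁ G G₁ a :=
  have hs := uIcc_subset_Ioi_zero ha hb
  intervalIntegral.integral_eq_sub_of_hasDerivAt
    (fun _ hx => hF.hasDerivAt_wronskian hG (hs hx))
    (((hF.continuousOn.mul hG.continuousOn_deriv_deriv).sub
      (hF.continuousOn_deriv_deriv.mul hG.continuousOn)).mono hs).intervalIntegrable

theorem IsC2.integral_mul_deriv_deriv (hF : IsC2 F F₁ F₂) (hφ : IsTestFunction φ) :
    ∫ x, F x * deriv (deriv φ) x ∂halfLine = ∫ x, F₂ x * φ x ∂halfLine := by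
  rw [hasWeakDeriv_of_hasDerivAt hF.hasDerivAt hF.continuousOn_deriv _ hφ.deriv,
    hasWeakDeriv_of_hasDerivAt hF.hasDerivAt_deriv hF.continuousOn_deriv_deriv _ hφ, neg_neg]

theorem integral_mul_diffExpr {α : ℂ} {f : ℝ → ℂ} (hf : LocallyIntegrableOn f (Ioi 0))
    (hφ : IsTestFunction φ) :
    ∫ x, f x * diffExpr α φ x ∂halfLine = -(∫ x, f x * deriv (deriv φ) x ∂halfLine) +
      ∫ x, potential α x * f x * φ x ∂halfLine := by
  have hpot : LocallyIntegrableOn (fun x => potential α x * f x) (Ioi 0) :=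
    hf.continuousOn_mul (continuousOn_potential α) isOpen_Ioi.isLocallyClosed
  rw [neg_add_eq_sub, ← integral_sub (hφ.integrable_mul hpot) (hφ.deriv.deriv.integrable_mul hf)]
  refine integral_congr_ae (.of_forall fun x => ?_)
  simp only [diffExpr, potential]
  ring

theorem IsC2.integral_mul_diffExpr (hF : IsC2 F F₁ F₂) (α : ℂ) (hφ : IsTestFunction φ) :
    ∫ x, F x * diffExpr α φ x ∂halfLine =
      ∫ x, (-F₂ x + potential α x * F x) * φ x ∂halfLine := by
  have hpot := ((continuousOn_potential α).mul hF.continuousOn).locallyIntegrableOn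
    (μ := volume) measurableSet_Ioi
  have hF₂ := hF.continuousOn_deriv_deriv.locallyIntegrableOn (μ := volume) measurableSet_Ioi
  rw [AlmostHomogeneous.integral_mul_diffExpr
    (hF.continuousOn.locallyIntegrableOn measurableSet_Ioi) hφ, hF.integral_mul_deriv_deriv hφ,
    neg_add_eq_sub]
  refine (integral_sub (hφ.integrable_mul hpot) (hφ.integrable_mul hF₂)).symm.trans
    (integral_congr_ae (.of_forall fun x => ?_))
  simp only [Pi.mul_apply]
  ring

end IsC2

theorem isSolution_of_eq_second_primitive {q f F : ℝ → ℂ} {A B : ℂ}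
    (hq : ContinuousOn q (Ioi 0)) (hr : LocallyIntegrableOn (fun x => q x * f x) (Ioi 0))
    (hF : F = fun x => A + ∫ t in (1 : ℝ)..x, (B + ∫ v in (1 : ℝ)..t, q v * f v))
    (hfF : f =ᵐ[halfLine] F) :
    IsSolution q F (fun x => B + ∫ v in (1 : ℝ)..x, q v * F v) := by
  have hae : ∀ x, 0 < x → ∫ v in (1 : ℝ)..x, q v * f v = ∫ v in (1 : ℝ)..x, q v * F v := by
    intro x hx
    refine intervalIntegral.integral_congr_ae ?_
    filter_upwards [(ae_restrict_iff' measurableSet_Ioi).1 hfF] with v hv hv1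
    rw [hv (uIcc_subset_Ioi_zero one_pos hx (uIoc_subset_uIcc hv1))]
  have hd : ∀ x, 0 < x → HasDerivAt F (B + ∫ v in (1 : ℝ)..x, q v * F v) x := fun x hx => by
    rw [← hae x hx, hF]
    exact (hasDerivAt_primitive (continuousOn_const.add (continuousOn_primitive hr)) hx).const_add A
  have hqF : ContinuousOn (fun x => q x * F x) (Ioi 0) :=
    hq.mul fun x hx => (hd x hx).continuousAt.continuousWithinAt
  exact ⟨hd, fun x hx => (hasDerivAt_primitive hqF hx).const_add B, hqF⟩

theorem exists_isSolution_of_forall_integral_eq {q f : ℝ → ℂ} (hq : ContinuousOn q (Ioi 0))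
    (hf : LocallyIntegrableOn f (Ioi 0))
    (h : ∀ φ, IsTestFunction φ →
      ∫ x, f x * deriv (deriv φ) x ∂halfLine = ∫ x, q x * f x * φ x ∂halfLine) :
    ∃ F F₁, IsSolution q F F₁ ∧ f =ᵐ[halfLine] F := by
  have hr : LocallyIntegrableOn (fun x => q x * f x) (Ioi 0) :=
    hf.continuousOn_mul hq isOpen_Ioi.isLocallyClosed
  obtain ⟨B, hB⟩ := exists_hasWeakDeriv_const_add_primitive hf hr h
  obtain ⟨A, hA⟩ := hB.exists_ae_eq_primitive hf
    ((continuousOn_const.add (continuousOn_primitive hr)).locallyIntegrableOn measurableSet_Ioi)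
  exact ⟨_, _, isSolution_of_eq_second_primitive hq hr rfl hA, hA⟩

theorem mem_maxGraph_iff {α : ℂ} {f g : L2HalfLine} : (f, g) ∈ maxGraph α ↔
    ∀ φ : ℝ → ℂ, IsTestFunction φ →
      ∫ x, f x * diffExpr α φ x ∂halfLine = ∫ x, g x * φ x ∂halfLine := Iff.rfl

theorem exists_isSolution_of_mem_maxGraph {α z : ℂ} {f : L2HalfLine}
    (hf : (f, z • f) ∈ maxGraph α) :
    ∃ F F₁, IsSolution (fun x => potential α x - z) F F₁ ∧ f =ᵐ[halfLine] F := by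
  have hloc := locallyIntegrableOn_coe_Lp f
  refine exists_isSolution_of_forall_integral_eq
    ((continuousOn_potential α).sub continuousOn_const) hloc fun φ hφ => ?_
  have hpot := hφ.integrable_mul
    (hloc.continuousOn_mul (continuousOn_potential α) isOpen_Ioi.isLocallyClosed)
  have hsmul : ∫ x, (z • f : L2HalfLine) x * φ x ∂halfLine = ∫ x, z * (f x * φ x) ∂halfLine := by
    refine integral_congr_ae ?_
    filter_upwards [Lp.coeFn_smul z f] with x hx
    rw [hx, Pi.smul_apply, smul_eq_mul, mul_assoc]
  have hweak := mem_maxGraph_iff.1 hf φ hφ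
  rw [integral_mul_diffExpr hloc hφ, hsmul, neg_add_eq_sub, sub_eq_iff_eq_add'] at hweak
  simp only [sub_mul, mul_assoc] at hpot ⊢
  rw [integral_sub hpot ((hφ.integrable_mul hloc).const_mul z)]
  simp only [mul_assoc] at hweak
  linear_combination -hweak

/-! ### The minimal operator near `0` -/

theorem isC2_of_contDiff {χ : ℝ → ℂ} (hχ : ContDiff ℝ 2 χ) :
    IsC2 χ (deriv χ) (deriv (deriv χ)) := by
  have hχ' : ContDiff ℝ 1 (deriv χ) := (contDiff_succ_iff_deriv.1 hχ).2.2
  exact ⟨fun x _ => (hχ.differentiable two_ne_zero x).hasDerivAt,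
    fun x _ => (hχ'.differentiable one_ne_zero x).hasDerivAt,
    (hχ'.continuous_deriv le_rfl).continuousOn⟩

theorem IsC2.mul {F F₁ F₂ G G₁ G₂ : ℝ → ℂ} (hF : IsC2 F F₁ F₂) (hG : IsC2 G G₁ G₂) :
    IsC2 (fun x => F x * G x) (fun x => F₁ x * G x + F x * G₁ x)
      (fun x => F₂ x * G x + 2 * F₁ x * G₁ x + F x * G₂ x) := by
  refine ⟨fun x hx => (hF.hasDerivAt x hx).mul (hG.hasDerivAt x hx), fun x hx => ?_, ?_⟩
  · refine (((hF.hasDerivAt_deriv x hx).mul (hG.hasDerivAt x hx)).add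
      ((hF.hasDerivAt x hx).mul (hG.hasDerivAt_deriv x hx))).congr_deriv ?_
    ring
  · exact ((hF.continuousOn_deriv_deriv.mul hG.continuousOn).add
      ((continuousOn_const.mul hF.continuousOn_deriv).mul hG.continuousOn_deriv)).add
      (hF.continuousOn.mul hG.continuousOn_deriv_deriv)

/-- A smooth cutoff function, equal to `1` on `]-∞,a]` and to `0` on `[b,∞[`. -/
structure IsCutoff (χ : ℝ → ℂ) (a b : ℝ) : Prop where
  smooth : ContDiff ℝ ((⊤ : ℕ∞) : WithTop ℕ∞) χ
  eq_one : ∀ x, x ≤ a → χ x = 1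
  eq_zero : ∀ x, b ≤ x → χ x = 0
  norm_le : ∀ x, ‖χ x‖ ≤ 1

theorem exists_isCutoff {a b : ℝ} (hab : a < b) : ∃ χ, IsCutoff χ a b := by
  refine ⟨fun x => (Real.smoothTransition ((b - x) / (b - a)) : ℝ),
    Complex.ofRealCLM.contDiff.comp (Real.smoothTransition.contDiff.comp (by fun_prop)),
    fun x hx => ?_, fun x hx => ?_, fun x => ?_⟩
  · rw [Real.smoothTransition.one_of_one_le, Complex.ofReal_one]
    rw [le_div_iff₀ (sub_pos.2 hab)]
    linarith
  · rw [Real.smoothTransition.zero_of_nonpos, Complex.ofReal_zero]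
    exact div_nonpos_of_nonpos_of_nonneg (by linarith) (by linarith)
  · rw [Complex.norm_real, Real.norm_of_nonneg (Real.smoothTransition.nonneg _)]
    exact Real.smoothTransition.le_one _

namespace IsCutoff

variable {χ : ℝ → ℂ} {a b x : ℝ}

theorem eventuallyEq_const (h : IsCutoff χ a b) (hx : x < a ∨ b < x) :
    ∃ c, χ =ᶠ[𝓝 x] fun _ => c := by
  rcases hx with hx | hx
  · exact ⟨1, by filter_upwards [Iio_mem_nhds hx] with y hy using h.eq_one y (le_of_lt hy)⟩
  · exact ⟨0, by filter_upwards [Ioi_mem_nhds hx] with y hy using h.eq_zero y (le_of_lt hy)⟩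

theorem deriv_eq_zero (h : IsCutoff χ a b) (hx : x < a ∨ b < x) : deriv χ x = 0 := by
  obtain ⟨c, hc⟩ := h.eventuallyEq_const hx
  rw [hc.deriv_eq, deriv_const]

theorem deriv_deriv_eq_zero (h : IsCutoff χ a b) (hx : x < a ∨ b < x) :
    deriv (deriv χ) x = 0 := by
  obtain ⟨c, hc⟩ := h.eventuallyEq_const hx
  rw [hc.deriv.deriv_eq, deriv_const', deriv_const]

theorem isC2 (h : IsCutoff χ a b) : IsC2 χ (deriv χ) (deriv (deriv χ)) :=
  isC2_of_contDiff (h.smooth.of_le (WithTop.coe_le_coe.2 le_top))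

theorem memLp_mul (h : IsCutoff χ a b) {u : ℝ → ℂ} (hu : ContinuousOn u (Ioi 0))
    (hu2 : MemLp u 2 (volume.restrict (Ioo 0 b))) : MemLp (fun x => χ x * u x) 2 halfLine := by
  have hsupp : (fun x => χ x * u x) =ᵐ[halfLine] (Ioo 0 b).indicator fun x => χ x * u x := by
    refine (ae_restrict_iff' measurableSet_Ioi).2 (.of_forall fun x (hx : 0 < x) => ?_)
    rcases lt_or_ge x b with hxb | hbx
    · rw [indicator_of_mem (show x ∈ Ioo 0 b from ⟨hx, hxb⟩)]
    · rw [indicator_of_notMem fun h => hbx.not_gt h.2]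
      exact mul_eq_zero_of_left (h.eq_zero x hbx) _
  rw [memLp_congr_ae hsupp, memLp_indicator_iff_restrict measurableSet_Ioo,
    Measure.restrict_restrict measurableSet_Ioo, inter_eq_left.2 Ioo_subset_Ioi_self]
  refine hu2.mono (((h.smooth.continuous.continuousOn.mul hu).mono
    Ioo_subset_Ioi_self).aestronglyMeasurable measurableSet_Ioo) (.of_forall fun x => ?_)
  rw [norm_mul]
  exact mul_le_of_le_one_left (norm_nonneg _) (h.norm_le x)

end IsCutoff

theorem memLp_of_continuousOn_of_eq_zero {w : ℝ → ℂ} {a b : ℝ} (ha : 0 < a)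
    (hw : ContinuousOn w (Ioi 0)) (h0 : ∀ x, x < a ∨ b < x → w x = 0) : MemLp w 2 halfLine := by
  have hIcc : Icc a b ⊆ Ioi 0 := Icc_subset_Ioi_zero ha
  obtain ⟨C, hC⟩ := isCompact_Icc.exists_bound_of_continuousOn (hw.mono hIcc)
  have hind : (Icc a b).indicator w = w :=
    indicator_eq_self.2 fun x hx => by_contra fun h => hx (h0 x (by
      rwa [mem_Icc, not_and_or, not_le, not_le] at h))
  rw [← hind, memLp_indicator_iff_restrict measurableSet_Icc,
    Measure.restrict_restrict measurableSet_Icc, inter_eq_left.2 hIcc]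
  exact MemLp.of_bound ((hw.mono hIcc).aestronglyMeasurable measurableSet_Icc) C
    ((ae_restrict_iff' measurableSet_Icc).2 (.of_forall hC))

theorem continuous_integral_mul_of_memLp {ψ : ℝ → ℂ} (hψ : MemLp ψ 2 halfLine) :
    Continuous fun f : L2HalfLine => ∫ x, f x * ψ x ∂halfLine := by
  have hconj : MemLp (fun x => (starRingEnd ℂ) (ψ x)) 2 halfLine := hψ.star
  have hinner : (fun f : L2HalfLine => ∫ x, f x * ψ x ∂halfLine) =
      fun f => inner ℂ (hconj.toLp _) f := by
    ext f
    rw [L2.inner_def]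
    refine integral_congr_ae ?_
    filter_upwards [hconj.coeFn_toLp] with x hx
    simp [hx]
  rw [hinner]
  exact continuous_const.inner continuous_id

theorem minOp_graph (α : ℂ) : (minOp α).graph = (testGraph α).topologicalClosure := by
  rw [minOp, ← (testOp_isClosable α).graph_closure_eq_closure_graph, testOp_graph]

theorem minOp_graph_le_maxGraph (α : ℂ) : (minOp α).graph ≤ maxGraph α := by
  rw [minOp_graph]
  refine Submodule.topologicalClosure_minimal _ (testGraph_le_maxGraph α) ?_
  rw [← maxOp_graph]
  exact maxOp_isClosed α

section minOp

variable {α : ℂ} {h g : L2HalfLine} {D D₁ D₂ : ℝ → ℂ} {ε : ℝ}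

theorem integral_mul_eq_of_mem_minOp_graph (hg : (h, g) ∈ (minOp α).graph) {v w : ℝ → ℂ}
    (hv : MemLp v 2 halfLine) (hw : MemLp w 2 halfLine)
    (hvw : ∀ φ, IsTestFunction φ →
      ∫ x, v x * diffExpr α φ x ∂halfLine = ∫ x, w x * φ x ∂halfLine) :
    ∫ x, g x * v x ∂halfLine = ∫ x, h x * w x ∂halfLine := by
  rw [minOp_graph] at hg
  have hclosed : IsClosed {p : L2HalfLine × L2HalfLine |
      ∫ x, p.2 x * v x ∂halfLine = ∫ x, p.1 x * w x ∂halfLine} :=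
    isClosed_eq ((continuous_integral_mul_of_memLp hv).comp continuous_snd)
      ((continuous_integral_mul_of_memLp hw).comp continuous_fst)
  refine closure_minimal ?_ hclosed hg
  rintro p ⟨φ, hφ, hp₁, hp₂⟩
  calc ∫ x, p.2 x * v x ∂halfLine
      = ∫ x, v x * diffExpr α φ x ∂halfLine :=
        integral_congr_ae (by filter_upwards [hp₂] with x hx; rw [hx, mul_comm])
    _ = ∫ x, w x * φ x ∂halfLine := hvw φ hφ
    _ = ∫ x, p.1 x * w x ∂halfLine :=
        integral_congr_ae (by filter_upwards [hp₁] with x hx; rw [hx, mul_comm])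

theorem IsC2.ae_eq_of_mem_maxGraph (hD : IsC2 D D₁ D₂) (hg : (h, g) ∈ maxGraph α)
    (hDh : ∀ᵐ x ∂halfLine, x < ε → D x = h x) :
    ∀ᵐ x ∂halfLine, x < ε → g x = -D₂ x + potential α x * D x := by
  have hLD : LocallyIntegrableOn (fun x => -D₂ x + potential α x * D x) (Ioi 0) :=
    (hD.continuousOn_deriv_deriv.neg.add
      ((continuousOn_potential α).mul hD.continuousOn)).locallyIntegrableOn measurableSet_Ioi
  have hgl := locallyIntegrableOn_coe_Lp g
  have hzero := ae_eq_zero_of_forall_integral_mul_eq_zero (U := Ioo 0 ε) isOpen_Ioo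
    Ioo_subset_Ioi_self ((hgl.sub hLD).mono_set Ioo_subset_Ioi_self) fun φ hφ hφs => by
      have hlocal : ∫ x, h x * diffExpr α φ x ∂halfLine = ∫ x, D x * diffExpr α φ x ∂halfLine := by
        refine integral_congr_ae ?_
        filter_upwards [hDh] with x hx
        by_cases hxs : x ∈ tsupport φ
        · rw [hx (hφs hxs).2]
        · have hφ₂ : deriv (deriv φ) x = 0 :=
            deriv_eq_zero_of_notMem_tsupport fun h => hxs (tsupport_deriv_subset h)
          simp only [diffExpr, image_eq_zero_of_notMem_tsupport hxs, hφ₂, neg_zero, mul_zero,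
            add_zero]
      simp only [Pi.sub_apply, sub_mul]
      rw [integral_sub (hφ.integrable_mul hgl) (hφ.integrable_mul hLD),
        ← mem_maxGraph_iff.1 hg φ hφ, hlocal, hD.integral_mul_diffExpr α hφ, sub_self]
  refine (ae_restrict_iff' measurableSet_Ioi).2 ?_
  filter_upwards [hzero] with x hx hx0 hxε
  exact sub_eq_zero.1 (hx ⟨hx0, hxε⟩)

theorem IsC2.integral_Ioi_green {F F₁ F₂ G G₁ G₂ : ℝ → ℂ} (hF : IsC2 F F₁ F₂) (hG : IsC2 G G₁ G₂)
    {a b : ℝ} (ha : 0 < a) (hab : a ≤ b)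
    (hb : ∀ x, b ≤ x → G x = 0 ∧ G₁ x = 0 ∧ G₂ x = 0) :
    ∫ x in Ioi a, (F x * G₂ x - F₂ x * G x) = -wronskian F F₁ G G₁ a := by
  have htrunc : ∫ x in Ioi a, (F x * G₂ x - F₂ x * G x) =
      ∫ x in a..b, (F x * G₂ x - F₂ x * G x) := by
    rw [intervalIntegral.integral_of_le hab]
    refine setIntegral_eq_of_subset_of_forall_sdiff_eq_zero measurableSet_Ioi Ioc_subset_Ioi_self
      fun x hx => ?_
    obtain ⟨hG0, -, hG₂⟩ := hb x (not_lt.1 fun h => hx.2 ⟨hx.1, h.le⟩)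
    rw [hG0, hG₂, mul_zero, mul_zero, sub_zero]
  rw [htrunc, hF.integral_green hG ha (ha.trans_le hab)]
  simp only [wronskian, (hb b le_rfl).1, (hb b le_rfl).2.1, mul_zero, sub_zero, zero_sub]

theorem IsC2.tendsto_wronskian_of_memLp (hD : IsC2 D D₁ D₂) (hg : (h, g) ∈ (minOp α).graph)
    (hε : 0 < ε) (hDh : ∀ᵐ x ∂halfLine, x < ε → D x = h x) {v v₁ v₂ : ℝ → ℂ} (hv : IsC2 v v₁ v₂)
    (hv2 : MemLp v 2 halfLine) (hLv2 : MemLp (fun x => -v₂ x + potential α x * v x) 2 halfLine)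
    (hv0 : ∀ x, ε ≤ x → v x = 0 ∧ v₁ x = 0 ∧ v₂ x = 0) :
    Tendsto (wronskian D D₁ v v₁) (𝓝[>] 0) (𝓝 0) := by
  have hgD := hD.ae_eq_of_mem_maxGraph (minOp_graph_le_maxGraph α hg) hDh
  have hgv : Integrable (fun x => g x * v x) halfLine := (Lp.memLp g).integrable_mul hv2
  have hhLv : Integrable (fun x => h x * (-v₂ x + potential α x * v x)) halfLine :=
    (Lp.memLp h).integrable_mul hLv2
  have hpair : (fun x => g x * v x - h x * (-v₂ x + potential α x * v x)) =ᵐ[halfLine]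
      fun x => D x * v₂ x - D₂ x * v x := by
    filter_upwards [hDh, hgD] with x hx₁ hx₂
    rcases lt_or_ge x ε with hxε | hxε
    · rw [hx₂ hxε, ← hx₁ hxε]
      ring
    · simp only [hv0 x hxε, mul_zero, neg_zero, add_zero]
  have htotal : ∫ x in Ioi 0, (D x * v₂ x - D₂ x * v x) = 0 := by
    rw [← integral_congr_ae hpair, integral_sub hgv hhLv, sub_eq_zero]
    exact integral_mul_eq_of_mem_minOp_graph hg hv2 hLv2 fun φ hφ => hv.integral_mul_diffExpr α hφ
  have hint : IntegrableOn (fun x => D x * v₂ x - D₂ x * v x) (Ioi 0) :=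
    (hgv.sub hhLv).congr hpair
  have hlim := (hint.continuousWithinAt_Ici_primitive_Ioi.mono Ioi_subset_Ici_self).tendsto.neg
  rw [htotal, neg_zero] at hlim
  refine hlim.congr' ?_
  filter_upwards [Ioo_mem_nhdsGT hε] with x hx
  rw [hD.integral_Ioi_green hv hx.1 hx.2.le hv0, neg_neg]

theorem IsC2.tendsto_wronskian_of_mem_minOp_graph (hD : IsC2 D D₁ D₂)
    (hg : (h, g) ∈ (minOp α).graph) (hε : 0 < ε) (hDh : ∀ᵐ x ∂halfLine, x < ε → D x = h x)
    {u u₁ : ℝ → ℂ} (hu : IsSolution (potential α) u u₁)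
    (hu2 : MemLp u 2 (volume.restrict (Ioo 0 ε))) :
    Tendsto (wronskian D D₁ u u₁) (𝓝[>] 0) (𝓝 0) := by
  obtain ⟨χ, hχ⟩ := exists_isCutoff (show ε / 3 < ε / 2 by linarith)
  have hv := hχ.isC2.mul hu
  have hv2 : MemLp (fun x => χ x * u x) 2 halfLine := hχ.memLp_mul hu.continuousOn
    (hu2.mono_measure (Measure.restrict_mono (Ioo_subset_Ioo_right (by linarith)) le_rfl))
  -- `L_α (χ u)` is square integrable because it only involves `χ'` and `χ''`.
  have hLv2 := memLp_of_continuousOn_of_eq_zero (show 0 < ε / 3 by positivity)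
    (hv.continuousOn_deriv_deriv.neg.add ((continuousOn_potential α).mul hv.continuousOn))
    (b := ε / 2) fun x hx => by
      simp only [Pi.add_apply, Pi.neg_apply, Pi.mul_apply, hχ.deriv_eq_zero hx,
        hχ.deriv_deriv_eq_zero hx]
      ring
  refine (hD.tendsto_wronskian_of_memLp hg hε hDh hv hv2 hLv2 fun x hx => ?_).congr' ?_
  · have hx' : ε / 2 < x := by linarith
    simp [hχ.eq_zero x hx'.le, hχ.deriv_eq_zero (.inr hx'), hχ.deriv_deriv_eq_zero (.inr hx')]
  · filter_upwards [Ioo_mem_nhdsGT (show (0 : ℝ) < ε / 3 by positivity)] with x hx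
    simp [wronskian, hχ.eq_one x hx.2.le, hχ.deriv_eq_zero (.inl hx.2)]

end minOp

/-! ### Square integrable solutions at infinity -/

theorem IsSolution.eq_zero_of_initial {p F F₁ : ℝ → ℂ} (hF : IsSolution p F F₁)
    (hp : ContinuousOn p (Ioi 0)) {x₀ : ℝ} (hx₀ : 0 < x₀) (h0 : F x₀ = 0) (h1 : F₁ x₀ = 0)
    {x : ℝ} (hx : 0 < x) : F x = 0 := by
  set a := min x₀ x / 2 with ha_def
  set b := max x₀ x + 1
  have ha : 0 < a := by positivity
  obtain ⟨C, hC⟩ := isCompact_Icc.exists_bound_of_continuousOn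
    (hp.mono (Icc_subset_Ioi_zero ha : Icc a b ⊆ Ioi 0))
  have hlip : ∀ t ∈ Ioo a b, LipschitzOnWith (max 1 C.toNNReal)
      (fun y : ℂ × ℂ => (y.2, p t * y.1)) univ := by
    intro t ht
    have hpt : ‖p t‖₊ * 1 ≤ C.toNNReal := by
      rw [mul_one]
      exact NNReal.le_toNNReal_of_coe_le (hC t (Ioo_subset_Icc_self ht))
    exact ((LipschitzWith.prod_snd.prodMk
      ((lipschitzWith_smul (p t)).comp LipschitzWith.prod_fst)).weaken
        (max_le_max le_rfl hpt)).lipschitzOnWith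
  have hpos : ∀ t ∈ Ioo a b, 0 < t := fun t ht => ha.trans ht.1
  have heq := ODE_solution_unique_of_mem_Ioo (t₀ := x₀) (f := fun t => (F t, F₁ t))
    (g := fun _ => (0, 0)) hlip
    ⟨by linarith [min_le_left x₀ x], by linarith [le_max_left x₀ x]⟩
    (fun t ht =>
      ⟨(hF.hasDerivAt t (hpos t ht)).prodMk (hF.hasDerivAt_deriv t (hpos t ht)), trivial⟩)
    (fun t _ => ⟨by simpa [← Prod.zero_eq_mk] using hasDerivAt_const t ((0, 0) : ℂ × ℂ), trivial⟩)
    (by simp [h0, h1])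
  exact congrArg Prod.fst (heq
    ⟨by linarith [min_le_right x₀ x], by linarith [le_max_right x₀ x]⟩)

theorem nonpos_of_integrableOn_Ioi {f : ℝ → ℝ} {a δ : ℝ} (hf : IntegrableOn f (Ioi a))
    (h : ∀ x, a < x → δ ≤ f x) : δ ≤ 0 := by
  by_contra! hδ
  have hconst : IntegrableOn (fun _ : ℝ => δ) (Ioi a) := by
    refine hf.mono' aestronglyMeasurable_const ?_
    refine (ae_restrict_iff' measurableSet_Ioi).2 (.of_forall fun x hx => ?_)
    rw [Real.norm_of_nonneg hδ.le]
    exact h x hx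
  rw [integrableOn_const_iff] at hconst
  simp [hδ.ne'] at hconst

theorem exists_hasDerivAt_lt_of_integrableOn_Ioi {f f' : ℝ → ℝ} {a δ : ℝ}
    (hf : IntegrableOn f (Ioi a)) (hd : ∀ x, a < x → HasDerivAt f (f' x) x) (hδ : 0 < δ) :
    ∃ x, a < x ∧ f' x < δ := by
  by_contra! hle
  set b := a + 1
  have hb : ∀ {x}, x ∈ Ici b → a < x := (lt_add_one a).trans_le
  have hderiv : ∀ x, a < x → HasDerivAt (fun x => f x - δ * x) (f' x - δ * 1) x := fun x hx =>
    (hd x hx).sub ((hasDerivAt_id x).const_mul δ)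
  have hmono : MonotoneOn (fun x => f x - δ * x) (Ici b) :=
    monotoneOn_of_hasDerivWithinAt_nonneg (convex_Ici _)
      (fun x hx => (hderiv x (hb hx)).continuousAt.continuousWithinAt)
      (fun x hx => (hderiv x (hb (interior_subset hx))).hasDerivWithinAt)
      (fun x hx => by linarith [hle x (hb (interior_subset hx))])
  set c := max b (b + (1 - f b) / δ)
  have hone : ∀ x, c < x → 1 ≤ f x := by
    intro x hx
    have hbx : b ≤ x := (le_max_left _ _).trans hx.le
    have hgrowth : f b - δ * b ≤ f x - δ * x := hmono self_mem_Ici hbx hbx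
    have hx' : (1 - f b) / δ ≤ x - b := by
      linarith [le_max_right b (b + (1 - f b) / δ)]
    rw [div_le_iff₀ hδ] at hx'
    linarith
  have hac : a ≤ c := (lt_add_one a).le.trans (le_max_left _ _)
  linarith [nonpos_of_integrableOn_Ioi (hf.mono_set (Ioi_subset_Ioi hac)) hone]

theorem IsSolution.integral_sq_norm_deriv_le {p F F₁ : ℝ → ℂ} (hF : IsSolution p F F₁)
    {a b C : ℝ} (ha : 0 < a) (hab : a ≤ b) (hp : ∀ x ∈ Icc a b, ‖p x‖ ≤ C) :
    ∫ x in a..b, ‖F₁ x‖ ^ 2 ≤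
      inner ℝ (F b) (F₁ b) - inner ℝ (F a) (F₁ a) + C * ∫ x in a..b, ‖F x‖ ^ 2 := by
  have hsub : uIcc a b ⊆ Ioi 0 := uIcc_subset_Ioi_zero ha (ha.trans_le hab)
  have c0 := hF.continuousOn.mono hsub
  have c1 := hF.continuousOn_deriv.mono hsub
  have hF₁i : IntervalIntegrable (fun x => ‖F₁ x‖ ^ 2) volume a b :=
    (c1.norm.pow 2).intervalIntegrable
  have hFi : IntervalIntegrable (fun x => C * ‖F x‖ ^ 2) volume a b :=
    (continuousOn_const.mul (c0.norm.pow 2)).intervalIntegrable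
  have hci : IntervalIntegrable
      (fun x => (inner ℝ (F x) (p x * F x) + inner ℝ (F₁ x) (F₁ x) : ℝ)) volume a b :=
    ((c0.inner (hF.continuousOn_deriv_deriv.mono hsub)).add (c1.inner c1)).intervalIntegrable
  have hftc := intervalIntegral.integral_eq_sub_of_hasDerivAt
    (fun x hx => (hF.hasDerivAt x (hsub hx)).inner ℝ (hF.hasDerivAt_deriv x (hsub hx))) hci
  have hle := intervalIntegral.integral_mono_on hab (hF₁i.sub hFi) hci fun x hx => by
    have hCS : -(‖F x‖ * ‖p x * F x‖) ≤ inner ℝ (F x) (p x * F x) :=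
      (neg_le_neg (abs_real_inner_le_norm _ _)).trans (neg_abs_le _)
    rw [norm_mul] at hCS
    rw [real_inner_self_eq_norm_sq]
    nlinarith [hp x hx, sq_nonneg ‖F x‖]
  rw [hftc, intervalIntegral.integral_sub hF₁i hFi, intervalIntegral.integral_const_mul] at hle
  linarith

theorem IsSolution.memLp_deriv {p F F₁ : ℝ → ℂ} (hF : IsSolution p F F₁) {a C : ℝ} (ha : 0 < a)
    (hp : ∀ x, a ≤ x → ‖p x‖ ≤ C) (h : MemLp F 2 (volume.restrict (Ioi a))) :
    MemLp F₁ 2 (volume.restrict (Ioi a)) := by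
  have hC : 0 ≤ C := (norm_nonneg _).trans (hp a le_rfl)
  have hI : IntegrableOn (fun x => ‖F x‖ ^ 2) (Ioi a) := (memLp_two_iff_integrable_sq_norm h.1).1 h
  have hii : ∀ x, a ≤ x → IntervalIntegrable (fun t => ‖F₁ t‖ ^ 2) volume a x := fun x hx =>
    ((hF.continuousOn_deriv.mono (uIcc_subset_Ioi_zero ha (ha.trans_le hx))).norm.pow
      2).intervalIntegrable
  rw [memLp_two_iff_integrable_sq_norm ((hF.continuousOn_deriv.mono
    (Ioi_subset_Ioi ha.le)).aestronglyMeasurable measurableSet_Ioi)]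
  refine integrableOn_Ioi_of_intervalIntegral_norm_bounded
    (1 - inner ℝ (F a) (F₁ a) + C * ∫ x in Ioi a, ‖F x‖ ^ 2) a (l := atTop)
    (b := fun x => max a x) (fun x => (intervalIntegrable_iff_integrableOn_Ioc_of_le
      (le_max_left a x)).1 (hii _ (le_max_left a x)))
    (tendsto_atTop_mono (le_max_right a) tendsto_id) (.of_forall fun x => ?_)
  -- `2 ⟪F, F₁⟫` is the derivative of the integrable function `‖F‖²`.
  obtain ⟨y, hxy, hy⟩ := exists_hasDerivAt_lt_of_integrableOn_Ioi
    (hI.mono_set (Ioi_subset_Ioi (le_max_left a x)))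
    (fun t ht => (hF.hasDerivAt t (ha.trans ((le_max_left a x).trans_lt ht))).norm_sq) two_pos
  have hay : a ≤ y := (le_max_left a x).trans hxy.le
  have hF₁le := hF.integral_sq_norm_deriv_le ha hay fun t ht => hp t ht.1
  have hFle : ∫ t in a..y, ‖F t‖ ^ 2 ≤ ∫ t in Ioi a, ‖F t‖ ^ 2 := by
    rw [intervalIntegral.integral_of_le hay]
    exact setIntegral_mono_set hI (.of_forall fun t => by positivity)
      (Eventually.of_forall fun t ht => ht.1)
  have hmono : ∫ t in a..max a x, ‖F₁ t‖ ^ 2 ≤ ∫ t in a..y, ‖F₁ t‖ ^ 2 :=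
    intervalIntegral.integral_mono_interval le_rfl (le_max_left a x) hxy.le
      (.of_forall fun t => by positivity) (hii y hay)
  simp only [norm_pow, norm_norm]
  linarith [mul_le_mul_of_nonneg_left hFle hC]

theorem integrableOn_wronskian {F F₁ G G₁ : ℝ → ℂ} {s : Set ℝ}
    (hF : MemLp F 2 (volume.restrict s)) (hF₁ : MemLp F₁ 2 (volume.restrict s))
    (hG : MemLp G 2 (volume.restrict s)) (hG₁ : MemLp G₁ 2 (volume.restrict s)) :
    IntegrableOn (wronskian F F₁ G G₁) s :=
  (hF.integrable_mul hG₁).sub (hF₁.integrable_mul hG)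

theorem IsSolution.wronskian_eq {p F F₁ G G₁ : ℝ → ℂ} (hF : IsSolution p F F₁)
    (hG : IsSolution p G G₁) {x y : ℝ} (hx : 0 < x) (hy : 0 < y) :
    wronskian F F₁ G G₁ x = wronskian F F₁ G G₁ y := by
  have hd : ∀ t ∈ Ioi (0 : ℝ), HasDerivAt (wronskian F F₁ G G₁) 0 t := fun t ht =>
    (hF.hasDerivAt_wronskian hG ht).congr_deriv (by ring)
  exact isOpen_Ioi.is_const_of_deriv_eq_zero isPreconnected_Ioi
    (fun t ht => (hd t ht).differentiableAt.differentiableWithinAt)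
    (fun t ht => (hd t ht).deriv) hx hy

theorem IsSolution.wronskian_eq_zero {p F F₁ G G₁ : ℝ → ℂ} (hF : IsSolution p F F₁)
    (hG : IsSolution p G G₁) {a C : ℝ} (ha : 0 < a) (hp : ∀ x, a ≤ x → ‖p x‖ ≤ C)
    (hF2 : MemLp F 2 (volume.restrict (Ioi a))) (hG2 : MemLp G 2 (volume.restrict (Ioi a)))
    {x : ℝ} (hx : 0 < x) : wronskian F F₁ G G₁ x = 0 := by
  have hi := integrableOn_wronskian hF2 (hF.memLp_deriv ha hp hF2) hG2 (hG.memLp_deriv ha hp hG2)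
  refine norm_le_zero_iff.1 (nonpos_of_integrableOn_Ioi hi.norm fun y hy => ?_)
  rw [hF.wronskian_eq hG hx (ha.trans hy)]

theorem norm_potential_sub_le (α z : ℂ) {x : ℝ} (hx : 1 ≤ x) :
    ‖potential α x - z‖ ≤ ‖-(1 / 4) + α‖ + ‖z‖ := by
  refine (norm_sub_le _ _).trans (add_le_add_left ?_ _)
  rw [potential, norm_div, norm_pow, Complex.norm_real, Real.norm_of_nonneg (by linarith)]
  exact div_le_self (norm_nonneg _) (one_le_pow₀ hx)

theorem continuousOn_potential_sub (α z : ℂ) :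
    ContinuousOn (fun x => potential α x - z) (Ioi 0) :=
  (continuousOn_potential α).sub continuousOn_const

/-- The energy `|F'|² + (z - c/t²) |F|²` of a solution of `F'' = (c/t² - z) F`. It is nearly
conserved at infinity, which excludes decaying solutions if `0 < z`. -/
def energy (c z : ℝ) (F F₁ : ℝ → ℂ) (t : ℝ) : ℝ := ‖F₁ t‖ ^ 2 + (z - c / t ^ 2) * ‖F t‖ ^ 2

theorem hasDerivAt_energy {c z : ℝ} {F F₁ : ℝ → ℂ}
    (hF : IsSolution (fun x => ((c / x ^ 2 - z : ℝ) : ℂ)) F F₁) {t : ℝ} (ht : 0 < t) :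
    HasDerivAt (energy c z F F₁) (2 * c / t ^ 3 * ‖F t‖ ^ 2) t := by
  have hpot : HasDerivAt (fun t : ℝ => z - c / t ^ 2) (2 * c / t ^ 3) t := by
    refine (((hasDerivAt_pow 2 t).inv (by positivity)).const_mul c |>.const_sub z).congr_deriv ?_
    field_simp
    simp
    ring
  refine ((hF.hasDerivAt_deriv t ht).norm_sq.add
    (hpot.mul (hF.hasDerivAt t ht).norm_sq)).congr_deriv ?_
  rw [← Complex.real_smul, real_inner_smul_right, real_inner_comm]
  ring

theorem mul_sq_norm_le_energy {c z t : ℝ} (F F₁ : ℝ → ℂ) (h : c / t ^ 2 ≤ z / 2) :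
    z / 2 * ‖F t‖ ^ 2 ≤ energy c z F F₁ t := by
  have := mul_le_mul_of_nonneg_right h (sq_nonneg ‖F t‖)
  rw [energy]
  nlinarith [sq_nonneg ‖F₁ t‖]

theorem monotoneOn_energy_mul_exp {c z x₀ : ℝ} {F F₁ : ℝ → ℂ} (hz : 0 < z) (hx₀ : 0 < x₀)
    (hF : IsSolution (fun x => ((c / x ^ 2 - z : ℝ) : ℂ)) F F₁)
    (hc : ∀ t, x₀ ≤ t → c / t ^ 2 ≤ z / 2) :
    MonotoneOn (fun t => energy c z F F₁ t * Real.exp (-(4 * |c| / z) / (2 * t ^ 2)))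
      (Ici x₀) := by
  set A := 4 * |c| / z with hA
  have hpos : ∀ {t}, t ∈ Ici x₀ → 0 < t := fun ht => hx₀.trans_le ht
  have hexp : ∀ t, 0 < t → HasDerivAt (fun t => Real.exp (-A / (2 * t ^ 2)))
      (Real.exp (-A / (2 * t ^ 2)) * (A / t ^ 3)) t := by
    intro t ht
    refine HasDerivAt.exp ?_
    refine ((((hasDerivAt_pow 2 t).const_mul 2).inv (by positivity)).const_mul (-A)).congr_deriv ?_
    field_simp
    simp
  have hd := fun t (ht : 0 < t) => (hasDerivAt_energy hF ht).mul (hexp t ht)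
  refine monotoneOn_of_hasDerivWithinAt_nonneg (convex_Ici _)
    (fun t ht => (hd t (hpos ht)).continuousAt.continuousWithinAt)
    (fun t ht => (hd t (hpos (interior_subset ht))).hasDerivWithinAt) fun t ht => ?_
  have ht' : t ∈ Ici x₀ := interior_subset ht
  have ht0 := hpos ht'
  have hle : 2 * |c| * ‖F t‖ ^ 2 ≤ A * energy c z F F₁ t :=
    calc 2 * |c| * ‖F t‖ ^ 2 = A * (z / 2 * ‖F t‖ ^ 2) := by rw [hA]; field_simp; ring
      _ ≤ _ := mul_le_mul_of_nonneg_left (mul_sq_norm_le_energy F F₁ (hc t ht')) (by positivity)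
  have hnonneg : 0 ≤ 2 * c * ‖F t‖ ^ 2 + A * energy c z F F₁ t := by
    nlinarith [mul_le_mul_of_nonneg_right (neg_abs_le c) (sq_nonneg ‖F t‖)]
  calc 0 ≤ Real.exp (-A / (2 * t ^ 2)) / t ^ 3 *
        (2 * c * ‖F t‖ ^ 2 + A * energy c z F F₁ t) := by positivity
    _ = _ := by ring

theorem integrableOn_energy {c z x₀ : ℝ} {F F₁ : ℝ → ℂ} (hx₀ : 1 ≤ x₀)
    (hF : IsSolution (fun x => ((c / x ^ 2 - z : ℝ) : ℂ)) F F₁)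
    (hF2 : MemLp F 2 (volume.restrict (Ioi x₀))) (hF₁2 : MemLp F₁ 2 (volume.restrict (Ioi x₀))) :
    IntegrableOn (energy c z F F₁) (Ioi x₀) := by
  have i0 := (memLp_two_iff_integrable_sq_norm hF2.1).1 hF2
  have i1 := (memLp_two_iff_integrable_sq_norm hF₁2.1).1 hF₁2
  have hpos : ∀ {t}, t ∈ Ioi x₀ → 1 ≤ t := fun ht => hx₀.trans (mem_Ioi.1 ht).le
  refine (i1.add (i0.const_mul (|z| + |c|))).mono' ?_ ?_
  · exact ContinuousOn.aestronglyMeasurable (fun t ht =>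
      (hasDerivAt_energy hF (one_pos.trans_le (hpos ht))).continuousAt.continuousWithinAt)
      measurableSet_Ioi
  · refine (ae_restrict_iff' measurableSet_Ioi).2 (.of_forall fun t ht => ?_)
    have hc : |z - c / t ^ 2| ≤ |z| + |c| := by
      refine (abs_sub _ _).trans (add_le_add_right ?_ _)
      rw [abs_div, abs_of_nonneg (sq_nonneg t)]
      exact div_le_self (abs_nonneg c) (one_le_pow₀ (hpos ht))
    calc ‖energy c z F F₁ t‖ ≤ ‖‖F₁ t‖ ^ 2‖ + ‖(z - c / t ^ 2) * ‖F t‖ ^ 2‖ := norm_add_le _ _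
      _ = ‖F₁ t‖ ^ 2 + |z - c / t ^ 2| * ‖F t‖ ^ 2 := by simp
      _ ≤ ‖F₁ t‖ ^ 2 + (|z| + |c|) * ‖F t‖ ^ 2 := by gcongr

theorem potential_sub_eq_ofReal {α : ℂ} (hα : α.im = 0) (z x : ℝ) :
    potential α x - z = (((-(1 / 4) + α.re) / x ^ 2 - z : ℝ) : ℂ) := by
  have hαre : (α.re : ℂ) = α := Complex.ext rfl (by simpa using hα.symm)
  rw [potential]
  push_cast
  rw [hαre]

theorem div_sq_le_half {c z t : ℝ} (hz : 0 < z) (ht : 1 ≤ t) (hct : 2 * |c| / z ≤ t) :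
    c / t ^ 2 ≤ z / 2 := by
  rw [div_le_iff₀ (by positivity)]
  rw [div_le_iff₀ hz] at hct
  nlinarith [le_abs_self c, mul_le_mul_of_nonneg_left ht (show 0 ≤ t * z by positivity)]

theorem IsSolution.eq_zero_of_pos {α : ℂ} (hα : α.im = 0) {z : ℝ} (hz : 0 < z) {F F₁ : ℝ → ℂ}
    (hF : IsSolution (fun x => potential α x - z) F F₁)
    (hF2 : MemLp F 2 (volume.restrict (Ioi 1))) {x : ℝ} (hx : 0 < x) : F x = 0 := by
  have hF₁2 := hF.memLp_deriv one_pos (fun t ht => norm_potential_sub_le α z ht) hF2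
  set c : ℝ := -(1 / 4) + α.re
  have hreal : IsSolution (fun x => ((c / x ^ 2 - z : ℝ) : ℂ)) F F₁ :=
    hF.congr fun x => congrArg (· * F x) (potential_sub_eq_ofReal hα z x)
  set x₀ : ℝ := max 1 (2 * |c| / z)
  have hx₀ : 1 ≤ x₀ := le_max_left _ _
  have hc : ∀ t, x₀ ≤ t → c / t ^ 2 ≤ z / 2 := fun t ht =>
    div_sq_le_half hz (hx₀.trans ht) ((le_max_right _ _).trans ht)
  have hnonneg : ∀ t, x₀ ≤ t → 0 ≤ energy c z F F₁ t := fun t ht =>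
    (by positivity : 0 ≤ z / 2 * ‖F t‖ ^ 2).trans (mul_sq_norm_le_energy F F₁ (hc t ht))
  have hsub := Measure.restrict_mono_set volume (Ioi_subset_Ioi hx₀)
  have henergy : energy c z F F₁ x₀ ≤ 0 := by
    have hEi := integrableOn_energy hx₀ hreal (hF2.mono_measure hsub) (hF₁2.mono_measure hsub)
    refine nonpos_of_mul_nonpos_left (b := Real.exp (-(4 * |c| / z) / (2 * x₀ ^ 2)))
      (nonpos_of_integrableOn_Ioi hEi fun t ht => ?_) (Real.exp_pos _)
    refine (monotoneOn_energy_mul_exp hz (one_pos.trans_le hx₀) hreal hc self_mem_Ici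
      ht.le ht.le).trans (mul_le_of_le_one_right (hnonneg t ht.le) (Real.exp_le_one_iff.2 ?_))
    exact div_nonpos_of_nonpos_of_nonneg (neg_nonpos.2 (by positivity)) (by positivity)
  have hFx : F x₀ = 0 := by
    have hle := (mul_sq_norm_le_energy F F₁ (hc x₀ le_rfl)).trans henergy
    have hsq : ‖F x₀‖ ^ 2 ≤ 0 := nonpos_of_mul_nonpos_right hle (half_pos hz)
    simpa using hsq
  have hF₁x : F₁ x₀ = 0 := by simpa [energy, hFx] using henergy
  exact hF.eq_zero_of_initial (continuousOn_potential_sub α z) (by linarith) hFx hF₁x hx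

theorem IsC2.conj {F F₁ F₂ : ℝ → ℂ} (hF : IsC2 F F₁ F₂) :
    IsC2 (fun x => conj (F x)) (fun x => conj (F₁ x)) (fun x => conj (F₂ x)) :=
  ⟨fun x hx => (hF.hasDerivAt x hx).star, fun x hx => (hF.hasDerivAt_deriv x hx).star,
    Complex.continuous_conj.comp_continuousOn hF.continuousOn_deriv_deriv⟩

theorem conj_potential {α : ℂ} (hα : α.im = 0) (x : ℝ) : conj (potential α x) = potential α x := by
  refine Complex.conj_eq_iff_im.2 ?_
  rw [potential, ← Complex.ofReal_pow, Complex.div_ofReal_im]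
  simp [hα]

theorem IsSolution.hasDerivAt_im_wronskian_conj {α : ℂ} (hα : α.im = 0) {z : ℂ} {F F₁ : ℝ → ℂ}
    (hF : IsSolution (fun x => potential α x - z) F F₁) {t : ℝ} (ht : 0 < t) :
    HasDerivAt (fun t => (wronskian F F₁ (fun x => conj (F x)) (fun x => conj (F₁ x)) t).im)
      (2 * z.im * ‖F t‖ ^ 2) t := by
  have hW := Complex.imCLM.hasFDerivAt.comp_hasDerivAt t (hF.hasDerivAt_wronskian hF.conj ht)
  refine hW.congr_deriv ?_
  have heq : F t * conj ((potential α t - z) * F t) - (potential α t - z) * F t * conj (F t) =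
      ((2 * z.im * ‖F t‖ ^ 2 : ℝ) : ℂ) * Complex.I := by
    rw [map_mul, map_sub, conj_potential hα]
    have hz := Complex.sub_conj z
    push_cast at hz ⊢
    linear_combination (z - conj z) * Complex.mul_conj' (F t) + (‖F t‖ : ℂ) ^ 2 * hz
  rw [heq, Complex.imCLM_apply, Complex.im_ofReal_mul, Complex.I_im, mul_one]

theorem IsSolution.eq_zero_of_im_ne_zero {α : ℂ} (hα : α.im = 0) {z : ℂ} (hz : z.im ≠ 0)
    {F F₁ : ℝ → ℂ} (hF : IsSolution (fun x => potential α x - z) F F₁)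
    (hF2 : MemLp F 2 (volume.restrict (Ioi 1)))
    (h0 : Tendsto (wronskian F F₁ (fun x => conj (F x)) (fun x => conj (F₁ x))) (𝓝[>] 0) (𝓝 0))
    {x : ℝ} (hx : 0 < x) : F x = 0 := by
  have hF₁2 := hF.memLp_deriv one_pos (fun t ht => norm_potential_sub_le α z ht) hF2
  set W := wronskian F F₁ (fun x => conj (F x)) (fun x => conj (F₁ x))
  set V : ℝ → ℝ := fun t => z.im * (W t).im
  have hVd : ∀ t, 0 < t → HasDerivAt V (z.im * (2 * z.im * ‖F t‖ ^ 2)) t := fun t ht =>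
    (hF.hasDerivAt_im_wronskian_conj hα ht).const_mul z.im
  have hmono : MonotoneOn V (Ioi 0) :=
    monotoneOn_of_hasDerivWithinAt_nonneg (convex_Ioi _)
      (fun t ht => (hVd t ht).continuousAt.continuousWithinAt)
      (fun t ht => (hVd t (interior_subset ht)).hasDerivWithinAt)
      (fun t _ => by nlinarith [mul_nonneg (sq_nonneg z.im) (sq_nonneg ‖F t‖)])
  have hV0 : Tendsto V (𝓝[>] 0) (𝓝 0) := by
    simpa using ((Complex.continuous_im.tendsto 0).comp h0).const_mul z.im
  have hnonneg : ∀ t, 0 < t → 0 ≤ V t := by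
    intro t ht
    refine le_of_tendsto hV0 ?_
    filter_upwards [Ioo_mem_nhdsGT ht] with s hs
    exact hmono hs.1 ht hs.2.le
  have hVi : IntegrableOn V (Ioi 1) :=
    (integrableOn_wronskian hF2 hF₁2 hF2.star hF₁2.star).im.const_mul z.im
  have hnonpos : ∀ t, 0 < t → V t ≤ 0 := by
    intro t ht
    refine nonpos_of_integrableOn_Ioi
      (hVi.mono_set (Ioi_subset_Ioi (le_max_left 1 t))) fun s hs => ?_
    have hts : t < s := (le_max_right 1 t).trans_lt hs
    exact hmono ht (ht.trans hts) hts.le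
  have hVz : V =ᶠ[𝓝 x] fun _ => 0 := by
    filter_upwards [Ioi_mem_nhds hx] with t ht
    exact le_antisymm (hnonpos t ht) (hnonneg t ht)
  have hd := (hVd x hx).deriv
  rw [hVz.deriv_eq, deriv_const] at hd
  simpa [hz] using hd.symm

/-! ### Powers and the decaying solution -/

theorem ofReal_cpow_eq_exp {x : ℝ} (hx : 0 < x) (w : ℂ) :
    (x : ℂ) ^ w = Complex.exp (Real.log x * w) := by
  rw [Complex.cpow_def_of_ne_zero (by exact_mod_cast hx.ne'), Complex.ofReal_log hx.le]

theorem ofReal_cpow_ne_zero {x : ℝ} (hx : 0 < x) (w : ℂ) : (x : ℂ) ^ w ≠ 0 := by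
  rw [ofReal_cpow_eq_exp hx]
  exact Complex.exp_ne_zero _

theorem ofReal_eq_exp_log {x : ℝ} (hx : 0 < x) : (x : ℂ) = Complex.exp (Real.log x) := by
  rw [← Complex.ofReal_exp, Real.exp_log hx]

/-- The function `x ^ w` on `]0,∞[`. -/
abbrev powFun (w : ℂ) : ℝ → ℂ := fun x => (x : ℂ) ^ w

/-- The derivative of `powFun w`. -/
abbrev powDeriv (w : ℂ) : ℝ → ℂ := fun x => w * (x : ℂ) ^ w / x

theorem hasDerivAt_powFun {x : ℝ} (hx : 0 < x) (w : ℂ) :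
    HasDerivAt (powFun w) (powDeriv w x) x := by
  have hx' : (x : ℂ) ≠ 0 := by exact_mod_cast hx.ne'
  rcases eq_or_ne w 0 with rfl | hw
  · have hone : powFun 0 = fun _ => 1 := funext fun y => Complex.cpow_zero (y : ℂ)
    rw [hone]
    simpa [powDeriv] using hasDerivAt_const x (1 : ℂ)
  · refine (hasDerivAt_ofReal_cpow_const hx.ne' hw).congr_deriv ?_
    rw [Complex.cpow_sub _ _ hx', Complex.cpow_one, ← mul_div_assoc]

theorem continuousOn_powFun (w : ℂ) : ContinuousOn (powFun w) (Ioi 0) :=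
  fun _ hx => (hasDerivAt_powFun hx w).continuousAt.continuousWithinAt

theorem isSolution_powFun {m w : ℂ} (hw : w * (w - 1) = -(1 / 4) + m ^ 2) :
    IsSolution (potential (m ^ 2)) (powFun w) (powDeriv w) := by
  refine ⟨fun x hx => hasDerivAt_powFun hx w, fun x hx => ?_,
    (continuousOn_potential _).mul (continuousOn_powFun w)⟩
  have hx' : (x : ℂ) ≠ 0 := by exact_mod_cast hx.ne'
  refine (((hasDerivAt_powFun hx w).const_mul w).div (hasDerivAt_id x).ofReal_comp
    hx').congr_deriv ?_
  rw [potential, ← hw]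
  simp only [id, Complex.ofReal_one]
  field_simp

theorem powFun_half_add_mul_powFun_half_sub (m : ℂ) {x : ℝ} (hx : 0 < x) :
    powFun (1 / 2 + m) x * powFun (1 / 2 - m) x = x := by
  rw [powFun, powFun, ← Complex.cpow_add _ _ (by exact_mod_cast hx.ne'),
    show (1 / 2 + m) + (1 / 2 - m) = 1 by ring, Complex.cpow_one]

/-- The integrand of `∫₀^∞ exp(-t - y/t) t^{-s-1} dt`. -/
def macdonaldIntegrand (s : ℂ) (y t : ℝ) : ℂ :=
  (Real.exp (-t - y / t) : ℂ) * (t : ℂ) ^ (-s - 1)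

/-- The integral `∫₀^∞ exp(-t - y/t) t^{-s-1} dt`, which is `2 y^{-s/2} K_s(2√y)` for the
Macdonald function `K_s`. -/
def macdonald (s : ℂ) (y : ℝ) : ℂ := ∫ t in Ioi 0, macdonaldIntegrand s y t

theorem continuousOn_macdonaldIntegrand (s : ℂ) (y : ℝ) :
    ContinuousOn (macdonaldIntegrand s y) (Ioi 0) := by
  refine ContinuousOn.mul ?_ (continuousOn_powFun _)
  refine Complex.continuous_ofReal.comp_continuousOn (Real.continuous_exp.comp_continuousOn ?_)
  exact continuousOn_id.neg.sub (continuousOn_const.div continuousOn_id fun t ht => ne_of_gt ht)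

theorem aestronglyMeasurable_macdonaldIntegrand (s : ℂ) (y : ℝ) :
    AEStronglyMeasurable (macdonaldIntegrand s y) (volume.restrict (Ioi 0)) :=
  (continuousOn_macdonaldIntegrand s y).aestronglyMeasurable measurableSet_Ioi

theorem norm_macdonaldIntegrand (s : ℂ) (y : ℝ) {t : ℝ} (ht : 0 < t) :
    ‖macdonaldIntegrand s y t‖ = Real.exp (-t - y / t) * t ^ (-s.re - 1) := by
  rw [macdonaldIntegrand, norm_mul, Complex.norm_real, Real.norm_of_nonneg (Real.exp_pos _).le,
    Complex.norm_cpow_eq_rpow_re_of_pos ht]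
  simp

theorem exp_neg_le_mul_rpow_neg {a p : ℝ} (ha : 0 < a) (hp : 0 ≤ p) :
    Real.exp (-a) ≤ (p + 1) ^ p * a ^ (-p) := by
  have hq : 0 < p + 1 := by linarith
  have hbase : a / (p + 1) ≤ Real.exp (a / (p + 1)) := by
    linarith [Real.add_one_le_exp (a / (p + 1))]
  have hpow : (a / (p + 1)) ^ p ≤ Real.exp a := by
    refine (Real.rpow_le_rpow (by positivity) hbase hp).trans ?_
    rw [← Real.exp_mul]
    refine Real.exp_le_exp.2 ?_
    rw [div_mul_eq_mul_div, div_le_iff₀ hq]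
    nlinarith
  calc Real.exp (-a) = (Real.exp a)⁻¹ := Real.exp_neg a
    _ ≤ ((a / (p + 1)) ^ p)⁻¹ := inv_anti₀ (by positivity) hpow
    _ = (p + 1) ^ p * a ^ (-p) := by
      rw [Real.div_rpow ha.le hq.le, inv_div, Real.rpow_neg ha.le, div_eq_mul_inv]

theorem norm_macdonaldIntegrand_le (s : ℂ) {y t p : ℝ} (hy : 0 < y) (ht : 0 < t) (hp : 0 ≤ p) :
    ‖macdonaldIntegrand s y t‖ ≤
      (p + 1) ^ p * y ^ (-p) * (Real.exp (-t) * t ^ ((p - s.re) - 1)) := by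
  have hpow : (y / t) ^ (-p) = y ^ (-p) * t ^ p := by
    rw [Real.div_rpow hy.le ht.le, Real.rpow_neg ht.le, div_inv_eq_mul]
  calc ‖macdonaldIntegrand s y t‖
      = Real.exp (-t) * Real.exp (-(y / t)) * t ^ (-s.re - 1) := by
        rw [norm_macdonaldIntegrand s y ht, sub_eq_add_neg (-t), Real.exp_add]
    _ ≤ Real.exp (-t) * ((p + 1) ^ p * (y ^ (-p) * t ^ p)) * t ^ (-s.re - 1) := by
        rw [← hpow]
        gcongr
        exact exp_neg_le_mul_rpow_neg (by positivity) hp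
    _ = (p + 1) ^ p * y ^ (-p) * (Real.exp (-t) * (t ^ p * t ^ (-s.re - 1))) := by ring
    _ = _ := by rw [← Real.rpow_add ht]; ring_nf

theorem integrableOn_macdonaldIntegrand (s : ℂ) {y : ℝ} (hy : 0 < y) :
    IntegrableOn (macdonaldIntegrand s y) (Ioi 0) := by
  set p := |s.re| + 1
  have hi := (Real.GammaIntegral_convergent (s := p - s.re)
    (by linarith [le_abs_self s.re])).const_mul ((p + 1) ^ p * y ^ (-p))
  exact hi.mono' (aestronglyMeasurable_macdonaldIntegrand s y)
    ((ae_restrict_iff' measurableSet_Ioi).2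
      (.of_forall fun t ht => norm_macdonaldIntegrand_le s hy ht (by positivity)))

theorem exists_norm_macdonald_le (s : ℂ) {p : ℝ} (hp : 0 ≤ p) (hps : s.re < p) :
    ∃ C, 0 ≤ C ∧ ∀ y, 0 < y → ‖macdonald s y‖ ≤ C * y ^ (-p) := by
  refine ⟨(p + 1) ^ p * Real.Gamma (p - s.re),
    mul_nonneg (by positivity) (Real.Gamma_pos_of_pos (by linarith)).le, fun y hy => ?_⟩
  refine (norm_integral_le_of_norm_le
    ((Real.GammaIntegral_convergent (s := p - s.re) (by linarith)).const_mul
      ((p + 1) ^ p * y ^ (-p)))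
    ((ae_restrict_iff' measurableSet_Ioi).2
      (.of_forall fun t ht => norm_macdonaldIntegrand_le s hy ht hp))).trans_eq ?_
  rw [integral_const_mul, ← Real.Gamma_eq_integral (by linarith)]
  ring

theorem hasDerivAt_macdonaldIntegrand (s : ℂ) (y : ℝ) {t : ℝ} (ht : 0 < t) :
    HasDerivAt (fun y => macdonaldIntegrand s y t) (-macdonaldIntegrand (s + 1) y t) y := by
  have ht' : (t : ℂ) ≠ 0 := by exact_mod_cast ht.ne'
  have hexp : HasDerivAt (fun y : ℝ => Real.exp (-t - y / t))
      (Real.exp (-t - y / t) * (-(1 / t))) y :=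
    (((hasDerivAt_id y).div_const t).const_sub (-t)).exp
  refine (hexp.ofReal_comp.mul_const ((t : ℂ) ^ (-s - 1))).congr_deriv ?_
  rw [macdonaldIntegrand, show -(s + 1) - 1 = (-s - 1) - 1 by ring,
    Complex.cpow_sub (-s - 1) 1 ht', Complex.cpow_one]
  push_cast
  ring

theorem hasDerivAt_macdonald (s : ℂ) {y : ℝ} (hy : 0 < y) :
    HasDerivAt (macdonald s) (-macdonald (s + 1) y) y := by
  have h := (hasDerivAt_integral_of_dominated_loc_of_deriv_le (μ := volume.restrict (Ioi 0))
    (F := macdonaldIntegrand s) (F' := fun y t => -macdonaldIntegrand (s + 1) y t)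
    (bound := fun t => ‖macdonaldIntegrand (s + 1) (y / 2) t‖)
    (s := Ioi (y / 2)) (Ioi_mem_nhds (by linarith))
    (.of_forall (aestronglyMeasurable_macdonaldIntegrand s))
    (integrableOn_macdonaldIntegrand s hy) (aestronglyMeasurable_macdonaldIntegrand (s + 1) y).neg
    ?_ (integrableOn_macdonaldIntegrand (s + 1) (by positivity : 0 < y / 2)).norm ?_).2
  · rwa [integral_neg] at h
  · refine (ae_restrict_iff' measurableSet_Ioi).2 (.of_forall fun t ht x hx => ?_)
    have ht : 0 < t := ht
    have hxt : y / 2 / t ≤ x / t := div_le_div_of_nonneg_right (le_of_lt hx) ht.le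
    rw [norm_neg, norm_macdonaldIntegrand _ _ ht, norm_macdonaldIntegrand _ _ ht]
    gcongr
  · exact (ae_restrict_iff' measurableSet_Ioi).2
      (.of_forall fun t ht x _ => hasDerivAt_macdonaldIntegrand s x ht)

theorem integral_Ioi_eq_integral_comp_div {E : Type*} [NormedAddCommGroup E] [NormedSpace ℝ E]
    (f : ℝ → E) {y : ℝ} (hy : 0 < y) :
    ∫ t in Ioi 0, f t = ∫ x in Ioi 0, (y / x ^ 2) • f (y / x) := by
  have hmul := integral_comp_mul_left_Ioi f 0 hy
  have hinv := integral_comp_rpow_Ioi (fun x => f (y * x)) (show (-1 : ℝ) ≠ 0 by norm_num)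
  rw [mul_zero] at hmul
  rw [← smul_inv_smul₀ hy.ne' (∫ t in Ioi 0, f t), ← hmul, ← hinv, ← integral_smul]
  refine setIntegral_congr_fun measurableSet_Ioi fun x hx => ?_
  have hx : 0 < x := hx
  have hpow : x ^ ((-1 : ℝ) - 1) = (x ^ 2)⁻¹ := by
    rw [show (-1 : ℝ) - 1 = -(2 : ℕ) by norm_num, Real.rpow_neg hx.le, Real.rpow_natCast]
  simp only [Real.rpow_neg_one, hpow, abs_neg, abs_one, one_mul, smul_smul, div_eq_mul_inv]

theorem smul_macdonaldIntegrand_div (s : ℂ) {x y : ℝ} (hx : 0 < x) (hy : 0 < y) :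
    (y / x ^ 2) • macdonaldIntegrand s y (y / x) =
      (y : ℂ) ^ (-s) * macdonaldIntegrand (-s) y x := by
  have hexp : -(y / x) - y / (y / x) = -x - y / x := by
    field_simp
    ring
  have hpow : ((y / x ^ 2 : ℝ) : ℂ) * ((y / x : ℝ) : ℂ) ^ (-s - 1) =
      (y : ℂ) ^ (-s) * (x : ℂ) ^ (- -s - 1) := by
    rw [ofReal_eq_exp_log (by positivity : 0 < y / x ^ 2), ofReal_cpow_eq_exp (by positivity),
      ofReal_cpow_eq_exp hy, ofReal_cpow_eq_exp hx, ← Complex.exp_add, ← Complex.exp_add,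
      Real.log_div hy.ne' (by positivity), Real.log_div hy.ne' hx.ne', Real.log_pow]
    push_cast
    ring_nf
  rw [macdonaldIntegrand, macdonaldIntegrand, hexp, Complex.real_smul]
  linear_combination (Real.exp (-x - y / x) : ℂ) * hpow

theorem macdonald_neg (s : ℂ) {y : ℝ} (hy : 0 < y) :
    macdonald s y = (y : ℂ) ^ (-s) * macdonald (-s) y := by
  rw [macdonald, integral_Ioi_eq_integral_comp_div _ hy, macdonald, ← integral_const_mul]
  exact setIntegral_congr_fun measurableSet_Ioi fun x hx => smul_macdonaldIntegrand_div s hx hy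

theorem macdonald_recurrence (s : ℂ) {y : ℝ} (hy : 0 < y) :
    (y : ℂ) * macdonald (s + 1) y = s * macdonald s y + macdonald (s - 1) y := by
  have hy' : (y : ℂ) ≠ 0 := by exact_mod_cast hy.ne'
  have hreflect : macdonald s =ᶠ[𝓝 y] fun y => (y : ℂ) ^ (-s) * macdonald (-s) y := by
    filter_upwards [Ioi_mem_nhds hy] with x hx using macdonald_neg s hx
  -- Differentiate both sides of the reflection formula.
  have hderiv := ((hasDerivAt_macdonald s hy).congr_of_eventuallyEq hreflect.symm).unique
    ((hasDerivAt_powFun hy (-s)).mul (hasDerivAt_macdonald (-s) hy))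
  have hpred := macdonald_neg (s - 1) hy
  rw [show -(s - 1) = -s + 1 by ring, Complex.cpow_add _ _ hy', Complex.cpow_one] at hpred
  simp only [powFun, powDeriv] at hderiv
  field_simp at hderiv
  rw [hpred, macdonald_neg s hy]
  linear_combination -hderiv

theorem tendsto_macdonald {s : ℂ} (hs : 0 < s.re) :
    Tendsto (macdonald (-s)) (𝓝[>] 0) (𝓝 (Complex.Gamma s)) := by
  rw [Complex.Gamma_eq_integral hs]
  refine tendsto_integral_filter_of_dominated_convergence (μ := volume.restrict (Ioi 0))
    (fun t => Real.exp (-t) * t ^ (s.re - 1))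
    (.of_forall (aestronglyMeasurable_macdonaldIntegrand (-s))) ?_
    (Real.GammaIntegral_convergent hs) ?_
  · filter_upwards [self_mem_nhdsWithin] with y hy
    refine (ae_restrict_iff' measurableSet_Ioi).2 (.of_forall fun t ht => ?_)
    rw [norm_macdonaldIntegrand _ _ ht, Complex.neg_re, neg_neg]
    have ht : 0 < t := ht
    have hyt : 0 < y / t := div_pos hy ht
    gcongr
    linarith
  · refine .of_forall fun t => ?_
    simp only [macdonaldIntegrand, neg_neg]
    refine Tendsto.mul_const _ ?_
    have hc : Continuous fun y : ℝ => ((Real.exp (-t - y / t) : ℝ) : ℂ) := by fun_prop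
    simpa using (hc.tendsto 0).mono_left nhdsWithin_le_nhds

/-- The solution of `L_{m²} f = -4 β f` which decays at infinity. -/
def decaying (m : ℂ) (β x : ℝ) : ℂ := powFun (1 / 2 + m) x * macdonald m (β * x ^ 2)

/-- The derivative of `decaying`. -/
def decayingDeriv (m : ℂ) (β x : ℝ) : ℂ :=
  powDeriv (1 / 2 + m) x * macdonald m (β * x ^ 2) -
    2 * β * x * powFun (1 / 2 + m) x * macdonald (m + 1) (β * x ^ 2)

section Decaying

variable {m : ℂ} {β : ℝ}

theorem hasDerivAt_macdonald_comp (s : ℂ) (hβ : 0 < β) {x : ℝ} (hx : 0 < x) :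
    HasDerivAt (fun x : ℝ => macdonald s (β * x ^ 2))
      (-(2 * β * x) * macdonald (s + 1) (β * x ^ 2)) x := by
  have hinner : HasDerivAt (fun x : ℝ => β * x ^ 2) (β * (2 * x)) x := by
    simpa using (hasDerivAt_pow 2 x).const_mul β
  refine ((hasDerivAt_macdonald s (by positivity : 0 < β * x ^ 2)).scomp x hinner).congr_deriv ?_
  rw [Complex.real_smul]
  push_cast
  ring

theorem isSolution_decaying (m : ℂ) (hβ : 0 < β) :
    IsSolution (fun x => potential (m ^ 2) x - (-4 * β : ℂ)) (decaying m β)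
      (decayingDeriv m β) := by
  have hd : ∀ x, 0 < x → HasDerivAt (decaying m β) (decayingDeriv m β x) x := by
    intro x hx
    refine ((hasDerivAt_powFun hx _).mul
      (hasDerivAt_macdonald_comp m hβ hx)).congr_deriv ?_
    rw [decayingDeriv]
    ring
  refine ⟨hd, fun x hx => ?_, (continuousOn_potential_sub _ _).mul fun x hx =>
    (hd x hx).continuousAt.continuousWithinAt⟩
  have hx' : (x : ℂ) ≠ 0 := by exact_mod_cast hx.ne'
  have hpow := (isSolution_powFun (m := m) (w := 1 / 2 + m) (by ring)).hasDerivAt_deriv x hx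
  have hdd := (hpow.mul (hasDerivAt_macdonald_comp m hβ hx)).sub
    ((((hasDerivAt_id x).ofReal_comp.const_mul (2 * (β : ℂ))).mul
      (hasDerivAt_powFun hx (1 / 2 + m))).mul (hasDerivAt_macdonald_comp (m + 1) hβ hx))
  refine hdd.congr_deriv ?_
  have hrec := macdonald_recurrence (m + 1) (by positivity : 0 < β * x ^ 2)
  rw [add_sub_cancel_right] at hrec
  simp only [id, Complex.ofReal_one, Pi.mul_apply, decaying, powDeriv]
  push_cast at hrec
  linear_combination (norm := skip) (4 * (β : ℂ) * powFun (1 / 2 + m) x) * hrec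
  field_simp
  ring

theorem wronskian_decaying_plus (m : ℂ) (hβ : 0 < β) {x : ℝ} (hx : 0 < x) :
    wronskian (decaying m β) (decayingDeriv m β) (powFun (1 / 2 + m)) (powDeriv (1 / 2 + m)) x =
      2 * (β : ℂ) ^ (-m) * macdonald (-(m + 1)) (β * x ^ 2) := by
  have hy : 0 < β * x ^ 2 := by positivity
  have hpow : (β : ℂ) * x * ((x : ℂ) ^ (1 / 2 + m)) ^ 2 * ((β * x ^ 2 : ℝ) : ℂ) ^ (-(m + 1)) =
      (β : ℂ) ^ (-m) := by
    conv_lhs => rw [ofReal_cpow_eq_exp hy, ofReal_cpow_eq_exp hx]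
    rw [ofReal_cpow_eq_exp hβ, ofReal_eq_exp_log hβ, ofReal_eq_exp_log hx,
      Real.log_mul hβ.ne' (by positivity), Real.log_pow, ← Complex.exp_nat_mul,
      ← Complex.exp_add, ← Complex.exp_add, ← Complex.exp_add]
    push_cast
    ring_nf
  simp only [wronskian, decaying, decayingDeriv, powFun, powDeriv]
  rw [macdonald_neg (m + 1) hy, ← hpow]
  ring

theorem wronskian_decaying_minus (m : ℂ) (hβ : 0 < β) {x : ℝ} (hx : 0 < x) :
    wronskian (decaying m β) (decayingDeriv m β) (powFun (1 / 2 - m)) (powDeriv (1 / 2 - m)) x =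
      2 * macdonald (-(1 - m)) (β * x ^ 2) := by
  have hx' : (x : ℂ) ≠ 0 := by exact_mod_cast hx.ne'
  have hprod := powFun_half_add_mul_powFun_half_sub m hx
  have hrec := macdonald_recurrence m (by positivity : 0 < β * x ^ 2)
  push_cast at hrec
  have hfactor : wronskian (decaying m β) (decayingDeriv m β) (powFun (1 / 2 - m))
      (powDeriv (1 / 2 - m)) x =
      (powFun (1 / 2 + m) x * powFun (1 / 2 - m) x) / x * (-2 * m * macdonald m (β * x ^ 2)) +
      2 * β * x * (powFun (1 / 2 + m) x * powFun (1 / 2 - m) x) *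
        macdonald (m + 1) (β * x ^ 2) := by
    simp only [wronskian, decaying, decayingDeriv, powDeriv]
    ring
  rw [show -(1 - m) = m - 1 by ring, hfactor, hprod, div_self hx']
  linear_combination 2 * hrec

theorem tendsto_const_mul_sq_nhdsGT (hβ : 0 < β) :
    Tendsto (fun x : ℝ => β * x ^ 2) (𝓝[>] 0) (𝓝[>] 0) := by
  refine tendsto_nhdsWithin_iff.2 ⟨?_, ?_⟩
  · have hc : Continuous fun x : ℝ => β * x ^ 2 := by fun_prop
    simpa using (hc.tendsto 0).mono_left nhdsWithin_le_nhds
  · filter_upwards [self_mem_nhdsWithin] with x hx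
    exact mul_pos hβ (pow_pos hx 2)

theorem tendsto_wronskian_decaying_plus (hm : -1 < m.re) (hβ : 0 < β) :
    Tendsto (wronskian (decaying m β) (decayingDeriv m β) (powFun (1 / 2 + m))
      (powDeriv (1 / 2 + m))) (𝓝[>] 0) (𝓝 (2 * (β : ℂ) ^ (-m) * Complex.Gamma (m + 1))) := by
  refine (((tendsto_macdonald (s := m + 1) (by simp; linarith)).comp
    (tendsto_const_mul_sq_nhdsGT hβ)).const_mul (2 * (β : ℂ) ^ (-m))).congr' ?_
  filter_upwards [self_mem_nhdsWithin] with x hx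
  exact (wronskian_decaying_plus m hβ hx).symm

theorem tendsto_wronskian_decaying_minus (hm : m.re < 1) (hβ : 0 < β) :
    Tendsto (wronskian (decaying m β) (decayingDeriv m β) (powFun (1 / 2 - m))
      (powDeriv (1 / 2 - m))) (𝓝[>] 0) (𝓝 (2 * Complex.Gamma (1 - m))) := by
  refine (((tendsto_macdonald (s := 1 - m) (by simp; linarith)).comp
    (tendsto_const_mul_sq_nhdsGT hβ)).const_mul 2).congr' ?_
  filter_upwards [self_mem_nhdsWithin] with x hx
  exact (wronskian_decaying_minus m hβ hx).symm

theorem exists_norm_decaying_le (m : ℂ) (hβ : 0 < β) {p : ℝ} (hp : 0 ≤ p) (hpm : m.re < p) :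
    ∃ C, 0 ≤ C ∧ ∀ x, 0 < x → ‖decaying m β x‖ ≤ C * x ^ (1 / 2 + m.re - 2 * p) := by
  obtain ⟨C, hC0, hC⟩ := exists_norm_macdonald_le m hp hpm
  refine ⟨C * β ^ (-p), by positivity, fun x hx => ?_⟩
  have hβx : (β * x ^ 2) ^ (-p) = β ^ (-p) * x ^ (-2 * p) := by
    rw [Real.mul_rpow hβ.le (by positivity), ← Real.rpow_natCast, ← Real.rpow_mul hx.le]
    norm_num
  calc ‖decaying m β x‖ = x ^ (1 / 2 + m.re) * ‖macdonald m (β * x ^ 2)‖ := by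
        rw [decaying, norm_mul, Complex.norm_cpow_eq_rpow_re_of_pos hx]
        simp
    _ ≤ x ^ (1 / 2 + m.re) * (C * (β ^ (-p) * x ^ (-2 * p))) := by
        rw [← hβx]
        gcongr
        exact hC _ (by positivity)
    _ = C * β ^ (-p) * (x ^ (1 / 2 + m.re) * x ^ (-2 * p)) := by ring
    _ = _ := by rw [← Real.rpow_add hx]; ring_nf

end Decaying

/-! ### Membership in the domain of the minimal operator -/

theorem tendsto_toLp_of_dominated {X E : Type*} [MeasurableSpace X] [NormedAddCommGroup E]
    {μ : Measure X} {p : ENNReal} [Fact (1 ≤ p)] (hp : p ≠ ⊤) {f : ℕ → X → E} {F : X → E}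
    {B : X → ℝ} (hf : ∀ n, MemLp (f n) p μ) (hF : MemLp F p μ) (hB : MemLp B p μ)
    (hb : ∀ n, ∀ᵐ x ∂μ, ‖f n x - F x‖ ≤ B x)
    (hlim : ∀ᵐ x ∂μ, Tendsto (fun n => f n x) atTop (𝓝 (F x))) :
    Tendsto (fun n => (hf n).toLp (f n)) atTop (𝓝 (hF.toLp F)) := by
  have hp0 : p ≠ 0 := (one_pos.trans_le (Fact.out : 1 ≤ p)).ne'
  have hpos : 0 < p.toReal := ENNReal.toReal_pos hp0 hp
  have hint : Tendsto (fun n => ∫⁻ x, ‖f n x - F x‖ₑ ^ p.toReal ∂μ) atTop (𝓝 0) := by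
    rw [← lintegral_zero (μ := μ)]
    refine tendsto_lintegral_of_dominated_convergence' (fun x => ‖B x‖ₑ ^ p.toReal)
      (fun n => ((hf n).sub hF).1.enorm.pow_const _) (fun n => ?_)
      (lintegral_rpow_enorm_lt_top_of_eLpNorm_lt_top hp0 hp hB.2).ne ?_
    · filter_upwards [hb n] with x hx
      gcongr
      exact enorm_le_iff_norm_le.2 (hx.trans (Real.le_norm_self _))
    · filter_upwards [hlim] with x hx
      simpa [hpos] using ((hx.sub_const (F x)).enorm).ennrpow_const p.toReal
  rw [Lp.tendsto_Lp_iff_tendsto_eLpNorm'' f hf F hF]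
  simpa only [eLpNorm_eq_lintegral_rpow_enorm_toReal hp0 hp, Pi.sub_apply,
    ENNReal.zero_rpow_of_pos (one_div_pos.2 hpos)] using hint.ennrpow_const (1 / p.toReal)

theorem IsC2.deriv_eq {F F₁ F₂ : ℝ → ℂ} (hF : IsC2 F F₁ F₂) {x : ℝ} (hx : 0 < x) :
    deriv F x = F₁ x := (hF.hasDerivAt x hx).deriv

theorem IsC2.deriv_deriv_eq {F F₁ F₂ : ℝ → ℂ} (hF : IsC2 F F₁ F₂) {x : ℝ} (hx : 0 < x) :
    deriv (deriv F) x = F₂ x := by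
  have hloc : deriv F =ᶠ[𝓝 x] F₁ := by
    filter_upwards [Ioi_mem_nhds hx] with y hy using hF.deriv_eq hy
  rw [hloc.deriv_eq, (hF.hasDerivAt_deriv x hx).deriv]

theorem exists_norm_scaled_mul_le {g : ℝ → ℂ} (hg : Continuous g) {a b : ℝ}
    (h0 : ∀ x, x < a ∨ b < x → g x = 0) (k : ℕ) :
    ∃ M : ℝ, ∀ (r x : ℝ) (u : ℂ), 0 < x →
      ‖(r : ℂ) ^ k * g (r * x) * u‖ ≤ M * ‖u / (x : ℂ) ^ k‖ := by
  obtain ⟨M, hM⟩ := (isCompact_Icc (a := a) (b := b)).exists_bound_of_continuousOn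
    (f := fun x => (x : ℂ) ^ k * g x) (by fun_prop)
  have hbound : ∀ y : ℝ, ‖(y : ℂ) ^ k * g y‖ ≤ max M 0 := fun y => by
    by_cases hy : y ∈ Icc a b
    · exact (hM y hy).trans (le_max_left _ _)
    · rw [mem_Icc, not_and_or, not_le, not_le] at hy
      simp [h0 y hy]
  refine ⟨max M 0, fun r x u hx => ?_⟩
  have hx' : (x : ℂ) ≠ 0 := by exact_mod_cast hx.ne'
  have hscale : (r : ℂ) ^ k * g (r * x) * u =
      (((r * x : ℝ) : ℂ) ^ k * g (r * x)) * (u / (x : ℂ) ^ k) := by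
    push_cast
    rw [mul_pow]
    field_simp
  rw [hscale, norm_mul]
  gcongr
  exact hbound _

theorem eventually_lt_natCast_add_one_mul (c : ℝ) {x : ℝ} (hx : 0 < x) :
    ∀ᶠ n : ℕ in atTop, c < ((n : ℝ) + 1) * x :=
  ((tendsto_natCast_atTop_atTop.atTop_add tendsto_const_nhds).atTop_mul_const
    hx).eventually_gt_atTop c

/-- The cutoff near `0` at scale `1 / r` built from `χ`: if `IsCutoff χ a b` and `0 < r`, it
vanishes on `]-∞,a/r]` and equals `1` on `[b/r,∞[`. -/
def cutoffNearZero (χ : ℝ → ℂ) (r x : ℝ) : ℂ := 1 - χ (r * x)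

theorem deriv_cutoffNearZero (χ : ℝ → ℂ) (r x : ℝ) :
    deriv (cutoffNearZero χ r) x = -(r * deriv χ (r * x)) := by
  rw [show cutoffNearZero χ r = fun x => 1 - χ (r * x) from rfl, deriv_const_sub,
    deriv_comp_mul_left, Complex.real_smul]

theorem deriv_deriv_cutoffNearZero (χ : ℝ → ℂ) (r x : ℝ) :
    deriv (deriv (cutoffNearZero χ r)) x = -(r ^ 2 * deriv (deriv χ) (r * x)) := by
  rw [funext (deriv_cutoffNearZero χ r), deriv.fun_neg, deriv_const_mul_field,
    deriv_comp_mul_left, Complex.real_smul]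
  ring

namespace IsCutoff

variable {χ : ℝ → ℂ} {a b : ℝ}

theorem contDiff_cutoffNearZero (hχ : IsCutoff χ a b) (r : ℝ) :
    ContDiff ℝ ((⊤ : ℕ∞) : WithTop ℕ∞) (cutoffNearZero χ r) :=
  contDiff_const.sub (hχ.smooth.comp (by fun_prop))

theorem contDiff_deriv (hχ : IsCutoff χ a b) :
    ContDiff ℝ ((⊤ : ℕ∞) : WithTop ℕ∞) (deriv χ) :=
  (contDiff_infty_iff_deriv.1 hχ.smooth).2

theorem isTestFunction_cutoffNearZero_mul (hχ : IsCutoff χ a b) (ha : 0 < a) {r : ℝ} (hr : 0 < r)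
    {h : ℝ → ℂ} (hs : ContDiffOn ℝ ((⊤ : ℕ∞) : WithTop ℕ∞) h (Ioi 0)) {c : ℝ}
    (hc : ∀ x, c ≤ x → h x = 0) : IsTestFunction fun x => cutoffNearZero χ r x * h x := by
  have hzero : ∀ x ≤ a / r, cutoffNearZero χ r x * h x = 0 := fun x hx => by
    rw [le_div_iff₀' hr] at hx
    simp [cutoffNearZero, hχ.eq_one _ hx]
  have hsupport : tsupport (fun x => cutoffNearZero χ r x * h x) ⊆ Icc (a / r) c :=
    closure_minimal (fun x hx => ⟨le_of_not_ge fun hxa => hx (hzero x hxa),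
      le_of_not_ge fun hcx => hx (by simp [hc x hcx])⟩) isClosed_Icc
  refine ⟨contDiff_iff_contDiffAt.2 fun x => ?_,
    isCompact_Icc.of_isClosed_subset (isClosed_tsupport _) hsupport,
    hsupport.trans (Icc_subset_Ioi_zero (div_pos ha hr))⟩
  rcases lt_or_ge x (a / r) with hx | hx
  · refine (contDiffAt_const (c := (0 : ℂ))).congr_of_eventuallyEq ?_
    filter_upwards [Iio_mem_nhds hx] with y hy using hzero y (le_of_lt hy)
  · exact (hχ.contDiff_cutoffNearZero r).contDiffAt.mul
      (hs.contDiffAt (Ioi_mem_nhds ((div_pos ha hr).trans_le hx)))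

theorem diffExpr_cutoffNearZero_mul (hχ : IsCutoff χ a b) {h h₁ h₂ : ℝ → ℂ} (hh : IsC2 h h₁ h₂)
    (α : ℂ) (r : ℝ) {x : ℝ} (hx : 0 < x) :
    diffExpr α (fun x => cutoffNearZero χ r x * h x) x =
      cutoffNearZero χ r x * (-h₂ x + potential α x * h x) +
        (r : ℂ) ^ 2 * deriv (deriv χ) (r * x) * h x +
        2 * ((r : ℂ) ^ 1 * deriv χ (r * x) * h₁ x) := by
  have hρ := isC2_of_contDiff
    ((hχ.contDiff_cutoffNearZero r).of_le (WithTop.coe_le_coe.2 le_top))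
  rw [diffExpr, (hρ.mul hh).deriv_deriv_eq hx, deriv_cutoffNearZero,
    deriv_deriv_cutoffNearZero, potential]
  ring

theorem exists_norm_diffExpr_cutoffNearZero_mul_sub_le (hχ : IsCutoff χ a b) {h h₁ h₂ : ℝ → ℂ}
    (hh : IsC2 h h₁ h₂) (α : ℂ) : ∃ M₁ M₂ : ℝ, ∀ r x : ℝ, 0 < x →
      ‖diffExpr α (fun x => cutoffNearZero χ r x * h x) x - (-h₂ x + potential α x * h x)‖ ≤
        ‖-h₂ x + potential α x * h x‖ + M₂ * ‖h x / (x : ℂ) ^ 2‖ + M₁ * ‖h₁ x / (x : ℂ)‖ := by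
  obtain ⟨M₁, hM₁⟩ := exists_norm_scaled_mul_le hχ.contDiff_deriv.continuous
    (fun x hx => hχ.deriv_eq_zero hx) 1
  obtain ⟨M₂, hM₂⟩ := exists_norm_scaled_mul_le
    (contDiff_infty_iff_deriv.1 hχ.contDiff_deriv).2.continuous
    (fun x hx => hχ.deriv_deriv_eq_zero hx) 2
  refine ⟨2 * M₁, M₂, fun r x hx => ?_⟩
  have hfirst := hM₁ r x (h₁ x) hx
  rw [pow_one (x : ℂ)] at hfirst
  rw [hχ.diffExpr_cutoffNearZero_mul hh α r hx, add_sub_right_comm, add_sub_right_comm,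
    cutoffNearZero, show ∀ s g : ℂ, (1 - s) * g - g = -(s * g) from fun s g => by ring,
    mul_assoc 2 M₁]
  refine (norm_add₃_le).trans (add_le_add_three ?_ (hM₂ r x (h x) hx) ?_)
  · rw [norm_neg, norm_mul]
    exact mul_le_of_le_one_left (norm_nonneg _) (hχ.norm_le _)
  · rw [norm_mul, Complex.norm_ofNat]
    gcongr

end IsCutoff

theorem mem_minOp_graph_of_memLp {α : ℂ} {h h₁ h₂ : ℝ → ℂ} (hh : IsC2 h h₁ h₂)
    (hs : ContDiffOn ℝ ((⊤ : ℕ∞) : WithTop ℕ∞) h (Ioi 0)) {b : ℝ} (hb : ∀ x, b ≤ x → h x = 0)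
    (hh2 : MemLp h 2 halfLine)
    (hg2 : MemLp (fun x => -h₂ x + potential α x * h x) 2 halfLine)
    (hd1 : MemLp (fun x => h₁ x / x) 2 halfLine)
    (hd2 : MemLp (fun x => h x / (x : ℂ) ^ 2) 2 halfLine) :
    (hh2.toLp h, hg2.toLp _) ∈ (minOp α).graph := by
  obtain ⟨χ, hχ⟩ := exists_isCutoff one_lt_two
  obtain ⟨M₁, M₂, hM⟩ := hχ.exists_norm_diffExpr_cutoffNearZero_mul_sub_le hh α
  set φ : ℕ → ℝ → ℂ := fun n x => cutoffNearZero χ (n + 1) x * h x with hφ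
  have htest (n : ℕ) : IsTestFunction (φ n) := by
    refine hχ.isTestFunction_cutoffNearZero_mul one_pos (by positivity) hs hb
  have hφ2 (n : ℕ) : MemLp (φ n) 2 halfLine :=
    (htest n).smooth.continuous.memLp_of_hasCompactSupport (htest n).compact
  have hLφ2 (n : ℕ) : MemLp (diffExpr α (φ n)) 2 halfLine :=
    ((htest n).continuous_diffExpr α).memLp_of_hasCompactSupport ((htest n).compact_diffExpr α)
  have hφ_tendsto : Tendsto (fun n => (hφ2 n).toLp (φ n)) atTop (𝓝 (hh2.toLp h)) := by
    refine tendsto_toLp_of_dominated ENNReal.ofNat_ne_top hφ2 hh2 hh2.norm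
      (fun n => .of_forall fun x => ?_)
      ((ae_restrict_iff' measurableSet_Ioi).2 (.of_forall fun x hx => ?_))
    · rw [hφ, show cutoffNearZero χ (n + 1) x * h x - h x = -(χ ((n + 1) * x) * h x) by
        rw [cutoffNearZero]; ring, norm_neg, norm_mul]
      exact mul_le_of_le_one_left (norm_nonneg _) (hχ.norm_le _)
    · refine tendsto_const_nhds.congr' ?_
      filter_upwards [eventually_lt_natCast_add_one_mul 2 hx] with n hn
      simp [hφ, cutoffNearZero, hχ.eq_zero _ hn.le]
  have hLφ_tendsto : Tendsto (fun n => (hLφ2 n).toLp (diffExpr α (φ n))) atTop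
      (𝓝 (hg2.toLp _)) := by
    refine tendsto_toLp_of_dominated ENNReal.ofNat_ne_top hLφ2 hg2
      ((hg2.norm.add (hd2.norm.const_mul M₂)).add (hd1.norm.const_mul M₁))
      (fun n => (ae_restrict_iff' measurableSet_Ioi).2 (.of_forall fun x hx => hM _ x hx))
      ((ae_restrict_iff' measurableSet_Ioi).2 (.of_forall fun x hx => ?_))
    refine tendsto_const_nhds.congr' ?_
    filter_upwards [eventually_lt_natCast_add_one_mul 2 hx] with n hn
    rw [hφ, hχ.diffExpr_cutoffNearZero_mul hh α _ hx]
    simp [cutoffNearZero, hχ.eq_zero _ hn.le, hχ.deriv_eq_zero (.inr hn),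
      hχ.deriv_deriv_eq_zero (.inr hn)]
  rw [minOp_graph]
  exact mem_closure_of_tendsto (hφ_tendsto.prodMk_nhds hLφ_tendsto) (.of_forall fun n =>
    ⟨φ n, htest n, (hφ2 n).coeFn_toLp, (hLφ2 n).coeFn_toLp⟩)

theorem IsSolution.contDiffOn {F F₁ p : ℝ → ℂ} (hF : IsSolution p F F₁)
    (hp : ContDiffOn ℝ ((⊤ : ℕ∞) : WithTop ℕ∞) p (Ioi 0)) :
    ContDiffOn ℝ ((⊤ : ℕ∞) : WithTop ℕ∞) F (Ioi 0) := by
  have hcontDiff (n : ℕ) : ContDiffOn ℝ n F (Ioi 0) ∧ ContDiffOn ℝ n F₁ (Ioi 0) := by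
    induction n with
    | zero => exact ⟨contDiffOn_zero.2 hF.continuousOn, contDiffOn_zero.2 hF.continuousOn_deriv⟩
    | succ n ih =>
      push_cast
      rw [contDiffOn_succ_iff_deriv_of_isOpen isOpen_Ioi,
        contDiffOn_succ_iff_deriv_of_isOpen isOpen_Ioi]
      have hpF : ContDiffOn ℝ n (fun x => p x * F x) (Ioi 0) :=
        (hp.of_le (by exact_mod_cast le_top)).mul ih.1
      exact ⟨⟨fun x hx => (hF.hasDerivAt x hx).differentiableAt.differentiableWithinAt,
        by simp, ih.2.congr fun x hx => (hF.hasDerivAt x hx).deriv⟩,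
        fun x hx => (hF.hasDerivAt_deriv x hx).differentiableAt.differentiableWithinAt,
        by simp, hpF.congr fun x hx => (hF.hasDerivAt_deriv x hx).deriv⟩
  exact contDiffOn_infty.2 fun n => (hcontDiff n).1

theorem contDiffOn_potential_sub (α z : ℂ) :
    ContDiffOn ℝ ((⊤ : ℕ∞) : WithTop ℕ∞) (fun x => potential α x - z) (Ioi 0) := by
  have hsq : ContDiffOn ℝ ((⊤ : ℕ∞) : WithTop ℕ∞) (fun x : ℝ => (x : ℂ) ^ 2) (Ioi 0) :=
    (Complex.ofRealCLM.contDiff.pow 2).contDiffOn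
  have hinv := hsq.inv fun x (hx : 0 < x) => by simpa using hx.ne'
  exact (((contDiffOn_const (c := -(1 / 4) + α)).mul hinv).sub
    (contDiffOn_const (c := z))).congr fun x _ => by
      rw [potential, div_eq_mul_inv, Pi.inv_apply]

theorem norm_le_of_norm_deriv_le_rpow {W W' : ℝ → ℂ} {C q : ℝ} (hq : 0 < q) (hC : 0 ≤ C)
    (hd : ∀ x, 0 < x → HasDerivAt W (W' x) x) (hb : ∀ x, 0 < x → ‖W' x‖ ≤ C * x ^ (q - 1))
    (h0 : Tendsto W (𝓝[>] 0) (𝓝 0)) {x : ℝ} (hx : 0 < x) : ‖W x‖ ≤ C / q * x ^ q := by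
  have hlim : Tendsto (fun s => ‖W x - W s‖) (𝓝[>] 0) (𝓝 ‖W x‖) := by
    simpa using (tendsto_const_nhds.sub h0).norm
  refine le_of_tendsto hlim ?_
  filter_upwards [Ioo_mem_nhdsGT hx] with s hs
  have hprimitive (t : ℝ) (ht : 0 < t) :
      HasDerivAt (fun t => C / q * t ^ q) (C * t ^ (q - 1)) t := by
    refine ((Real.hasDerivAt_rpow_const (Or.inl ht.ne')).const_mul (C / q)).congr_deriv ?_
    field_simp
  have hpos (t : ℝ) (ht : t ∈ Icc s x) : 0 < t := hs.1.trans_le ht.1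
  refine image_norm_le_of_norm_deriv_right_le_deriv_boundary' (f := fun t => W t - W s)
    (f' := W') (B := fun t => C / q * t ^ q) (B' := fun t => C * t ^ (q - 1))
    (fun t ht => ((hd t (hpos t ht)).continuousAt.sub continuousAt_const).continuousWithinAt)
    (fun t ht => ((hd t (hpos t (Ico_subset_Icc_self ht))).sub_const _).hasDerivWithinAt) ?_
    (fun t ht => (hprimitive t (hpos t ht)).continuousAt.continuousWithinAt)
    (fun t ht => (hprimitive t (hpos t (Ico_subset_Icc_self ht))).hasDerivWithinAt)
    (fun t ht => hb t (hpos t (Ico_subset_Icc_self ht))) ⟨hs.2.le, le_rfl⟩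
  rw [sub_self, norm_zero]
  exact mul_nonneg (div_nonneg hC hq.le) (Real.rpow_nonneg hs.1.le q)

theorem integrableOn_sq_norm_of_norm_le_rpow {w : ℝ → ℂ} {s : Set ℝ} {A k : ℝ}
    (hs : MeasurableSet s) (hs0 : s ⊆ Ioi 0) (hw : ContinuousOn w (Ioi 0))
    (hint : IntegrableOn (fun x : ℝ => x ^ (2 * k)) s) (hle : ∀ x ∈ s, ‖w x‖ ≤ A * x ^ k) :
    IntegrableOn (fun x => ‖w x‖ ^ 2) s := by
  refine (hint.const_mul (A ^ 2)).mono'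
    (((hw.mono hs0).norm.pow 2).aestronglyMeasurable hs)
    ((ae_restrict_iff' hs).2 (.of_forall fun x hx => ?_))
  rw [norm_pow, norm_norm]
  refine (pow_le_pow_left₀ (norm_nonneg _) (hle x hx) 2).trans_eq ?_
  rw [mul_pow, mul_comm 2 k, Real.rpow_mul (le_of_lt (hs0 hx)), Real.rpow_two]

theorem integrableOn_Ioc_rpow {b e : ℝ} (hb : 0 ≤ b) (he : -1 < e) :
    IntegrableOn (fun x : ℝ => x ^ e) (Ioc 0 b) :=
  (intervalIntegrable_iff_integrableOn_Ioc_of_le hb).1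
    (intervalIntegral.intervalIntegrable_rpow' he)

theorem memLp_of_integrableOn_Ioc_of_integrableOn_Ioi {w : ℝ → ℂ} {b : ℝ} (hb : 0 ≤ b)
    (hw : ContinuousOn w (Ioi 0)) (hnear : IntegrableOn (fun x => ‖w x‖ ^ 2) (Ioc 0 b))
    (hfar : IntegrableOn (fun x => ‖w x‖ ^ 2) (Ioi b)) : MemLp w 2 halfLine := by
  rw [memLp_two_iff_integrable_sq_norm (hw.aestronglyMeasurable measurableSet_Ioi)]
  have hunion := hnear.union hfar
  rwa [Ioc_union_Ioi_eq_Ioi hb] at hunion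

theorem memLp_mul_of_norm_le_rpow {ψ u : ℝ → ℂ} {b C e : ℝ} (hb : 0 ≤ b) (he : -(1 / 2) < e)
    (hψ : Continuous ψ) (h0 : ∀ x, b < x → ψ x = 0) (hu : ContinuousOn u (Ioi 0))
    (hC : ∀ x, 0 < x → ‖u x‖ ≤ C * x ^ e) : MemLp (fun x => ψ x * u x) 2 halfLine := by
  obtain ⟨M, hM⟩ := (isCompact_Icc (a := 0) (b := b)).exists_bound_of_continuousOn hψ.continuousOn
  have hψu : ContinuousOn (fun x => ψ x * u x) (Ioi 0) := hψ.continuousOn.mul hu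
  have hnear : IntegrableOn (fun x => ‖ψ x * u x‖ ^ 2) (Ioc 0 b) := by
    refine integrableOn_sq_norm_of_norm_le_rpow (A := M * C) measurableSet_Ioc Ioc_subset_Ioi_self
      hψu (integrableOn_Ioc_rpow hb (by linarith)) fun x hx => ?_
    have hψx := hM x (Ioc_subset_Icc_self hx)
    rw [norm_mul, mul_assoc]
    exact mul_le_mul hψx (hC x hx.1) (norm_nonneg _) ((norm_nonneg _).trans hψx)
  have hfar : IntegrableOn (fun x => ‖ψ x * u x‖ ^ 2) (Ioi b) :=
    integrableOn_zero.congr_fun (fun x hx => by simp [h0 x hx]) measurableSet_Ioi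
  exact memLp_of_integrableOn_Ioc_of_integrableOn_Ioi hb hψu hnear hfar

theorem memLp_of_norm_le_rpow_of_norm_le_rpow {w : ℝ → ℂ} {C D e d : ℝ} (he : -(1 / 2) < e)
    (hd : d < -(1 / 2)) (hw : ContinuousOn w (Ioi 0))
    (hC : ∀ x, 0 < x → ‖w x‖ ≤ C * x ^ e) (hD : ∀ x, 0 < x → ‖w x‖ ≤ D * x ^ d) :
    MemLp w 2 halfLine := by
  exact memLp_of_integrableOn_Ioc_of_integrableOn_Ioi zero_le_one hw
    (integrableOn_sq_norm_of_norm_le_rpow measurableSet_Ioc Ioc_subset_Ioi_self hw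
      (integrableOn_Ioc_rpow zero_le_one (by linarith)) fun x hx => hC x hx.1)
    (integrableOn_sq_norm_of_norm_le_rpow measurableSet_Ioi (Ioi_subset_Ioi zero_le_one) hw
      ((integrableOn_Ioi_rpow_iff one_pos).2 (by linarith)) fun x hx => hD x (one_pos.trans hx))

theorem mem_eigenvalues_iff {m : ℂ} {κ : OnePoint ℂ} {z : ℂ} :
    z ∈ eigenvalues (almostHomOp m κ) ↔
      ∃ f : L2HalfLine, f ≠ 0 ∧ (f, z • f) ∈ maxGraph (m ^ 2) ∧ f ∈ boundarySpace m κ := by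
  rw [← maxOp_graph]
  constructor
  · rintro ⟨f, hf0, hf⟩
    refine ⟨f, hf0, ?_, f.2.1⟩
    rw [← hf]
    exact LinearPMap.le_graph_of_le LinearPMap.domRestrict_le (LinearPMap.mem_graph _ f)
  · rintro ⟨f, hf0, hf, hb⟩
    obtain ⟨y, hy, hmax⟩ := (LinearPMap.mem_graph_iff _).1 hf
    exact ⟨⟨f, hb, (show (y : L2HalfLine) = f from hy) ▸ y.2⟩, hf0,
      (LinearPMap.domRestrict_apply hy.symm).trans hmax⟩

theorem memLp_decaying {m : ℂ} (hm : |m.re| < 1) {β : ℝ} (hβ : 0 < β) :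
    MemLp (decaying m β) 2 halfLine := by
  obtain ⟨hm_gt, hm_lt⟩ := abs_lt.1 hm
  obtain ⟨p, hp, hp_lt⟩ := exists_between
    (show max 0 m.re < (1 + m.re) / 2 from max_lt (by linarith) (by linarith))
  obtain ⟨C, -, hC⟩ := exists_norm_decaying_le m hβ ((le_max_left _ _).trans hp.le)
    ((le_max_right _ _).trans_lt hp)
  obtain ⟨D, -, hD⟩ := exists_norm_decaying_le m hβ zero_le_two (by linarith : m.re < 2)
  exact memLp_of_norm_le_rpow_of_norm_le_rpow (by linarith) (by linarith)
    (isSolution_decaying m hβ).continuousOn hC hD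

/-! ### The boundary functions -/

theorem wronskian_sub_const_mul (F F₁ B B₁ u u₁ : ℝ → ℂ) (c : ℂ) (x : ℝ) :
    wronskian (fun x => F x - c * B x) (fun x => F₁ x - c * B₁ x) u u₁ x =
      wronskian F F₁ u u₁ x - c * wronskian B B₁ u u₁ x := by
  simp only [wronskian]
  ring

theorem isSolution_powFun_half_add (m : ℂ) :
    IsSolution (potential (m ^ 2)) (powFun (1 / 2 + m)) (powDeriv (1 / 2 + m)) :=
  isSolution_powFun (by ring)

theorem isSolution_powFun_half_sub (m : ℂ) :
    IsSolution (potential (m ^ 2)) (powFun (1 / 2 - m)) (powDeriv (1 / 2 - m)) :=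
  isSolution_powFun (by ring)

theorem wronskian_powFun (m : ℂ) {x : ℝ} (hx : 0 < x) :
    wronskian (powFun (1 / 2 - m)) (powDeriv (1 / 2 - m)) (powFun (1 / 2 + m))
      (powDeriv (1 / 2 + m)) x = 2 * m := by
  have hx' : (x : ℂ) ≠ 0 := by exact_mod_cast hx.ne'
  calc wronskian (powFun (1 / 2 - m)) (powDeriv (1 / 2 - m)) (powFun (1 / 2 + m))
        (powDeriv (1 / 2 + m)) x
      = powFun (1 / 2 + m) x * powFun (1 / 2 - m) x / x * (2 * m) := by
        simp only [wronskian]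
        ring
    _ = 2 * m := by rw [powFun_half_add_mul_powFun_half_sub m hx, div_self hx', one_mul]

/-- The derivative of `boundaryFun m κ` for finite `κ`. -/
abbrev boundaryDeriv (m κ : ℂ) : ℝ → ℂ := fun x =>
  powDeriv (1 / 2 - m) x + κ * powDeriv (1 / 2 + m) x

theorem isSolution_boundaryFun (m κ : ℂ) :
    IsSolution (potential (m ^ 2)) (boundaryFun m (OnePoint.some κ)) (boundaryDeriv m κ) :=
  ((isSolution_powFun_half_sub m).add ((isSolution_powFun_half_add m).const_mul κ)).congr
    fun x => by
      simp only [boundaryFun]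
      ring

theorem wronskian_boundaryFun_powFun_half_add (m κ : ℂ) {x : ℝ} (hx : 0 < x) :
    wronskian (boundaryFun m (OnePoint.some κ)) (boundaryDeriv m κ) (powFun (1 / 2 + m))
      (powDeriv (1 / 2 + m)) x = 2 * m := by
  rw [← wronskian_powFun m hx]
  simp only [wronskian, boundaryFun]
  ring

theorem wronskian_boundaryFun_powFun_half_sub (m κ : ℂ) {x : ℝ} (hx : 0 < x) :
    wronskian (boundaryFun m (OnePoint.some κ)) (boundaryDeriv m κ) (powFun (1 / 2 - m))
      (powDeriv (1 / 2 - m)) x = -2 * m * κ := by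
  rw [show -2 * m * κ = -κ * (2 * m) by ring, ← wronskian_powFun m hx]
  simp only [wronskian, boundaryFun]
  ring

theorem norm_powFun {w : ℂ} {x : ℝ} (hx : 0 < x) : ‖powFun w x‖ = x ^ w.re :=
  Complex.norm_cpow_eq_rpow_re_of_pos hx w

theorem norm_powDeriv {w : ℂ} {x : ℝ} (hx : 0 < x) : ‖powDeriv w x‖ = ‖w‖ * x ^ (w.re - 1) := by
  rw [powDeriv, norm_div, norm_mul, Complex.norm_cpow_eq_rpow_re_of_pos hx, Complex.norm_real,
    Real.norm_of_nonneg hx.le, Real.rpow_sub_one hx.ne', mul_div_assoc]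

theorem norm_wronskian_powFun_le {α w z : ℂ} {D D₁ K : ℝ → ℂ} {C e : ℝ}
    (hD : IsC2 D D₁ (fun x => potential α x * D x - z * K x))
    (hw : IsSolution (potential α) (powFun w) (powDeriv w))
    (hK : ∀ x, 0 < x → ‖K x‖ ≤ C * x ^ e) (he : 0 < e + 1 + w.re)
    (h0 : Tendsto (wronskian D D₁ (powFun w) (powDeriv w)) (𝓝[>] 0) (𝓝 0)) {x : ℝ}
    (hx : 0 < x) :
    ‖wronskian D D₁ (powFun w) (powDeriv w) x‖ ≤
      ‖z‖ * C / (e + 1 + w.re) * x ^ (e + 1 + w.re) := by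
  have hC : 0 ≤ C := by simpa using (norm_nonneg _).trans (hK 1 one_pos)
  refine norm_le_of_norm_deriv_le_rpow he (by positivity)
    (fun t ht => hD.hasDerivAt_wronskian hw ht) (fun t ht => ?_) h0 hx
  calc ‖D t * (potential α t * powFun w t) - (potential α t * D t - z * K t) * powFun w t‖
      = ‖z‖ * ‖K t‖ * t ^ w.re := by
        rw [← norm_powFun ht, ← norm_mul, ← norm_mul]
        congr 1
        ring
    _ ≤ ‖z‖ * (C * t ^ e) * t ^ w.re := by gcongr; exact hK t ht
    _ = ‖z‖ * C * t ^ (e + 1 + w.re - 1) := by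
        rw [show e + 1 + w.re - 1 = e + w.re by ring, Real.rpow_add ht]
        ring

theorem norm_mul_sub_mul_le_rpow {u v U V : ℂ} {x a b A B p q p' q' s : ℝ} (hx : 0 < x)
    (hu : ‖u‖ = a * x ^ p) (hv : ‖v‖ = b * x ^ q) (hU : ‖U‖ ≤ A * x ^ p')
    (hV : ‖V‖ ≤ B * x ^ q') (hp : p + p' = s) (hq : q + q' = s) :
    ‖u * U - v * V‖ ≤ (a * A + b * B) * x ^ s :=
  calc ‖u * U - v * V‖ ≤ ‖u‖ * ‖U‖ + ‖v‖ * ‖V‖ := by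
        simpa only [norm_mul] using norm_sub_le (u * U) (v * V)
    _ ≤ ‖u‖ * (A * x ^ p') + ‖v‖ * (B * x ^ q') := by gcongr
    _ = a * A * x ^ (p + p') + b * B * x ^ (q + q') := by
        rw [hu, hv, Real.rpow_add hx, Real.rpow_add hx]
        ring
    _ = (a * A + b * B) * x ^ s := by rw [hp, hq, add_mul]

/- Cramer's rule in the basis `x ^ (1 / 2 ± m)` recovers `D` and `D₁` from the two Wronskians,
which are controlled by integrating their derivatives from `0`. -/
theorem exists_norm_le_of_tendsto_wronskian {m z : ℂ} (hm0 : m ≠ 0) {D D₁ K : ℝ → ℂ} {C e : ℝ}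
    (hD : IsC2 D D₁ (fun x => potential (m ^ 2) x * D x - z * K x))
    (hK : ∀ x, 0 < x → ‖K x‖ ≤ C * x ^ e) (he : |m.re| < e + 3 / 2)
    (hadd : Tendsto (wronskian D D₁ (powFun (1 / 2 + m)) (powDeriv (1 / 2 + m))) (𝓝[>] 0) (𝓝 0))
    (hsub : Tendsto (wronskian D D₁ (powFun (1 / 2 - m)) (powDeriv (1 / 2 - m))) (𝓝[>] 0) (𝓝 0)) :
    ∃ A B, ∀ x, 0 < x → ‖D x‖ ≤ A * x ^ (e + 2) ∧ ‖D₁ x‖ ≤ B * x ^ (e + 1) := by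
  obtain ⟨hm_gt, hm_lt⟩ := abs_lt.1 he
  have hre_add : (1 / 2 + m : ℂ).re = 1 / 2 + m.re := by simp
  have hre_sub : (1 / 2 - m : ℂ).re = 1 / 2 - m.re := by simp
  have h2m : 0 < ‖2 * m‖ := by simpa using hm0
  set Cadd := ‖z‖ * C / (e + 1 + (1 / 2 + m).re)
  set Csub := ‖z‖ * C / (e + 1 + (1 / 2 - m).re)
  refine ⟨(1 * Cadd + 1 * Csub) / ‖2 * m‖,
    (‖1 / 2 - m‖ * Cadd + ‖1 / 2 + m‖ * Csub) / ‖2 * m‖, fun x hx => ?_⟩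
  have hWadd := norm_wronskian_powFun_le hD (isSolution_powFun_half_add m) hK
    (by rw [hre_add]; linarith) hadd hx
  have hWsub := norm_wronskian_powFun_le hD (isSolution_powFun_half_sub m) hK
    (by rw [hre_sub]; linarith) hsub hx
  have hcramer : 2 * m * D x =
      powFun (1 / 2 - m) x * wronskian D D₁ (powFun (1 / 2 + m)) (powDeriv (1 / 2 + m)) x -
        powFun (1 / 2 + m) x * wronskian D D₁ (powFun (1 / 2 - m)) (powDeriv (1 / 2 - m)) x := by
    rw [← wronskian_powFun m hx]
    simp only [wronskian]
    ring
  have hcramer_deriv : 2 * m * D₁ x =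
      powDeriv (1 / 2 - m) x * wronskian D D₁ (powFun (1 / 2 + m)) (powDeriv (1 / 2 + m)) x -
        powDeriv (1 / 2 + m) x *
          wronskian D D₁ (powFun (1 / 2 - m)) (powDeriv (1 / 2 - m)) x := by
    rw [← wronskian_powFun m hx]
    simp only [wronskian]
    ring
  constructor
  · rw [div_mul_eq_mul_div, le_div_iff₀' h2m, ← norm_mul, hcramer]
    exact norm_mul_sub_mul_le_rpow hx ((norm_powFun hx).trans (one_mul _).symm)
      ((norm_powFun hx).trans (one_mul _).symm) hWadd hWsub
      (by rw [hre_add, hre_sub]; ring) (by rw [hre_add, hre_sub]; ring)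
  · rw [div_mul_eq_mul_div, le_div_iff₀' h2m, ← norm_mul, hcramer_deriv]
    exact norm_mul_sub_mul_le_rpow hx (norm_powDeriv hx) (norm_powDeriv hx) hWadd hWsub
      (by rw [hre_add, hre_sub]; ring) (by rw [hre_add, hre_sub]; ring)

theorem norm_div_pow_le_rpow {u : ℂ} {x A s : ℝ} (k : ℕ) (hx : 0 < x)
    (hu : ‖u‖ ≤ A * x ^ (s + k)) : ‖u / (x : ℂ) ^ k‖ ≤ A * x ^ s := by
  rwa [norm_div, norm_pow, Complex.norm_real, Real.norm_of_nonneg hx.le,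
    div_le_iff₀ (pow_pos hx k), mul_assoc, ← Real.rpow_add_natCast hx.ne']

theorem continuousOn_div_pow {u : ℝ → ℂ} (hu : ContinuousOn u (Ioi 0)) (k : ℕ) :
    ContinuousOn (fun x => u x / (x : ℂ) ^ k) (Ioi 0) :=
  hu.div (Complex.continuous_ofReal.pow k).continuousOn fun _ hx =>
    pow_ne_zero k (by exact_mod_cast (mem_Ioi.1 hx).ne')

section Cutoff

variable {χ u : ℝ → ℂ} {a b C e : ℝ}

theorem IsCutoff.memLp_mul_of_norm_le_rpow (hχ : IsCutoff χ a b) (hb : 0 ≤ b)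
    (he : -(1 / 2) < e) (hu : ContinuousOn u (Ioi 0)) (hC : ∀ x, 0 < x → ‖u x‖ ≤ C * x ^ e) :
    MemLp (fun x => χ x * u x) 2 halfLine :=
  AlmostHomogeneous.memLp_mul_of_norm_le_rpow hb he hχ.smooth.continuous
    (fun x hx => hχ.eq_zero x hx.le) hu hC

theorem IsCutoff.memLp_deriv_mul_of_norm_le_rpow (hχ : IsCutoff χ a b) (hb : 0 ≤ b)
    (he : -(1 / 2) < e) (hu : ContinuousOn u (Ioi 0)) (hC : ∀ x, 0 < x → ‖u x‖ ≤ C * x ^ e) :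
    MemLp (fun x => deriv χ x * u x) 2 halfLine :=
  AlmostHomogeneous.memLp_mul_of_norm_le_rpow hb he hχ.contDiff_deriv.continuous
    (fun _ hx => hχ.deriv_eq_zero (.inr hx)) hu hC

theorem IsCutoff.memLp_deriv_deriv_mul_of_norm_le_rpow (hχ : IsCutoff χ a b) (hb : 0 ≤ b)
    (he : -(1 / 2) < e) (hu : ContinuousOn u (Ioi 0)) (hC : ∀ x, 0 < x → ‖u x‖ ≤ C * x ^ e) :
    MemLp (fun x => deriv (deriv χ) x * u x) 2 halfLine :=
  AlmostHomogeneous.memLp_mul_of_norm_le_rpow hb he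
    (contDiff_infty_iff_deriv.1 hχ.contDiff_deriv).2.continuous
    (fun _ hx => hχ.deriv_deriv_eq_zero (.inr hx)) hu hC

end Cutoff

theorem exists_mem_minOp_domain {α : ℂ} {D D₁ D₂ : ℝ → ℂ} {A B C e : ℝ} (hD : IsC2 D D₁ D₂)
    (hs : ContDiffOn ℝ ((⊤ : ℕ∞) : WithTop ℕ∞) D (Ioi 0)) (he : -(1 / 2) < e)
    (hD_le : ∀ x, 0 < x → ‖D x‖ ≤ A * x ^ (e + 2))
    (hD₁_le : ∀ x, 0 < x → ‖D₁ x‖ ≤ B * x ^ (e + 1))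
    (hLD_le : ∀ x, 0 < x → ‖-D₂ x + potential α x * D x‖ ≤ C * x ^ e) :
    ∃ h ∈ (minOp α).domain, ∀ᵐ x ∂halfLine, x < 1 → D x = h x := by
  obtain ⟨χ, hχ⟩ := exists_isCutoff one_lt_two
  have hD_div_le (x : ℝ) (hx : 0 < x) : ‖D x / (x : ℂ) ^ 1‖ ≤ A * x ^ (e + 1) :=
    norm_div_pow_le_rpow 1 hx ((hD_le x hx).trans_eq (by norm_num [add_assoc]))
  have hD₁_div_le (x : ℝ) (hx : 0 < x) : ‖D₁ x / (x : ℂ) ^ 1‖ ≤ B * x ^ e :=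
    norm_div_pow_le_rpow 1 hx ((hD₁_le x hx).trans_eq (by norm_num))
  have hLD := hD.continuousOn_deriv_deriv.neg.add ((continuousOn_potential α).mul hD.continuousOn)
  have hχD : MemLp (fun x => χ x * D x) 2 halfLine :=
    hχ.memLp_mul_of_norm_le_rpow zero_le_two (by linarith) hD.continuousOn hD_le
  have hχD_deriv_div : MemLp (fun x => (deriv χ x * D x + χ x * D₁ x) / x) 2 halfLine :=
    ((hχ.memLp_deriv_mul_of_norm_le_rpow zero_le_two (by linarith)
      (continuousOn_div_pow hD.continuousOn 1) hD_div_le).add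
    (hχ.memLp_mul_of_norm_le_rpow zero_le_two he
      (continuousOn_div_pow hD.continuousOn_deriv 1) hD₁_div_le)).ae_eq (.of_forall fun x => by
        simp only [Pi.add_apply, pow_one]
        ring)
  have hχD_div_sq : MemLp (fun x => χ x * D x / (x : ℂ) ^ 2) 2 halfLine :=
    (hχ.memLp_mul_of_norm_le_rpow zero_le_two he (continuousOn_div_pow hD.continuousOn 2)
      fun x hx => norm_div_pow_le_rpow 2 hx (hD_le x hx)).ae_eq (.of_forall fun x => by ring)
  have hLχD : MemLp (fun x => -(deriv (deriv χ) x * D x + 2 * deriv χ x * D₁ x + χ x * D₂ x) +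
      potential α x * (χ x * D x)) 2 halfLine :=
    (((hχ.memLp_mul_of_norm_le_rpow zero_le_two he hLD hLD_le).sub
    (hχ.memLp_deriv_deriv_mul_of_norm_le_rpow zero_le_two (by linarith) hD.continuousOn
      hD_le)).sub
    ((hχ.memLp_deriv_mul_of_norm_le_rpow zero_le_two (by linarith) hD.continuousOn_deriv
      hD₁_le).const_mul 2)).ae_eq (.of_forall fun x => by
        simp only [Pi.sub_apply, Pi.add_apply, Pi.neg_apply, Pi.mul_apply]
        ring)
  have hmem := mem_minOp_graph_of_memLp (hχ.isC2.mul hD) (hχ.smooth.contDiffOn.mul hs)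
    (fun x hx => mul_eq_zero_of_left (hχ.eq_zero x hx) _) hχD hLχD hχD_deriv_div hχD_div_sq
  refine ⟨hχD.toLp _, LinearPMap.mem_domain_of_mem_graph hmem, ?_⟩
  filter_upwards [hχD.coeFn_toLp] with x hx hx1
  rw [hx, hχ.eq_one x hx1.le, one_mul]

theorem IsC2.deriv_eq_zero {F F₁ F₂ : ℝ → ℂ} (hF : IsC2 F F₁ F₂) (h : ∀ x, 0 < x → F x = 0)
    {x : ℝ} (hx : 0 < x) : F₁ x = 0 :=
  (hF.hasDerivAt x hx).unique <| (hasDerivAt_const x 0).congr_of_eventuallyEq <| by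
    filter_upwards [Ioi_mem_nhds hx] with y hy using h y hy

theorem exists_decaying_ne_zero {m : ℂ} (hm : m.re < 1) {β : ℝ} (hβ : 0 < β) :
    ∃ x, 0 < x ∧ decaying m β x ≠ 0 := by
  by_contra! hzero
  have hlim : Tendsto (wronskian (decaying m β) (decayingDeriv m β) (powFun (1 / 2 - m))
      (powDeriv (1 / 2 - m))) (𝓝[>] 0) (𝓝 0) :=
    tendsto_const_nhds.congr' <| by
      filter_upwards [self_mem_nhdsWithin] with x hx
      simp only [wronskian, hzero x hx, (isSolution_decaying m hβ).deriv_eq_zero hzero hx, zero_mul,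
        sub_zero]
  have hGamma : Complex.Gamma (1 - m) ≠ 0 := Complex.Gamma_ne_zero_of_re_pos (by simpa using hm)
  exact mul_ne_zero two_ne_zero hGamma
    (tendsto_nhds_unique (tendsto_wronskian_decaying_minus hm hβ) hlim)

theorem eq_zero_of_ae_eq_zero {F : ℝ → ℂ} (hF : ContinuousOn F (Ioi 0))
    (h : F =ᵐ[halfLine] 0) {x : ℝ} (hx : 0 < x) : F x = 0 :=
  Measure.eqOn_of_ae_eq h hF continuousOn_const
    (by rw [isOpen_Ioi.interior_eq]; exact subset_closure) hx

theorem IsSolution.toLp_mem_maxGraph {α z : ℂ} {F F₁ : ℝ → ℂ}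
    (hF : IsSolution (fun x => potential α x - z) F F₁) (hF2 : MemLp F 2 halfLine) :
    (hF2.toLp F, z • hF2.toLp F) ∈ maxGraph α := by
  refine mem_maxGraph_iff.2 fun φ hφ => ?_
  calc ∫ x, hF2.toLp F x * diffExpr α φ x ∂halfLine
      = ∫ x, F x * diffExpr α φ x ∂halfLine :=
        integral_congr_ae (by filter_upwards [hF2.coeFn_toLp] with x hx; rw [hx])
    _ = ∫ x, (-((potential α x - z) * F x) + potential α x * F x) * φ x ∂halfLine :=
        hF.integral_mul_diffExpr α hφ
    _ = ∫ x, (z • hF2.toLp F : L2HalfLine) x * φ x ∂halfLine := by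
        refine integral_congr_ae ?_
        filter_upwards [hF2.coeFn_toLp, Lp.coeFn_smul z (hF2.toLp F)] with x hx hzx
        rw [hzx, Pi.smul_apply, hx, smul_eq_mul]
        ring

theorem IsSolution.toLp_mem_boundarySpace {m κ z c : ℂ} (hm0 : m ≠ 0) {F F₁ : ℝ → ℂ} {C e : ℝ}
    (hF : IsSolution (fun x => potential (m ^ 2) x - z) F F₁) (hF2 : MemLp F 2 halfLine)
    (he : -(1 / 2) < e) (hme : |m.re| < e + 3 / 2) (hF_le : ∀ x, 0 < x → ‖F x‖ ≤ C * x ^ e)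
    (hadd : Tendsto (wronskian F F₁ (powFun (1 / 2 + m)) (powDeriv (1 / 2 + m))) (𝓝[>] 0)
      (𝓝 (c * (2 * m))))
    (hsub : Tendsto (wronskian F F₁ (powFun (1 / 2 - m)) (powDeriv (1 / 2 - m))) (𝓝[>] 0)
      (𝓝 (c * (-2 * m * κ)))) :
    hF2.toLp F ∈ boundarySpace m (OnePoint.some κ) := by
  have hB := isSolution_boundaryFun m κ
  set D : ℝ → ℂ := fun x => F x - c * boundaryFun m (OnePoint.some κ) x
  set D₁ : ℝ → ℂ := fun x => F₁ x - c * boundaryDeriv m κ x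
  have hD : IsC2 D D₁ (fun x => potential (m ^ 2) x * D x - z * F x) :=
    (hF.sub (hB.const_mul c)).congr fun x => by
      simp only [D]
      ring
  have hDadd : Tendsto (wronskian D D₁ (powFun (1 / 2 + m)) (powDeriv (1 / 2 + m)))
      (𝓝[>] 0) (𝓝 0) := by
    rw [← sub_self (c * (2 * m))]
    refine (hadd.sub_const _).congr' ?_
    filter_upwards [self_mem_nhdsWithin] with x hx
    rw [wronskian_sub_const_mul, wronskian_boundaryFun_powFun_half_add m κ hx]
  have hDsub : Tendsto (wronskian D D₁ (powFun (1 / 2 - m)) (powDeriv (1 / 2 - m)))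
      (𝓝[>] 0) (𝓝 0) := by
    rw [← sub_self (c * (-2 * m * κ))]
    refine (hsub.sub_const _).congr' ?_
    filter_upwards [self_mem_nhdsWithin] with x hx
    rw [wronskian_sub_const_mul, wronskian_boundaryFun_powFun_half_sub m κ hx]
  obtain ⟨A, B, hAB⟩ := exists_norm_le_of_tendsto_wronskian hm0 hD hF_le hme hDadd hDsub
  have hD_smooth : ContDiffOn ℝ ((⊤ : ℕ∞) : WithTop ℕ∞) D (Ioi 0) :=
    (hF.contDiffOn (contDiffOn_potential_sub _ _)).sub (contDiffOn_const.mul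
      (hB.contDiffOn (by simpa only [sub_zero] using contDiffOn_potential_sub (m ^ 2) 0)))
  obtain ⟨g, hg, hDg⟩ := exists_mem_minOp_domain (C := ‖z‖ * C) hD hD_smooth he
    (fun x hx => (hAB x hx).1) (fun x hx => (hAB x hx).2) fun x hx => by
      rw [show -(potential (m ^ 2) x * D x - z * F x) + potential (m ^ 2) x * D x = z * F x by
        ring, norm_mul, mul_assoc]
      gcongr
      exact hF_le x hx
  refine ⟨c, g, hg, 1, one_pos, ?_⟩
  filter_upwards [hDg, hF2.coeFn_toLp] with x hx hFx hx1
  rw [hFx, ← hx hx1]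

theorem mem_eigenvalues_of_eq_zero {m κ : ℂ} (hm0 : m ≠ 0) (hm : |m.re| < 1) {β : ℝ} (hβ : 0 < β)
    (h : κ * (β : ℂ) ^ (-m) * Complex.Gamma (m + 1) + Complex.Gamma (1 - m) = 0) :
    (-4 * β : ℂ) ∈ eigenvalues (almostHomOp m (OnePoint.some κ)) := by
  obtain ⟨hm_gt, hm_lt⟩ := abs_lt.1 hm
  have hK := isSolution_decaying m hβ
  have hK2 := memLp_decaying hm hβ
  obtain ⟨p, hmax_lt, hp_lt⟩ := exists_between
    (show max 0 m.re < (1 + m.re) / 2 from max_lt (by linarith) (by linarith))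
  obtain ⟨hp_pos, hm_lt_p⟩ := max_lt_iff.1 hmax_lt
  obtain ⟨C, -, hK_le⟩ := exists_norm_decaying_le m hβ hp_pos.le hm_lt_p
  set c : ℂ := (β : ℂ) ^ (-m) * Complex.Gamma (m + 1) / m
  have hc_mul : c * m = (β : ℂ) ^ (-m) * Complex.Gamma (m + 1) := div_mul_cancel₀ _ hm0
  refine mem_eigenvalues_iff.2 ⟨hK2.toLp _, fun hzero => ?_, hK.toLp_mem_maxGraph hK2,
    hK.toLp_mem_boundarySpace hm0 hK2 (c := c) (by linarith)
      (abs_lt.2 ⟨by linarith, by linarith⟩) hK_le ?_ ?_⟩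
  · obtain ⟨x, hx, hKx⟩ := exists_decaying_ne_zero hm_lt hβ
    have hK_ae : decaying m β =ᵐ[halfLine] 0 :=
      hK2.coeFn_toLp.symm.trans (by rw [hzero]; exact Lp.coeFn_zero ℂ 2 halfLine)
    exact hKx (eq_zero_of_ae_eq_zero hK.continuousOn hK_ae hx)
  · convert tendsto_wronskian_decaying_plus hm_gt hβ using 2
    linear_combination 2 * hc_mul
  · convert tendsto_wronskian_decaying_minus hm_lt hβ using 2
    linear_combination (-2 * κ) * hc_mul - 2 * h

/-! ### Square integrable solutions near `0` -/

/-- `u` is a solution of `L_α u = 0` on `]0,∞[` that is square integrable near `0`. -/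
structure IsL2Solution (α : ℂ) (u u₁ : ℝ → ℂ) : Prop where
  isSolution : IsSolution (potential α) u u₁
  memLp : ∀ ε : ℝ, 0 < ε → MemLp u 2 (volume.restrict (Ioo 0 ε))

theorem IsL2Solution.conj {α : ℂ} (hα : α.im = 0) {u u₁ : ℝ → ℂ} (hu : IsL2Solution α u u₁) :
    IsL2Solution α (fun x => conj (u x)) (fun x => conj (u₁ x)) :=
  ⟨hu.isSolution.conj.congr fun x => by rw [map_mul, conj_potential hα],
    fun ε hε => (hu.memLp ε hε).star⟩

theorem IsL2Solution.const_mul {α : ℂ} {u u₁ : ℝ → ℂ} (hu : IsL2Solution α u u₁) (c : ℂ) :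
    IsL2Solution α (fun x => c * u x) (fun x => c * u₁ x) :=
  ⟨(hu.isSolution.const_mul c).congr fun x => by ring, fun ε hε => (hu.memLp ε hε).const_mul c⟩

theorem norm_powFun_sq {w : ℂ} {x : ℝ} (hx : 0 < x) : ‖powFun w x‖ ^ 2 = x ^ (2 * w.re) := by
  rw [norm_powFun hx, mul_comm 2, Real.rpow_mul hx.le, Real.rpow_two]

theorem memLp_powFun {w : ℂ} (hw : -(1 / 2) < w.re) {ε : ℝ} (hε : 0 < ε) :
    MemLp (powFun w) 2 (volume.restrict (Ioo 0 ε)) := by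
  rw [memLp_two_iff_integrable_sq_norm (((continuousOn_powFun w).mono
    Ioo_subset_Ioi_self).aestronglyMeasurable measurableSet_Ioo)]
  have hint := intervalIntegral.intervalIntegrable_rpow' (a := 0) (b := ε)
    (show -1 < 2 * w.re by linarith)
  rw [intervalIntegrable_iff_integrableOn_Ioo_of_le hε.le] at hint
  exact hint.congr_fun (fun x hx => (norm_powFun_sq hx.1).symm) measurableSet_Ioo

theorem isL2Solution_powFun_half_add {m : ℂ} (hm : -1 < m.re) :
    IsL2Solution (m ^ 2) (powFun (1 / 2 + m)) (powDeriv (1 / 2 + m)) :=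
  ⟨isSolution_powFun_half_add m, fun _ => memLp_powFun (by simp; linarith)⟩

theorem isL2Solution_powFun_half_sub {m : ℂ} (hm : m.re < 1) :
    IsL2Solution (m ^ 2) (powFun (1 / 2 - m)) (powDeriv (1 / 2 - m)) :=
  ⟨isSolution_powFun_half_sub m, fun _ => memLp_powFun (by simp; linarith)⟩

theorem isL2Solution_boundaryFun {m : ℂ} (hm : |m.re| < 1) (κ : ℂ) :
    IsL2Solution (m ^ 2) (boundaryFun m (OnePoint.some κ)) (boundaryDeriv m κ) :=
  ⟨isSolution_boundaryFun m κ, fun ε hε =>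
    ((isL2Solution_powFun_half_sub (abs_lt.1 hm).2).memLp ε hε).add
      (((isL2Solution_powFun_half_add (abs_lt.1 hm).1).memLp ε hε).const_mul κ)⟩

theorem hasDerivAt_ofReal_log {x : ℝ} (hx : 0 < x) :
    HasDerivAt (fun y : ℝ => (Real.log y : ℂ)) (x : ℂ)⁻¹ x := by
  simpa using (Real.hasDerivAt_log hx.ne').ofReal_comp

theorem isSolution_log_mul_powFun : IsSolution (potential 0)
    (fun x => (Real.log x : ℂ) * powFun (1 / 2) x)
    (fun x => powFun (1 / 2) x / x + Real.log x * powDeriv (1 / 2) x) where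
  hasDerivAt x hx := by
    refine ((hasDerivAt_ofReal_log hx).mul (hasDerivAt_powFun hx (1 / 2))).congr_deriv ?_
    ring
  hasDerivAt_deriv x hx := by
    have hx' : (x : ℂ) ≠ 0 := by exact_mod_cast hx.ne'
    have hpow := hasDerivAt_powFun hx (1 / 2)
    have hid : HasDerivAt (fun y : ℝ => (y : ℂ)) 1 x := (hasDerivAt_id x).ofReal_comp
    refine ((hpow.div hid hx').add ((hasDerivAt_ofReal_log hx).mul
      ((hpow.const_mul (1 / 2)).div hid hx'))).congr_deriv ?_
    simp only [potential, Pi.div_apply]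
    field_simp
    ring
  continuousOn_deriv_deriv := (continuousOn_potential 0).mul <|
    ContinuousOn.mul (fun _ hx => (hasDerivAt_ofReal_log hx).continuousAt.continuousWithinAt)
      (continuousOn_powFun _)

theorem memLp_log_mul_powFun (ε : ℝ) :
    MemLp (fun x : ℝ => (Real.log x : ℂ) * powFun (1 / 2) x) 2 (volume.restrict (Ioo 0 ε)) := by
  have hcont : Continuous fun x : ℝ => 2 * (√x * Real.log √x) :=
    continuous_const.mul (Real.continuous_mul_log.comp Real.continuous_sqrt)
  obtain ⟨C, hC⟩ := (isCompact_Icc (a := 0) (b := ε)).exists_bound_of_continuousOn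
    hcont.continuousOn
  refine MemLp.of_bound ((isSolution_log_mul_powFun.continuousOn.mono
    Ioo_subset_Ioi_self).aestronglyMeasurable measurableSet_Ioo) C ?_
  filter_upwards [ae_restrict_mem measurableSet_Ioo] with x hx
  have hsqrt : x ^ (1 / 2 : ℂ).re = √x := by
    rw [Real.sqrt_eq_rpow]
    norm_num
  calc ‖(Real.log x : ℂ) * powFun (1 / 2) x‖
      = |Real.log x| * √x := by
        rw [norm_mul, Complex.norm_real, Real.norm_eq_abs, norm_powFun hx.1, hsqrt]
    _ = ‖2 * (√x * Real.log √x)‖ := by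
        rw [Real.log_sqrt hx.1.le, show 2 * (√x * (Real.log x / 2)) = Real.log x * √x by ring,
          norm_mul, Real.norm_eq_abs, Real.norm_of_nonneg (Real.sqrt_nonneg x)]
    _ ≤ C := hC x (Ioo_subset_Icc_self hx)

theorem wronskian_powFun_log_mul_powFun {x : ℝ} (hx : 0 < x) :
    wronskian (powFun (1 / 2)) (powDeriv (1 / 2)) (fun x => (Real.log x : ℂ) * powFun (1 / 2) x)
      (fun x => powFun (1 / 2) x / x + Real.log x * powDeriv (1 / 2) x) x = 1 := by
  have hx' : (x : ℂ) ≠ 0 := by exact_mod_cast hx.ne'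
  have hsq : powFun (1 / 2) x * powFun (1 / 2) x = x := by
    simpa only [add_zero, sub_zero] using powFun_half_add_mul_powFun_half_sub 0 hx
  calc wronskian (powFun (1 / 2)) (powDeriv (1 / 2)) (fun x => (Real.log x : ℂ) * powFun (1 / 2) x)
        (fun x => powFun (1 / 2) x / x + Real.log x * powDeriv (1 / 2) x) x
      = powFun (1 / 2) x * powFun (1 / 2) x / x := by
        simp only [wronskian]
        ring
    _ = 1 := by rw [hsq, div_self hx']

theorem exists_isL2Solution_wronskian_eq {m : ℂ} (hm : |m.re| < 1) :
    ∃ (U U₁ V V₁ : ℝ → ℂ) (w : ℂ), w ≠ 0 ∧ IsL2Solution (m ^ 2) U U₁ ∧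
      IsL2Solution (m ^ 2) V V₁ ∧ ∀ x, 0 < x → wronskian U U₁ V V₁ x = w := by
  have hadd := isL2Solution_powFun_half_add (abs_lt.1 hm).1
  rcases eq_or_ne m 0 with rfl | hm0
  · rw [add_zero] at hadd
    refine ⟨_, _, _, _, 1, one_ne_zero, hadd, ?_, fun x hx => wronskian_powFun_log_mul_powFun hx⟩
    rw [zero_pow two_ne_zero]
    exact ⟨isSolution_log_mul_powFun, fun ε _ => memLp_log_mul_powFun ε⟩
  · exact ⟨_, _, _, _, 2 * m, mul_ne_zero two_ne_zero hm0,
      isL2Solution_powFun_half_sub (abs_lt.1 hm).2, hadd, fun x hx => wronskian_powFun m hx⟩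

/-! ### Eigenfunctions and the decaying solution -/

/-- `D` has vanishing Wronskian at `0` with all solutions of `L_α u = 0` that are square integrable
near `0`; by integration by parts this holds if `D` agrees near `0` with an element of
`Dom(L_α^min)`. -/
def HasZeroBoundaryValues (α : ℂ) (D D₁ : ℝ → ℂ) : Prop :=
  ∀ u u₁, IsL2Solution α u u₁ → Tendsto (wronskian D D₁ u u₁) (𝓝[>] 0) (𝓝 0)

/-- The boundary condition given by the solution `b` is symmetric: the Wronskian of `b` and its
complex conjugate vanishes. -/
def IsSymmetricBoundary (b b₁ : ℝ → ℂ) : Prop :=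
  ∀ x, 0 < x → wronskian b b₁ (fun x => conj (b x)) (fun x => conj (b₁ x)) x = 0

namespace HasZeroBoundaryValues

variable {α : ℂ} {D D₁ F F₁ b b₁ : ℝ → ℂ} {c : ℂ}

theorem const_mul (hD : HasZeroBoundaryValues α D D₁) (a : ℂ) :
    HasZeroBoundaryValues α (fun x => a * D x) (fun x => a * D₁ x) := fun u u₁ hu => by
  rw [← mul_zero a]
  refine ((hD u u₁ hu).const_mul a).congr fun x => ?_
  simp only [wronskian]
  ring

theorem congr (hD : HasZeroBoundaryValues α D D₁)
    (h : ∀ x, 0 < x → F x = D x ∧ F₁ x = D₁ x) : HasZeroBoundaryValues α F F₁ := fun u u₁ hu =>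
  (hD u u₁ hu).congr' <| by
    filter_upwards [self_mem_nhdsWithin] with x hx
    simp only [wronskian, h x hx]

theorem tendsto_wronskian_conj_right (hα : α.im = 0) (hD : HasZeroBoundaryValues α D D₁)
    {u u₁ : ℝ → ℂ} (hu : IsL2Solution α u u₁) :
    Tendsto (wronskian u u₁ (fun x => conj (D x)) (fun x => conj (D₁ x))) (𝓝[>] 0) (𝓝 0) := by
  have hlim := ((Complex.continuous_conj.tendsto 0).comp (hD _ _ (hu.conj hα))).neg
  rw [map_zero, neg_zero] at hlim
  refine hlim.congr fun x => ?_
  simp only [Function.comp_apply, wronskian, map_sub, map_mul, Complex.conj_conj]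
  ring

theorem tendsto_wronskian_conj_self {m : ℂ} (hα : (m ^ 2).im = 0) (hm : |m.re| < 1)
    (hD : HasZeroBoundaryValues (m ^ 2) D D₁) :
    Tendsto (wronskian D D₁ (fun x => conj (D x)) (fun x => conj (D₁ x))) (𝓝[>] 0) (𝓝 0) := by
  obtain ⟨U, U₁, V, V₁, w, hw0, hU, hV, hw⟩ := exists_isL2Solution_wronskian_eq hm
  have hlim := (((hD.tendsto_wronskian_conj_right hα hU).mul (hD V V₁ hV)).sub
    ((hD.tendsto_wronskian_conj_right hα hV).mul (hD U U₁ hU))).const_mul w⁻¹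
  rw [mul_zero, sub_zero, mul_zero] at hlim
  refine hlim.congr' ?_
  filter_upwards [self_mem_nhdsWithin] with x hx
  -- the Plücker relation between the Wronskians of `D`, `conj D`, `U` and `V`
  rw [inv_mul_eq_iff_eq_mul₀ hw0, ← hw x hx]
  simp only [wronskian]
  ring

theorem tendsto_wronskian_conj {m : ℂ} (hα : (m ^ 2).im = 0) (hm : |m.re| < 1)
    (hb : IsL2Solution (m ^ 2) b b₁) (hbb : IsSymmetricBoundary b b₁)
    (hD : HasZeroBoundaryValues (m ^ 2) (fun x => F x - c * b x) (fun x => F₁ x - c * b₁ x)) :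
    Tendsto (wronskian F F₁ (fun x => conj (F x)) (fun x => conj (F₁ x))) (𝓝[>] 0) (𝓝 0) := by
  have hlim := ((hD.tendsto_wronskian_conj_self hα hm).add
    ((hD _ _ (hb.conj hα)).const_mul (conj c))).add
      ((hD.tendsto_wronskian_conj_right hα hb).const_mul c)
  rw [mul_zero, add_zero, mul_zero, add_zero] at hlim
  refine hlim.congr' ?_
  filter_upwards [self_mem_nhdsWithin] with x hx
  have hbx := hbb x hx
  simp only [wronskian] at hbx
  simp only [wronskian, map_sub, map_mul]
  linear_combination (-c * conj c) * hbx

theorem eq_zero_of_isSolution {m : ℂ} (hm : |m.re| < 1) (hD : HasZeroBoundaryValues (m ^ 2) D D₁)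
    (hsol : IsSolution (potential (m ^ 2)) D D₁) {x : ℝ} (hx : 0 < x) : D x = 0 := by
  obtain ⟨U, U₁, V, V₁, w, hw0, hU, hV, hw⟩ := exists_isL2Solution_wronskian_eq hm
  have hW {u u₁ : ℝ → ℂ} (hu : IsL2Solution (m ^ 2) u u₁) : wronskian D D₁ u u₁ x = 0 := by
    refine tendsto_nhds_unique (tendsto_const_nhds.congr' ?_) (hD u u₁ hu)
    filter_upwards [self_mem_nhdsWithin] with y hy
    exact hsol.wronskian_eq hu.isSolution hx hy
  have hcramer : w * D x = U x * wronskian D D₁ V V₁ x - V x * wronskian D D₁ U U₁ x := by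
    rw [← hw x hx]
    simp only [wronskian]
    ring
  rw [hW hU, hW hV, mul_zero, mul_zero, sub_zero] at hcramer
  exact (mul_eq_zero.1 hcramer).resolve_left hw0

end HasZeroBoundaryValues

theorem IsSolution.exists_eq_mul {F F₁ K K₁ p : ℝ → ℂ} (hF : IsSolution p F F₁)
    (hK : IsSolution p K K₁) (hp : ContinuousOn p (Ioi 0)) (hW : wronskian F F₁ K K₁ 1 = 0)
    (hK0 : ∃ x, 0 < x ∧ K x ≠ 0) : ∃ a, ∀ x, 0 < x → F x = a * K x ∧ F₁ x = a * K₁ x := by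
  have hinitial : ∃ a, F 1 = a * K 1 ∧ F₁ 1 = a * K₁ 1 := by
    simp only [wronskian] at hW
    by_cases hK1 : K 1 = 0
    · have hK₁1 : K₁ 1 ≠ 0 := fun h => by
        obtain ⟨x, hx, hKx⟩ := hK0
        exact hKx (hK.eq_zero_of_initial hp one_pos hK1 h hx)
      rw [hK1, mul_zero, sub_zero] at hW
      refine ⟨F₁ 1 / K₁ 1, ?_, (div_mul_cancel₀ _ hK₁1).symm⟩
      rw [hK1, mul_zero, (mul_eq_zero.1 hW).resolve_right hK₁1]
    · refine ⟨F 1 / K 1, (div_mul_cancel₀ _ hK1).symm, ?_⟩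
      rw [div_mul_eq_mul_div, eq_div_iff hK1]
      exact (sub_eq_zero.1 hW).symm
  obtain ⟨a, hFa, hF₁a⟩ := hinitial
  have hD : IsSolution p (fun x => F x - a * K x) (fun x => F₁ x - a * K₁ x) :=
    (hF.sub (hK.const_mul a)).congr fun x => by ring
  have hD0 (x : ℝ) (hx : 0 < x) : F x - a * K x = 0 :=
    hD.eq_zero_of_initial hp one_pos (sub_eq_zero.2 hFa) (sub_eq_zero.2 hF₁a) hx
  exact ⟨a, fun x hx => ⟨sub_eq_zero.1 (hD0 x hx), sub_eq_zero.1 (hD.deriv_eq_zero hD0 hx)⟩⟩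

theorem memLp_restrict_Ioi_one {F : ℝ → ℂ} (hF : MemLp F 2 halfLine) :
    MemLp F 2 (volume.restrict (Ioi 1)) :=
  hF.mono_measure (Measure.restrict_mono (Ioi_subset_Ioi zero_le_one) le_rfl)

theorem IsSolution.exists_eq_mul_decaying {m : ℂ} (hm : |m.re| < 1) {β : ℝ} (hβ : 0 < β)
    {F F₁ : ℝ → ℂ} (hF : IsSolution (fun x => potential (m ^ 2) x - (-4 * β : ℂ)) F F₁)
    (hF2 : MemLp F 2 (volume.restrict (Ioi 1))) :
    ∃ a, ∀ x, 0 < x → F x = a * decaying m β x ∧ F₁ x = a * decayingDeriv m β x :=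
  hF.exists_eq_mul (isSolution_decaying m hβ) (continuousOn_potential_sub _ _)
    (hF.wronskian_eq_zero (isSolution_decaying m hβ) one_pos
      (fun _ ht => norm_potential_sub_le _ _ ht) hF2
      (memLp_restrict_Ioi_one (memLp_decaying hm hβ)) one_pos)
    (exists_decaying_ne_zero (abs_lt.1 hm).2 hβ)

theorem exists_isSolution_of_mem_eigenvalues {m z : ℂ} {κ : OnePoint ℂ} {b₁ : ℝ → ℂ}
    (hb : IsSolution (potential (m ^ 2)) (boundaryFun m κ) b₁)
    (hz : z ∈ eigenvalues (almostHomOp m κ)) :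
    ∃ (F F₁ : ℝ → ℂ) (c : ℂ), IsSolution (fun x => potential (m ^ 2) x - z) F F₁ ∧
      MemLp F 2 (volume.restrict (Ioi 1)) ∧ (∃ x, 0 < x ∧ F x ≠ 0) ∧
      HasZeroBoundaryValues (m ^ 2) (fun x => F x - c * boundaryFun m κ x)
        (fun x => F₁ x - c * b₁ x) := by
  obtain ⟨f, hf0, hfmax, c, h, hh, ε, hε, hfh⟩ := mem_eigenvalues_iff.1 hz
  obtain ⟨F, F₁, hF, hfF⟩ := exists_isSolution_of_mem_maxGraph hfmax
  obtain ⟨g, hg⟩ := LinearPMap.mem_domain_iff.1 hh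
  refine ⟨F, F₁, c, hF, memLp_restrict_Ioi_one ((memLp_congr_ae hfF).1 (Lp.memLp f)), ?_,
    fun u u₁ hu => ?_⟩
  · by_contra! hF0
    have hF_ae : F =ᵐ[halfLine] 0 := by
      filter_upwards [ae_restrict_mem measurableSet_Ioi] with x hx using hF0 x hx
    exact hf0 (Lp.ext ((hfF.trans hF_ae).trans (Lp.coeFn_zero ℂ 2 halfLine).symm))
  · refine (hF.sub (hb.const_mul c)).tendsto_wronskian_of_mem_minOp_graph hg hε ?_
      hu.isSolution (hu.memLp ε hε)
    filter_upwards [hfh, hfF] with x hfhx hfFx hx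
    rw [← hfFx, hfhx hx]

section SymmetricBoundary

variable {m z : ℂ} {κ : OnePoint ℂ} {b₁ : ℝ → ℂ}

theorem exists_eq_ofReal_neg_of_mem_eigenvalues (hα : (m ^ 2).im = 0) (hm : |m.re| < 1)
    (hb : IsL2Solution (m ^ 2) (boundaryFun m κ) b₁)
    (hbb : IsSymmetricBoundary (boundaryFun m κ) b₁)
    (hinf : ∀ c : ℂ, MemLp (fun x => c * boundaryFun m κ x) 2 (volume.restrict (Ioi 1)) → c = 0)
    (hz : z ∈ eigenvalues (almostHomOp m κ)) : ∃ β : ℝ, 0 < β ∧ z = -4 * β := by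
  obtain ⟨F, F₁, c, hF, hF2, ⟨x, hx, hFx⟩, hD⟩ :=
    exists_isSolution_of_mem_eigenvalues hb.isSolution hz
  have him : z.im = 0 := by
    by_contra him
    exact hFx (hF.eq_zero_of_im_ne_zero hα him hF2 (hD.tendsto_wronskian_conj hα hm hb hbb) hx)
  obtain ⟨r, rfl⟩ : ∃ r : ℝ, z = r := ⟨z.re, Complex.ext rfl him⟩
  have hr_nonpos : r ≤ 0 := by
    by_contra! hr
    exact hFx (hF.eq_zero_of_pos hα hr hF2 hx)
  have hr_ne : r ≠ 0 := by
    rintro rfl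
    have hFb (x : ℝ) (hx : 0 < x) : F x = c * boundaryFun m κ x :=
      sub_eq_zero.1 (hD.eq_zero_of_isSolution hm
        ((hF.sub (hb.isSolution.const_mul c)).congr fun x => by push_cast; ring) hx)
    have hc : c = 0 := hinf c ((memLp_congr_ae (by
      filter_upwards [ae_restrict_mem measurableSet_Ioi] with x hx
      exact hFb x (one_pos.trans hx))).1 hF2)
    exact hFx (by rw [hFb x hx, hc, zero_mul])
  refine ⟨-r / 4, by linarith [hr_nonpos.lt_of_ne hr_ne], ?_⟩
  push_cast
  ring

theorem exists_hasZeroBoundaryValues_decaying (hm : |m.re| < 1) {β : ℝ} (hβ : 0 < β)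
    (hb : IsSolution (potential (m ^ 2)) (boundaryFun m κ) b₁)
    (hz : (-4 * β : ℂ) ∈ eigenvalues (almostHomOp m κ)) :
    ∃ c : ℂ, HasZeroBoundaryValues (m ^ 2) (fun x => decaying m β x - c * boundaryFun m κ x)
      (fun x => decayingDeriv m β x - c * b₁ x) := by
  obtain ⟨F, F₁, c, hF, hF2, ⟨x, hx, hFx⟩, hD⟩ := exists_isSolution_of_mem_eigenvalues hb hz
  obtain ⟨a, ha⟩ := hF.exists_eq_mul_decaying hm hβ hF2
  have ha0 : a ≠ 0 := by
    rintro rfl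
    exact hFx (by rw [(ha x hx).1, zero_mul])
  refine ⟨c / a, (hD.const_mul a⁻¹).congr fun x hx => ?_⟩
  rw [(ha x hx).1, (ha x hx).2]
  constructor <;> field_simp

end SymmetricBoundary

/-! ### The eigenvalue equation -/

theorem eq_zero_of_memLp_powFun {w c : ℂ} (hw : -(1 / 2) ≤ w.re)
    (h : MemLp (fun x => c * powFun w x) 2 (volume.restrict (Ioi 1))) : c = 0 := by
  by_contra hc
  have hpow : MemLp (powFun w) 2 (volume.restrict (Ioi 1)) := by
    simpa only [inv_mul_cancel_left₀ hc] using h.const_mul c⁻¹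
  have hint : IntegrableOn (fun x : ℝ => x ^ (2 * w.re)) (Ioi 1) :=
    IntegrableOn.congr_fun ((memLp_two_iff_integrable_sq_norm hpow.1).1 hpow)
      (fun x hx => norm_powFun_sq (one_pos.trans hx)) measurableSet_Ioi
  linarith [(integrableOn_Ioi_rpow_iff one_pos).1 hint]

theorem integrableOn_wronskian_euler_div {α : ℂ} {F F₁ : ℝ → ℂ}
    (hF : IsSolution (potential α) F F₁) (hF2 : MemLp F 2 (volume.restrict (Ioi 1))) :
    IntegrableOn (fun x : ℝ =>
      wronskian F F₁ (fun x => x * F₁ x) (fun x => F₁ x + x * (potential α x * F x)) x / x)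
      (Ioi 1) := by
  have hpot (x : ℝ) (hx : 1 ≤ x) : ‖potential α x‖ ≤ ‖-(1 / 4) + α‖ := by
    simpa using norm_potential_sub_le α 0 hx
  have hF₁2 := hF.memLp_deriv one_pos hpot hF2
  have hinv_le : ∀ᵐ x : ℝ ∂volume.restrict (Ioi 1), ‖(x : ℂ)⁻¹‖ ≤ 1 := by
    filter_upwards [ae_restrict_mem measurableSet_Ioi] with x (hx : 1 < x)
    rw [norm_inv, Complex.norm_real, Real.norm_of_nonneg (by linarith)]
    exact inv_le_one_of_one_le₀ hx.le
  have hpot_le : ∀ᵐ x : ℝ ∂volume.restrict (Ioi 1), ‖potential α x‖ ≤ ‖-(1 / 4) + α‖ := by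
    filter_upwards [ae_restrict_mem measurableSet_Ioi] with x hx using hpot x (le_of_lt hx)
  have hpot_meas : AEStronglyMeasurable (potential α) (volume.restrict (Ioi 1)) :=
    ((continuousOn_potential α).mono (Ioi_subset_Ioi zero_le_one)).aestronglyMeasurable
      measurableSet_Ioi
  refine IntegrableOn.congr_fun ((((hF2.integrable_mul hF₁2).bdd_mul
    Complex.measurable_ofReal.inv.aestronglyMeasurable hinv_le).add
    ((hF2.integrable_mul hF2).bdd_mul hpot_meas hpot_le)).sub (hF₁2.integrable_mul hF₁2))
    (fun x hx => ?_) measurableSet_Ioi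
  have hx' : (x : ℂ) ≠ 0 := by exact_mod_cast (one_pos.trans hx).ne'
  simp only [wronskian, Pi.add_apply, Pi.sub_apply, Pi.mul_apply, Pi.inv_apply]
  field_simp

theorem wronskian_euler_eq (m a₁ a₂ : ℂ) {x : ℝ} (hx : 0 < x) :
    wronskian (fun x => a₁ * powFun (1 / 2 - m) x + a₂ * powFun (1 / 2 + m) x)
      (fun x => a₁ * powDeriv (1 / 2 - m) x + a₂ * powDeriv (1 / 2 + m) x)
      (fun x => x * (a₁ * powDeriv (1 / 2 - m) x + a₂ * powDeriv (1 / 2 + m) x))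
      (fun x => a₁ * powDeriv (1 / 2 - m) x + a₂ * powDeriv (1 / 2 + m) x +
        x * (potential (m ^ 2) x * (a₁ * powFun (1 / 2 - m) x + a₂ * powFun (1 / 2 + m) x))) x =
      4 * m ^ 2 * (a₁ * a₂) := by
  have hx' : (x : ℂ) ≠ 0 := by exact_mod_cast hx.ne'
  rw [show 4 * m ^ 2 * (a₁ * a₂) = 4 * m ^ 2 * (a₁ * a₂) *
    (powFun (1 / 2 + m) x * powFun (1 / 2 - m) x / x) by
      rw [powFun_half_add_mul_powFun_half_sub m hx, div_self hx', mul_one]]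
  simp only [wronskian, potential]
  field_simp
  ring

/- The Euler field maps a solution `F` of `L_α F = 0` to another solution `x F'`. If `F` is square
integrable at infinity, then so is `F'`, hence the constant `W(F, x F')` has integrable quotient by
`x` and vanishes. -/
theorem mul_eq_zero_of_memLp {m a₁ a₂ : ℂ} (hm0 : m ≠ 0)
    (h : MemLp (fun x => a₁ * powFun (1 / 2 - m) x + a₂ * powFun (1 / 2 + m) x) 2
      (volume.restrict (Ioi 1))) : a₁ * a₂ = 0 := by
  have hF : IsSolution (potential (m ^ 2))
      (fun x => a₁ * powFun (1 / 2 - m) x + a₂ * powFun (1 / 2 + m) x)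
      (fun x => a₁ * powDeriv (1 / 2 - m) x + a₂ * powDeriv (1 / 2 + m) x) :=
    (((isSolution_powFun_half_sub m).const_mul a₁).add
      ((isSolution_powFun_half_add m).const_mul a₂)).congr fun x => by ring
  have hint : IntegrableOn (fun x : ℝ => 4 * m ^ 2 * (a₁ * a₂) / (x : ℂ)) (Ioi 1) :=
    (integrableOn_wronskian_euler_div hF h).congr_fun
      (fun x hx => congrArg (· / (x : ℂ)) (wronskian_euler_eq m a₁ a₂ (one_pos.trans hx)))
      measurableSet_Ioi
  by_contra hne
  have hconst : 4 * m ^ 2 * (a₁ * a₂) ≠ 0 :=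
    mul_ne_zero (mul_ne_zero (by norm_num) (pow_ne_zero 2 hm0)) hne
  have hrpow : IntegrableOn (fun x : ℝ => x ^ (-1 : ℝ)) (Ioi 1) :=
    IntegrableOn.congr_fun (hint.const_mul (4 * m ^ 2 * (a₁ * a₂))⁻¹).norm (fun x hx => by
      have hx0 : 0 < x := one_pos.trans hx
      rw [← mul_div_assoc, inv_mul_cancel₀ hconst, one_div, norm_inv, Complex.norm_real,
        Real.norm_of_nonneg hx0.le, Real.rpow_neg_one]) measurableSet_Ioi
  exact lt_irrefl _ ((integrableOn_Ioi_rpow_iff one_pos).1 hrpow)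

theorem eq_zero_of_memLp_boundaryFun {m κ c : ℂ} (hm0 : m ≠ 0) (hm : m.re < 1)
    (h : MemLp (fun x => c * boundaryFun m (OnePoint.some κ) x) 2 (volume.restrict (Ioi 1))) :
    c = 0 := by
  have hlin : (fun x => c * boundaryFun m (OnePoint.some κ) x) =
      fun x => c * powFun (1 / 2 - m) x + c * κ * powFun (1 / 2 + m) x := by
    ext x
    simp only [boundaryFun]
    ring
  rw [hlin] at h
  refine (mul_eq_zero.1 (mul_eq_zero_of_memLp hm0 h)).elim id fun hcκ => ?_
  simp only [hcκ, zero_mul, add_zero] at h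
  exact eq_zero_of_memLp_powFun (by simp; linarith) h

theorem mem_eigenvalues_iff_exists {m κ : ℂ} (hα : (m ^ 2).im = 0) (hm0 : m ≠ 0) (hm : |m.re| < 1)
    (hbb : IsSymmetricBoundary (boundaryFun m (OnePoint.some κ)) (boundaryDeriv m κ)) {z : ℂ} :
    z ∈ eigenvalues (almostHomOp m (OnePoint.some κ)) ↔ ∃ β : ℝ, 0 < β ∧ z = -4 * β ∧
      κ * (β : ℂ) ^ (-m) * Complex.Gamma (m + 1) + Complex.Gamma (1 - m) = 0 := by
  refine ⟨fun hz => ?_, ?_⟩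
  · obtain ⟨hm_gt, hm_lt⟩ := abs_lt.1 hm
    obtain ⟨β, hβ, rfl⟩ := exists_eq_ofReal_neg_of_mem_eigenvalues hα hm
      (isL2Solution_boundaryFun hm κ) hbb
      (fun c hc => eq_zero_of_memLp_boundaryFun hm0 hm_lt hc) hz
    obtain ⟨c, hc⟩ := exists_hasZeroBoundaryValues_decaying hm hβ (isSolution_boundaryFun m κ) hz
    have hadd : 2 * (β : ℂ) ^ (-m) * Complex.Gamma (m + 1) - c * (2 * m) = 0 := by
      refine tendsto_nhds_unique
        (((tendsto_wronskian_decaying_plus hm_gt hβ).sub_const _).congr' ?_)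
        (hc _ _ (isL2Solution_powFun_half_add hm_gt))
      filter_upwards [self_mem_nhdsWithin] with x hx
      rw [wronskian_sub_const_mul, wronskian_boundaryFun_powFun_half_add m κ hx]
    have hsub : 2 * Complex.Gamma (1 - m) - c * (-2 * m * κ) = 0 := by
      refine tendsto_nhds_unique
        (((tendsto_wronskian_decaying_minus hm_lt hβ).sub_const _).congr' ?_)
        (hc _ _ (isL2Solution_powFun_half_sub hm_lt))
      filter_upwards [self_mem_nhdsWithin] with x hx
      rw [wronskian_sub_const_mul, wronskian_boundaryFun_powFun_half_sub m κ hx]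
    exact ⟨β, hβ, rfl, by linear_combination (1 / 2) * hsub + κ / 2 * hadd⟩
  · rintro ⟨β, hβ, rfl, h⟩
    exact mem_eigenvalues_of_eq_zero hm0 hm hβ h

theorem conj_powFun {x : ℝ} (hx : 0 < x) (w : ℂ) : conj (powFun w x) = powFun (conj w) x := by
  rw [powFun, powFun, ofReal_cpow_eq_exp hx, ofReal_cpow_eq_exp hx, ← Complex.exp_conj, map_mul,
    Complex.conj_ofReal]

theorem conj_powDeriv {x : ℝ} (hx : 0 < x) (w : ℂ) :
    conj (powDeriv w x) = powDeriv (conj w) x := by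
  rw [powDeriv, map_div₀, map_mul, Complex.conj_ofReal]
  exact congrArg (fun u => conj w * u / (x : ℂ)) (conj_powFun hx w)

theorem conj_half : conj (1 / 2 : ℂ) = 1 / 2 := by
  rw [map_div₀, map_one, map_ofNat]

theorem conj_boundaryFun {m : ℂ} (κ : ℂ) {x : ℝ} (hx : 0 < x) :
    conj (boundaryFun m (OnePoint.some κ) x) =
      powFun (1 / 2 - conj m) x + conj κ * powFun (1 / 2 + conj m) x := by
  simp only [boundaryFun, map_add, map_mul]
  rw [conj_powFun hx, conj_powFun hx, map_sub, map_add, conj_half]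

theorem conj_boundaryDeriv {m : ℂ} (κ : ℂ) {x : ℝ} (hx : 0 < x) :
    conj (boundaryDeriv m κ x) =
      powDeriv (1 / 2 - conj m) x + conj κ * powDeriv (1 / 2 + conj m) x := by
  simp only [boundaryDeriv, map_add, map_mul]
  rw [conj_powDeriv hx, conj_powDeriv hx, map_sub, map_add, conj_half]

theorem isSymmetricBoundary_of_conj_eq {b b₁ : ℝ → ℂ} (hb : ∀ x, 0 < x → conj (b x) = b x)
    (hb₁ : ∀ x, 0 < x → conj (b₁ x) = b₁ x) : IsSymmetricBoundary b b₁ := fun x hx => by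
  simp only [wronskian, hb x hx, hb₁ x hx]
  ring

theorem isSymmetricBoundary_ofReal (m κ : ℝ) :
    IsSymmetricBoundary (boundaryFun m (OnePoint.some (κ : ℂ))) (boundaryDeriv m κ) :=
  isSymmetricBoundary_of_conj_eq
    (fun x hx => by rw [conj_boundaryFun _ hx, Complex.conj_ofReal, Complex.conj_ofReal]; rfl)
    (fun x hx => by rw [conj_boundaryDeriv _ hx, Complex.conj_ofReal, Complex.conj_ofReal])

theorem isSymmetricBoundary_of_norm_eq_one {m κ : ℂ} (hm : conj m = -m) (hκ : ‖κ‖ = 1) :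
    IsSymmetricBoundary (boundaryFun m (OnePoint.some κ)) (boundaryDeriv m κ) := fun x hx => by
  have hconj_smul : κ * conj κ = 1 := by simp [Complex.mul_conj', hκ]
  simp only [wronskian, conj_boundaryFun κ hx, conj_boundaryDeriv κ hx, hm, sub_neg_eq_add,
    ← sub_eq_add_neg]
  simp only [boundaryFun, boundaryDeriv]
  linear_combination (powFun (1 / 2 + m) x * powDeriv (1 / 2 - m) x -
    powDeriv (1 / 2 + m) x * powFun (1 / 2 - m) x) * hconj_smul

/-! ### Solving the eigenvalue equation -/

theorem eigenvalues_eq_empty {m : ℝ} (hm : |m| < 1) {κ : OnePoint ℂ} {a : ℂ} (ha : a ≠ 0)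
    (h : boundaryFun m κ = fun x => a * powFun (1 / 2 + m) x) :
    eigenvalues (almostHomOp m κ) = ∅ := by
  have hm' : |(m : ℂ).re| < 1 := by simpa using hm
  have hm_gt : -1 < (m : ℂ).re := (abs_lt.1 hm').1
  have hpow := isL2Solution_powFun_half_add hm_gt
  have hb : IsL2Solution ((m : ℂ) ^ 2) (boundaryFun m κ) (fun x => a * powDeriv (1 / 2 + m) x) :=
    h ▸ hpow.const_mul a
  have hsymm : IsSymmetricBoundary (boundaryFun m κ) (fun x => a * powDeriv (1 / 2 + m) x) := by
    intro x hx
    simp only [h, wronskian, map_mul, conj_powFun hx, conj_powDeriv hx, map_add, conj_half,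
      Complex.conj_ofReal]
    ring
  have hinf (c : ℂ) (hc : MemLp (fun x => c * boundaryFun m κ x) 2 (volume.restrict (Ioi 1))) :
      c = 0 := by
    simp only [h, ← mul_assoc] at hc
    refine (mul_eq_zero.1 (eq_zero_of_memLp_powFun ?_ hc)).resolve_right ha
    simp only [Complex.add_re, one_div, Complex.inv_re, Complex.re_ofNat, Complex.normSq_ofNat]
    linarith
  refine eq_empty_iff_forall_notMem.2 fun z hz => ?_
  obtain ⟨β, hβ, rfl⟩ := exists_eq_ofReal_neg_of_mem_eigenvalues
    (by rw [← Complex.ofReal_pow, Complex.ofReal_im]) hm' hb hsymm hinf hz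
  obtain ⟨c, hc⟩ := exists_hasZeroBoundaryValues_decaying hm' hβ hb.isSolution hz
  have hzero : 2 * (β : ℂ) ^ (-m : ℂ) * Complex.Gamma (m + 1) = 0 := by
    refine tendsto_nhds_unique
      ((tendsto_wronskian_decaying_plus hm_gt hβ).congr fun x => ?_) (hc _ _ hpow)
    simp only [h, wronskian]
    ring
  refine mul_ne_zero (mul_ne_zero two_ne_zero (ofReal_cpow_ne_zero hβ _))
    (Complex.Gamma_ne_zero_of_re_pos ?_) hzero
  rw [Complex.add_re, Complex.one_re]
  linarith

theorem mem_eigenvalues_real_iff {m κ : ℝ} (hm0 : m ≠ 0) (hm : |m| < 1) {z : ℂ} :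
    z ∈ eigenvalues (almostHomOp (m : ℂ) (OnePoint.some (κ : ℂ))) ↔ ∃ β : ℝ, 0 < β ∧ z = -4 * β ∧
      κ * β ^ (-m) * Real.Gamma (m + 1) + Real.Gamma (1 - m) = 0 := by
  rw [mem_eigenvalues_iff_exists (by rw [← Complex.ofReal_pow, Complex.ofReal_im])
    (by exact_mod_cast hm0) (by simpa using hm) (isSymmetricBoundary_ofReal m κ)]
  refine exists_congr fun β => and_congr_right fun hβ => and_congr_right fun _ => ?_
  have hGamma_add : Complex.Gamma (m + 1) = (Real.Gamma (m + 1) : ℂ) := by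
    rw [← Complex.Gamma_ofReal, Complex.ofReal_add, Complex.ofReal_one]
  have hGamma_sub : Complex.Gamma (1 - m) = (Real.Gamma (1 - m) : ℂ) := by
    rw [← Complex.Gamma_ofReal, Complex.ofReal_sub, Complex.ofReal_one]
  rw [← Complex.ofReal_neg, ← Complex.ofReal_cpow hβ.le, hGamma_add, hGamma_sub]
  exact_mod_cast Iff.rfl

theorem eigenvalues_some_eq_empty {m κ : ℝ} (hm : |m| < 1) (hκ : 0 ≤ κ) :
    eigenvalues (almostHomOp (m : ℂ) (OnePoint.some (κ : ℂ))) = ∅ := by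
  rcases eq_or_ne m 0 with rfl | hm0
  · refine eigenvalues_eq_empty hm (a := 1 + κ) (by exact_mod_cast (by positivity : 1 + κ ≠ 0)) ?_
    ext x
    simp only [boundaryFun, powFun, Complex.ofReal_zero, sub_zero, add_zero]
    ring
  · refine eq_empty_iff_forall_notMem.2 fun z hz => ?_
    obtain ⟨β, hβ, -, h⟩ := (mem_eigenvalues_real_iff hm0 hm).1 hz
    obtain ⟨hm_gt, hm_lt⟩ := abs_lt.1 hm
    have hGamma_add := Real.Gamma_pos_of_pos (by linarith : 0 < m + 1)
    have hGamma_sub := Real.Gamma_pos_of_pos (by linarith : 0 < 1 - m)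
    have hnonneg : 0 ≤ κ * β ^ (-m) * Real.Gamma (m + 1) := by positivity
    linarith

theorem eigenvalues_infty_eq_empty {m : ℝ} (hm : |m| < 1) :
    eigenvalues (almostHomOp (m : ℂ) OnePoint.infty) = ∅ :=
  eigenvalues_eq_empty hm one_ne_zero (funext fun _ => (one_mul _).symm)

theorem Gamma_mul_div_Gamma_neg {m : ℝ} (hm0 : m ≠ 0) (κ : ℝ) :
    κ * Real.Gamma m / Real.Gamma (-m) = -κ * Real.Gamma (m + 1) / Real.Gamma (1 - m) := by
  have hsub : Real.Gamma (1 - m) = -m * Real.Gamma (-m) := by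
    rw [← Real.Gamma_add_one (neg_ne_zero.2 hm0), neg_add_eq_sub]
  rw [Real.Gamma_add_one hm0, hsub, mul_left_comm, neg_mul, neg_mul, mul_neg,
    neg_div_neg_eq, mul_div_mul_left _ _ hm0]

theorem real_eigenvalue_equation_iff {m κ β : ℝ} (hm0 : m ≠ 0) (hG : Real.Gamma (1 - m) ≠ 0)
    (hβ : 0 < β) (hq : 0 ≤ κ * Real.Gamma m / Real.Gamma (-m)) :
    κ * β ^ (-m) * Real.Gamma (m + 1) + Real.Gamma (1 - m) = 0 ↔
      β = (κ * Real.Gamma m / Real.Gamma (-m)) ^ (1 / m) := by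
  have hcancel : β ^ (-m) * β ^ m = 1 := by
    rw [← Real.rpow_add hβ, neg_add_cancel, Real.rpow_zero]
  have hpow : κ * β ^ (-m) * Real.Gamma (m + 1) + Real.Gamma (1 - m) = 0 ↔
      β ^ m = κ * Real.Gamma m / Real.Gamma (-m) := by
    rw [Gamma_mul_div_Gamma_neg hm0, eq_div_iff hG]
    constructor <;> intro h
    · linear_combination β ^ m * h - κ * Real.Gamma (m + 1) * hcancel
    · linear_combination β ^ (-m) * h - Real.Gamma (1 - m) * hcancel
  rw [hpow, one_div, ← Real.rpow_left_inj hβ.le (Real.rpow_nonneg hq _) hm0,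
    Real.rpow_inv_rpow hq hm0]

theorem eigenvalues_of_neg {m κ : ℝ} (hm0 : m ≠ 0) (hm : |m| < 1) (hκ : κ < 0) :
    eigenvalues (almostHomOp (m : ℂ) (OnePoint.some (κ : ℂ))) =
      {((-4 * (κ * Real.Gamma m / Real.Gamma (-m)) ^ (1 / m) : ℝ) : ℂ)} := by
  obtain ⟨hm_gt, hm_lt⟩ := abs_lt.1 hm
  have hGamma_add := Real.Gamma_pos_of_pos (by linarith : 0 < m + 1)
  have hGamma_sub := Real.Gamma_pos_of_pos (by linarith : 0 < 1 - m)
  have hq : 0 < κ * Real.Gamma m / Real.Gamma (-m) :=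
    Gamma_mul_div_Gamma_neg hm0 κ ▸ div_pos (mul_pos (neg_pos.2 hκ) hGamma_add) hGamma_sub
  have hroot (β : ℝ) (hβ : 0 < β) := real_eigenvalue_equation_iff hm0 hGamma_sub.ne' hβ hq.le
  ext z
  rw [mem_eigenvalues_real_iff hm0 hm, mem_singleton_iff, Complex.ofReal_mul]
  constructor
  · rintro ⟨β, hβ, rfl, h⟩
    rw [(hroot β hβ).1 h]
    norm_num
  · rintro rfl
    have hβ := Real.rpow_pos_of_pos hq (1 / m)
    exact ⟨_, hβ, by norm_num, (hroot _ hβ).2 rfl⟩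

section Imaginary

variable {μ : ℝ}

theorem Gamma_I_mul_ne_zero (hμ : μ ≠ 0) : Complex.Gamma (Complex.I * μ) ≠ 0 := by
  intro h
  have hadd := Complex.Gamma_add_one (Complex.I * μ) (by simpa using hμ)
  rw [h, mul_zero] at hadd
  exact Complex.Gamma_ne_zero_of_re_pos (by simp) hadd

theorem eigenvalue_equation_iff {m κ w : ℂ} (hm0 : m ≠ 0) (hκ0 : κ ≠ 0)
    (hG : Complex.Gamma m ≠ 0) :
    κ * w * Complex.Gamma (m + 1) + Complex.Gamma (1 - m) = 0 ↔
      w = Complex.Gamma (-m) / (κ * Complex.Gamma m) := by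
  have hadd := Complex.Gamma_add_one m hm0
  have hsub : Complex.Gamma (1 - m) = -m * Complex.Gamma (-m) := by
    rw [← Complex.Gamma_add_one _ (neg_ne_zero.2 hm0), neg_add_eq_sub]
  rw [eq_div_iff (mul_ne_zero hκ0 hG), hadd, hsub]
  constructor <;> intro h
  · exact mul_left_cancel₀ hm0 (by linear_combination h)
  · linear_combination m * h

theorem cpow_neg_I_mul_eq_exp_iff (hμ : μ ≠ 0) (α : ℝ) {β : ℝ} (hβ : 0 < β) :
    (β : ℂ) ^ (-(Complex.I * μ)) = Complex.exp (Complex.I * α) ↔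
      ∃ n : ℤ, Real.exp (-((α + 2 * Real.pi * n) / μ)) = β := by
  rw [ofReal_cpow_eq_exp hβ, Complex.exp_eq_exp_iff_exists_int]
  refine exists_congr fun n => ?_
  have hleft : (Real.log β : ℂ) * -(Complex.I * μ) =
      Complex.I * ((Real.log β * -μ : ℝ) : ℂ) := by
    push_cast
    ring
  have hright : Complex.I * α + n * (2 * Real.pi * Complex.I) =
      Complex.I * ((α + 2 * Real.pi * n : ℝ) : ℂ) := by
    push_cast
    ring
  rw [hleft, hright, mul_right_inj' Complex.I_ne_zero, Complex.ofReal_inj, mul_neg,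
    neg_eq_iff_eq_neg, ← eq_div_iff hμ, neg_div, eq_comm, ← Real.exp_eq_exp, Real.exp_log hβ]

theorem eigenvalues_imaginary (hμ : μ ≠ 0) {κ : ℂ} (hκ : ‖κ‖ = 1) {α : ℝ}
    (hα : Complex.exp (Complex.I * α) =
      Complex.Gamma (-(Complex.I * μ)) / (κ * Complex.Gamma (Complex.I * μ))) :
    eigenvalues (almostHomOp (Complex.I * μ) (OnePoint.some κ)) =
      Set.range fun n : ℤ => ((-4 * Real.exp (-((α + 2 * Real.pi * n) / μ)) : ℝ) : ℂ) := by
  have hm0 : Complex.I * μ ≠ 0 := by simpa using hμ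
  have hκ0 : κ ≠ 0 := norm_ne_zero_iff.1 (hκ ▸ one_ne_zero)
  have hsq : ((Complex.I * μ : ℂ) ^ 2).im = 0 := by
    rw [mul_pow, Complex.I_sq, ← Complex.ofReal_pow, neg_one_mul, ← Complex.ofReal_neg,
      Complex.ofReal_im]
  ext z
  rw [mem_eigenvalues_iff_exists hsq hm0 (by simp)
    (isSymmetricBoundary_of_norm_eq_one (by simp) hκ)]
  simp only [eigenvalue_equation_iff hm0 hκ0 (Gamma_I_mul_ne_zero hμ), ← hα, mem_range,
    Complex.ofReal_mul]
  constructor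
  · rintro ⟨β, hβ, rfl, h⟩
    obtain ⟨n, rfl⟩ := (cpow_neg_I_mul_eq_exp_iff hμ α hβ).1 h
    exact ⟨n, by norm_num⟩
  · rintro ⟨n, rfl⟩
    exact ⟨_, Real.exp_pos _, by norm_num,
      (cpow_neg_I_mul_eq_exp_iff hμ α (Real.exp_pos _)).2 ⟨n, rfl⟩⟩

theorem exists_exp_eq_Gamma_div (hμ : μ ≠ 0) {κ : ℂ} (hκ : ‖κ‖ = 1) :
    ∃ α : ℝ, Complex.exp (Complex.I * α) =
      Complex.Gamma (-(Complex.I * μ)) / (κ * Complex.Gamma (Complex.I * μ)) := by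
  have hconj : conj (Complex.I * μ) = -(Complex.I * μ) := by simp
  have hnorm : ‖Complex.Gamma (-(Complex.I * μ)) / (κ * Complex.Gamma (Complex.I * μ))‖ = 1 := by
    rw [norm_div, norm_mul, hκ, one_mul, ← hconj, Complex.Gamma_conj, Complex.norm_conj]
    exact div_self (norm_ne_zero_iff.2 (Gamma_I_mul_ne_zero hμ))
  simpa only [mul_comm] using (Complex.norm_eq_one_iff _).1 hnorm

theorem infinite_setOf_lt_add_mul (a M : ℝ) {d : ℝ} (hd : d ≠ 0) :
    {n : ℤ | M < a + d * n}.Infinite := by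
  rcases hd.lt_or_gt with hneg | hpos
  · obtain ⟨N, hN⟩ := exists_int_lt ((M - a) / d)
    refine (Set.Iio_infinite N).mono fun n (hn : n < N) => ?_
    have hlt := (lt_div_iff_of_neg' hneg).1 ((Int.cast_lt.2 hn).trans hN)
    exact sub_lt_iff_lt_add'.1 hlt
  · obtain ⟨N, hN⟩ := exists_int_gt ((M - a) / d)
    refine (Set.Ioi_infinite N).mono fun n (hn : N < n) => ?_
    have hlt := (div_lt_iff₀' hpos).1 (hN.trans (Int.cast_lt.2 hn))
    exact sub_lt_iff_lt_add'.1 hlt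

theorem injective_neg_four_mul_exp (hμ : μ ≠ 0) (α : ℝ) :
    Function.Injective fun n : ℤ => -4 * Real.exp (-((α + 2 * Real.pi * n) / μ)) := by
  intro n k h
  have hexp := Real.exp_injective (mul_left_cancel₀ (by norm_num) h)
  have hadd := (div_left_inj' hμ).1 (neg_injective hexp)
  exact_mod_cast mul_left_cancel₀ (by positivity : 2 * Real.pi ≠ 0) (add_left_cancel hadd)

theorem infinite_eigenvalues_lt (hμ : μ ≠ 0) {κ : ℂ} (hκ : ‖κ‖ = 1) (R : ℝ) :
    {E : ℝ | E < R ∧ (E : ℂ) ∈ eigenvalues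
      (almostHomOp (Complex.I * μ) (OnePoint.some κ))}.Infinite := by
  obtain ⟨α, hα⟩ := exists_exp_eq_Gamma_div hμ hκ
  rw [eigenvalues_imaginary hμ hκ hα]
  refine ((infinite_setOf_lt_add_mul (-α / μ) |R| (d := -2 * Real.pi / μ)
    (by simp [hμ, Real.pi_ne_zero])).image (injective_neg_four_mul_exp hμ α).injOn).mono ?_
  rintro _ ⟨n, hn, rfl⟩
  refine ⟨?_, n, rfl⟩
  have hlt : |R| < -((α + 2 * Real.pi * n) / μ) := lt_of_lt_of_eq hn (by ring)
  have hexp := Real.add_one_le_exp (-((α + 2 * Real.pi * n) / μ))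
  beta_reduce
  linarith [neg_abs_le R, abs_nonneg R]

theorem infinite_eigenvalues_Ioo (hμ : μ ≠ 0) {κ : ℂ} (hκ : ‖κ‖ = 1) {ε : ℝ} (hε : 0 < ε) :
    {E : ℝ | -ε < E ∧ E < 0 ∧ (E : ℂ) ∈ eigenvalues
      (almostHomOp (Complex.I * μ) (OnePoint.some κ))}.Infinite := by
  obtain ⟨α, hα⟩ := exists_exp_eq_Gamma_div hμ hκ
  rw [eigenvalues_imaginary hμ hκ hα]
  refine ((infinite_setOf_lt_add_mul (α / μ) (-Real.log (ε / 4)) (d := 2 * Real.pi / μ)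
    (by simp [hμ, Real.pi_ne_zero])).image (injective_neg_four_mul_exp hμ α).injOn).mono ?_
  rintro _ ⟨n, hn, rfl⟩
  have hlt : -Real.log (ε / 4) < (α + 2 * Real.pi * n) / μ := lt_of_lt_of_eq hn (by ring)
  have hexp := (Real.lt_log_iff_exp_lt (by positivity)).1 (neg_lt.1 hlt)
  have hpos := Real.exp_pos (-((α + 2 * Real.pi * n) / μ))
  refine ⟨?_, ?_, n, rfl⟩ <;> beta_reduce <;> linarith

end Imaginary

end AlmostHomogeneous

end

theorem mainTheorem10 :
    -- no eigenvalues for real `m` and `κ ∈ [0,∞]`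
    (∀ m : ℝ, -1 < m → m < 1 →
      (∀ κ : ℝ, 0 ≤ κ →
        AlmostHomogeneous.eigenvalues
          (AlmostHomogeneous.almostHomOp (m : ℂ) (OnePoint.some (κ : ℂ))) = ∅) ∧
      AlmostHomogeneous.eigenvalues
        (AlmostHomogeneous.almostHomOp (m : ℂ) OnePoint.infty) = ∅) ∧
    -- a single eigenvalue for real `m ≠ 0` and `κ < 0`
    (∀ m : ℝ, -1 < m → m < 1 → m ≠ 0 → ∀ κ : ℝ, κ < 0 →
      AlmostHomogeneous.eigenvalues
          (AlmostHomogeneous.almostHomOp (m : ℂ) (OnePoint.some (κ : ℂ))) =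
        {((-4 * (κ * Real.Gamma m / Real.Gamma (-m)) ^ (1 / m) : ℝ) : ℂ)}) ∧
    -- infinitely many eigenvalues, accumulating at `-∞` and `0`, for `m = i μ`, `|κ| = 1`
    (∀ μ : ℝ, μ ≠ 0 → ∀ κ : ℂ, ‖κ‖ = 1 →
      (∀ R : ℝ, {E : ℝ | E < R ∧ (E : ℂ) ∈ AlmostHomogeneous.eigenvalues
          (AlmostHomogeneous.almostHomOp (Complex.I * μ) (OnePoint.some κ))}.Infinite) ∧
      (∀ ε : ℝ, 0 < ε → {E : ℝ | -ε < E ∧ E < 0 ∧ (E : ℂ) ∈ AlmostHomogeneous.eigenvalues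
          (AlmostHomogeneous.almostHomOp (Complex.I * μ) (OnePoint.some κ))}.Infinite) ∧
      (∀ α : ℝ, Complex.exp (Complex.I * α) =
            Complex.Gamma (-(Complex.I * μ)) / (κ * Complex.Gamma (Complex.I * μ)) →
        AlmostHomogeneous.eigenvalues
            (AlmostHomogeneous.almostHomOp (Complex.I * μ) (OnePoint.some κ)) =
          Set.range fun n : ℤ =>
            ((-4 * Real.exp (-((α + 2 * Real.pi * n) / μ)) : ℝ) : ℂ))) := by
  refine ⟨fun m hm_gt hm_lt => ⟨fun κ hκ => ?_, ?_⟩, fun m hm_gt hm_lt hm0 κ hκ => ?_,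
    fun μ hμ κ hκ => ⟨fun R => ?_, fun ε hε => ?_, fun α hα => ?_⟩⟩
  · exact AlmostHomogeneous.eigenvalues_some_eq_empty (abs_lt.2 ⟨hm_gt, hm_lt⟩) hκ
  · exact AlmostHomogeneous.eigenvalues_infty_eq_empty (abs_lt.2 ⟨hm_gt, hm_lt⟩)
  · exact AlmostHomogeneous.eigenvalues_of_neg hm0 (abs_lt.2 ⟨hm_gt, hm_lt⟩) hκ
  · exact AlmostHomogeneous.infinite_eigenvalues_lt hμ hκ R
  · exact AlmostHomogeneous.infinite_eigenvalues_Ioo hμ hκ hε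
  · exact AlmostHomogeneous.eigenvalues_imaginary hμ hκ hα
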